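/- Let $N\ge 1$, $\sigma\in(0,1)$, $s=1+\sigma$, and let $\Omega\subset\mathbb R^N$ be a bounded $C^{1,1}$ domain. Let $\mathcal P_1(\mathbb R^N)$ be the space of affine functions $p(x)=c_0+c\cdot x$ ($c_0\in\mathbb R$, $c\in\mathbb R^N$), put $Q(\Omega)=\mathbb R^{2N}\setminus(\mathbb R^N\setminus\Omega)^2$ and, for $u$ weakly differentiable on $\mathbb R^N$, $$D(u)^2=\iint_{Q(\Omega)}\frac{|\nabla u(x)-\nabla u(y)|^2}{|x-y|^{N+2\sigma}}\,dx\,dy .$$ Let $f\in L^2(\Omega)$, $g_2\in L^2(\partial\Omega)$ and $g_1\in L^1(\mathbb R^N\setminus\Omega,|x|^2dx)\cap L^1(\mathbb R^N\setminus\Omega)$. Put $d\mu_{g_1}=(\chi_\Omega+|g_1|\chi_{\mathbb R^N\setminus\Omega})\,dx$ and assume that $$\lambda_1(g_1)=\inf_{u}\ \frac{D(u)^2}{\int_{\mathbb R^N}u^2\,d\mu_{g_1}}>0,$$ where the infimum is over all weakly differentiable $u:\mathbb R^N\to\mathbb R$, $u\neq0$ (modulo null sets), with $D(u)<\infty$ and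 such that, for every $p\in\mathcal P_1(\mathbb R^N)$, $up$ is $\mu_{g_1}$-integrable with $\int_{\mathbb R^N} u\,p\,d\mu_{g_1}=0$ (the quotient is $0$ if its denominator is $\infty$, and $\infty$ if its denominator is $0$). Let $H^s_{\mathcal N(g_1,g_2)}(\Omega)$ be the space of weakly differentiable $u:\mathbb R^N\to\mathbb R$ with $$\int_\Omega u^2\,dx+D(u)^2+\int_{\mathbb R^N\setminus\Omega}|g_1|u^2\,dx<\infty .$$ A weak solution of the Neumann problem $$(-\Delta)^su=f\ \text{in }\Omega,\qquad \mathcal N^1_\sigma u=g_1\ \text{in }\mathbb R^N\setminus\overline\Omega,\qquad \mathcal N^2_\sigma u=g_2\ \text{on }\partial\Omega \tag{P}$$ is by definition a function $u\in H^s_{\mathcal N(g_1,g_2)}(\Omega)$ such that for all $v\in H^s_{\mathcal N(g_1,g_2)}(\Omega)$ $$\frac{c_{N,\sigma}}2\iint_{Q(\Omega)}\frac{(\nabla u(x)-\nabla u(y))\cdot(\nabla v(x)-\nabla v(y))}{|x-y|^{N+2\sigma}}\,dx\,dy=\int_\Omega fv\,dx+\int_{\mathbb R^N\setminus\Omega}g_1v\,dx+\int_{\partial\Omega}g_2v\,dS,$$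 where $c_{N,\sigma}=\Big(\int_{\mathbb R^N}\frac{1-\cos\xi_1}{|\xi|^{N+2\sigma}}\,d\xi\Big)^{-1}$ and, in the last integral, $v$ stands for its Sobolev trace in $L^2(\partial\Omega)$. Then (P) has a weak solution if and only if $$\int_\Omega fp\,dx+\int_{\mathbb R^N\setminus\Omega}g_1p\,dx+\int_{\partial\Omega}g_2p\,dS=0\qquad\text{for all }p\in\mathcal P_1(\mathbb R^N).$$ Moreover, the solution is then unique up to an affine function: if $u$ is a weak solution, then the weak solutions are exactly the functions that are almost everywhere equal to $u+p$ for some $p\in\mathcal P_1(\mathbb R^N)$. -/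

import Mathlib

open MeasureTheory Set Filter Topology
open scoped ENNReal NNReal

namespace FracNeumann

/-- Euclidean space `ℝ^N`. -/
abbrev Sp (N : ℕ) : Type := EuclideanSpace ℝ (Fin N)

/-- The affine functions `x ↦ c₀ + (c, x)` on `ℝ^N`. -/
def P1 (N : ℕ) : Set (Sp N → ℝ) :=
  {p | ∃ (c₀ : ℝ) (c : Sp N), ∀ x, p x = c₀ + inner ℝ c x}

/-- Bounded `C^{1,1}` domain: a bounded connected (nonempty) open set which near each of its
boundary points is, for a unit vector `ν`, the part of the space above the graph of a `C¹`
function with Lipschitz derivative, defined on the hyperplane orthogonal to `ν`. -/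
structure IsBoundedC11Domain {N : ℕ} (Ω : Set (Sp N)) : Prop where
  isOpen : IsOpen Ω
  isConnected : IsConnected Ω
  isBounded : Bornology.IsBounded Ω
  graph : ∀ x₀ ∈ frontier Ω, ∃ r > 0, ∃ ν : Sp N, ‖ν‖ = 1 ∧
    ∃ h : (Submodule.span ℝ {ν})ᗮ → ℝ, ContDiff ℝ 1 h ∧
      (∃ K : ℝ≥0, LipschitzWith K (fderiv ℝ h)) ∧
      ∀ y ∈ Metric.ball x₀ r,
        (y ∈ Ω ↔ h ((Submodule.span ℝ {ν})ᗮ.orthogonalProjectionOnto y) < inner ℝ ν y)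

/-- The surface measure `dS` on `∂Ω`: the `(N-1)`-dimensional Hausdorff measure, normalised to
agree with Lebesgue measure on `ℝ^(N-1)`, restricted to `∂Ω`. -/
noncomputable def surf {N : ℕ} (Ω : Set (Sp N)) : Measure (Sp N) :=
  (Measure.euclideanHausdorffMeasure (N - 1)).restrict (frontier Ω)

/-- `U` is the weak gradient of `u` on `ℝ^N` (tested in every direction `w`). -/
structure IsWeakGrad {N : ℕ} (u : Sp N → ℝ) (U : Sp N → Sp N) : Prop where
  locInt : LocallyIntegrable u volume
  locInt_grad : LocallyIntegrable U volume
  parts : ∀ φ : Sp N → ℝ, ContDiff ℝ ((⊤ : ℕ∞) : WithTop ℕ∞) φ → HasCompactSupport φ → ∀ w : Sp N,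
    ∫ x, inner ℝ (U x) w * φ x = - ∫ x, u x * fderiv ℝ φ x w

/-- `u` is weakly differentiable on `ℝ^N`. -/
def WeaklyDiff {N : ℕ} (u : Sp N → ℝ) : Prop := ∃ U, IsWeakGrad u U

open Classical in
/-- The weak gradient `∇u`, determined up to a null set (and `0` if `u` is not weakly
differentiable). -/
noncomputable def wgrad {N : ℕ} (u : Sp N → ℝ) : Sp N → Sp N :=
  if h : WeaklyDiff u then h.choose else 0

/-- `Q(Ω) = ℝ^{2N} ∖ (ℝ^N ∖ Ω)²`. -/
def Q {N : ℕ} (Ω : Set (Sp N)) : Set (Sp N × Sp N) := (Ωᶜ ×ˢ Ωᶜ)ᶜ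

/-- The energy `D(u)² = ∬_{Q(Ω)} |∇u(x) - ∇u(y)|² / |x - y|^{N+2σ} dx dy`, in `[0, ∞]`. -/
noncomputable def energy {N : ℕ} (σ : ℝ) (Ω : Set (Sp N)) (u : Sp N → ℝ) : ℝ≥0∞ :=
  ∫⁻ z in Q Ω,
    ENNReal.ofReal (‖wgrad u z.1 - wgrad u z.2‖ ^ 2 / ‖z.1 - z.2‖ ^ ((N : ℝ) + 2 * σ))

/-- The bilinear form `∬_{Q(Ω)} (∇u(x) - ∇u(y))·(∇v(x) - ∇v(y)) / |x - y|^{N+2σ} dx dy`. -/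
noncomputable def form {N : ℕ} (σ : ℝ) (Ω : Set (Sp N)) (u v : Sp N → ℝ) : ℝ :=
  ∫ z in Q Ω,
    inner ℝ (wgrad u z.1 - wgrad u z.2) (wgrad v z.1 - wgrad v z.2) /
      ‖z.1 - z.2‖ ^ ((N : ℝ) + 2 * σ)

/-- The space `Ḣ^s(Ω)`, `s = 1 + σ`. -/
def Hdot {N : ℕ} (σ : ℝ) (Ω : Set (Sp N)) : Set (Sp N → ℝ) :=
  {u | WeaklyDiff u ∧ energy σ Ω u < ⊤}

/-- The measure `dμ_{g₁} = (χ_Ω + |g₁| χ_{ℝ^N∖Ω}) dx`. -/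
noncomputable def mu {N : ℕ} (Ω : Set (Sp N)) (g₁ : Sp N → ℝ) : Measure (Sp N) :=
  volume.withDensity
    (Ω.indicator (fun _ => 1) + Ωᶜ.indicator (fun x => ENNReal.ofReal |g₁ x|))

/-- The space `H^{s,0}_{g₁}(Ω)` of the `u ∈ Ḣ^s(Ω)` with `∫ u p dμ_{g₁} = 0` (as a convergent
integral) for every affine `p`. -/
def Hzero {N : ℕ} (σ : ℝ) (Ω : Set (Sp N)) (g₁ : Sp N → ℝ) : Set (Sp N → ℝ) :=
  {u | u ∈ Hdot σ Ω ∧ ∀ p ∈ P1 N, Integrable (fun x => u x * p x) (mu Ω g₁) ∧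
    ∫ x, u x * p x ∂(mu Ω g₁) = 0}

/-- The Rayleigh infimum `λ₁(g₁) ∈ [0, ∞]` over the nonzero elements (modulo null sets) of
`H^{s,0}_{g₁}(Ω)`. The quotient is `0` when `∫ u² dμ_{g₁} = ∞`. -/
noncomputable def lambda1 {N : ℕ} (σ : ℝ) (Ω : Set (Sp N)) (g₁ : Sp N → ℝ) : ℝ≥0∞ :=
  ⨅ u ∈ {u | u ∈ Hzero σ Ω g₁ ∧ ¬ u =ᵐ[volume] 0},
    energy σ Ω u / ∫⁻ x, ENNReal.ofReal (u x ^ 2) ∂(mu Ω g₁)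

/-- Admissible data. Only the values of `f` on `Ω`, of `g₁` on `ℝ^N ∖ Ω` and of `g₂` on `∂Ω`
matter. -/
structure Admissible {N : ℕ} (σ : ℝ) (Ω : Set (Sp N)) (f g₁ g₂ : Sp N → ℝ) : Prop where
  f_L2 : MemLp f 2 (volume.restrict Ω)
  g₁_L1 : IntegrableOn g₁ Ωᶜ
  g₁_L1_weight : IntegrableOn (fun x => ‖x‖ ^ 2 * g₁ x) Ωᶜ
  g₁_spectral : 0 < lambda1 σ Ω g₁
  g₂_L2 : MemLp g₂ 2 (surf Ω)

/-- `‖u‖²` in `H^s_{N(g₁,g₂)}(Ω)`, with values in `[0, ∞]`. -/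
noncomputable def normSq {N : ℕ} (σ : ℝ) (Ω : Set (Sp N)) (g₁ u : Sp N → ℝ) : ℝ≥0∞ :=
  (∫⁻ x in Ω, ENNReal.ofReal (u x ^ 2)) + energy σ Ω u +
    ∫⁻ x in Ωᶜ, ENNReal.ofReal (|g₁ x| * u x ^ 2)

/-- The space `H^s_{N(g₁,g₂)}(Ω)`, `s = 1 + σ` (it does not depend on `g₂`). -/
def HN {N : ℕ} (σ : ℝ) (Ω : Set (Sp N)) (g₁ : Sp N → ℝ) : Set (Sp N → ℝ) :=
  {u | WeaklyDiff u ∧ normSq σ Ω g₁ u < ⊤}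

/-- `w ∈ L²(∂Ω)` is the Sobolev trace on `∂Ω` of the weakly differentiable function `v`: some
functions smooth up to the boundary converge to `v` in `H¹(Ω)` while their restrictions to `∂Ω`
converge to `w` in `L²(∂Ω)`. -/
def IsTrace {N : ℕ} (Ω : Set (Sp N)) (v w : Sp N → ℝ) : Prop :=
  MemLp w 2 (surf Ω) ∧ ∃ φ : ℕ → Sp N → ℝ, (∀ n, ContDiff ℝ ((⊤ : ℕ∞) : WithTop ℕ∞) (φ n)) ∧
    Tendsto (fun n => eLpNorm (φ n - v) 2 (volume.restrict Ω)) atTop (𝓝 0) ∧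
    Tendsto (fun n => eLpNorm (gradient (φ n) - wgrad v) 2 (volume.restrict Ω)) atTop (𝓝 0) ∧
    Tendsto (fun n => eLpNorm (φ n - w) 2 (surf Ω)) atTop (𝓝 0)

/-- The normalisation constant
`c_{N,σ} = (∫_{ℝ^N} (1 - cos ξ₁) / |ξ|^{N+2σ} dξ)⁻¹`. -/
noncomputable def cNs (N : ℕ) [NeZero N] (σ : ℝ) : ℝ :=
  (∫ ξ : Sp N, (1 - Real.cos (ξ 0)) / ‖ξ‖ ^ ((N : ℝ) + 2 * σ))⁻¹

/-- `u` is a weak solution of the Neumann problem with data `f`, `g₁`, `g₂`. The boundary term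
is taken in the sense of traces. -/
def IsWeakSol {N : ℕ} [NeZero N] (σ : ℝ) (Ω : Set (Sp N)) (f g₁ g₂ u : Sp N → ℝ) : Prop :=
  u ∈ HN σ Ω g₁ ∧ ∀ v ∈ HN σ Ω g₁, ∃ Tv : Sp N → ℝ, IsTrace Ω v Tv ∧
    cNs N σ / 2 * form σ Ω u v =
      (∫ x in Ω, f x * v x) + (∫ x in Ωᶜ, g₁ x * v x) + ∫ x, g₂ x * Tv x ∂(surf Ω)

end FracNeumann

/-! Solvability of a Neumann problem for the fractional Laplacian of order `1 + σ`, by the Riesz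
representation theorem and a spectral gap.

The energy `D(u)²` is the squared norm of `(x, y) ↦ ∇u(x) - ∇u(y)` in `L²` of the measure
`|x - y|^{-(N+2σ)} dx dy` on `Q(Ω)` (`energy_eq`, `form_eq`). So the weak formulation reads
`c ⟨Gu, Gv⟩ = ℓ(v)`, where `G` is the linear map `gradMap`, `c = c_{N,σ} / 2` and `ℓ` is the load
`∫_Ω f v + ∫_{Ωᶜ} g₁ v + ∫_{∂Ω} g₂ v`. Affine functions lie in the kernel of `G`; testing with them
gives the necessity of the compatibility condition. Conversely `G u = 0` forces `∇u` to be constant,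
hence `u` to be affine (`exists_ae_eq_aff_of_gradDiff_ae_eq_zero`), and this gives uniqueness up to
affine functions because `c_{N,σ} > 0` (`cNs_pos`).

For existence, every element of `H^s_N` is the sum of an affine function and an element of
`H^{s,0}_{g₁}`, by orthogonal projection in `L²(μ_{g₁})` (`exists_sub_aff_mem_Hzero`). When `ℓ`
vanishes on affine functions it is therefore enough to solve the equation on `H^{s,0}_{g₁}`. There
`λ₁(g₁) > 0` is the inequality `‖u‖_{L²(μ)} ≤ C D(u)` (`exists_eLpNorm_mu_le_of_lambda1_pos`), and
the Riesz theorem applies once two facts are known: `|ℓ(v)| ≤ C D(v)` (`exists_abs_load_le`), and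
the image of `H^{s,0}_{g₁}` under `G` is complete (`isClosed_map_hzeroSub`).

Both rest on one estimate: on every ball the `H¹` norm is bounded by `D(u) + ‖u‖_{L²(Ω)}`
(`exists_eLpNorm_H1_ball_le`). For `∇u`, compare with the mean `∫ η ∇u` for a smooth weight `η`
supported in `Ω`: the difference is an average of `∇u(y) - ∇u(x)` with `y ∈ Ω`, on which the kernel
is bounded below, and the mean itself is `-∫ u ∇η`. For `u`, use a Poincaré inequality that follows
from the translation estimate `‖u(· + h) - u‖ ≤ |h| ‖∇u‖`. Completeness follows since limits in `L²`
on balls preserve weak gradients. For the boundary term of `ℓ`, the trace inequality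
`‖φ‖_{L²(∂Ω)} ≤ C ‖φ‖_{H¹(Ω)}` is proved for smooth `φ` (`exists_eLpNorm_surf_le`), by integrating
along segments transversal to local graphs; it yields existence (through mollification), uniqueness,
linearity and boundedness of the trace.
-/

namespace FracNeumann

/-! ### Square integrals and Jensen's inequality -/

section Jensen

variable {X F : Type*} [MeasurableSpace X] [NormedAddCommGroup F]

theorem eLpNorm_two_sq (f : X → F) (μ : Measure X) :
    eLpNorm f 2 μ ^ 2 = ∫⁻ x, ‖f x‖ₑ ^ 2 ∂μ := by
  have h := eLpNorm_nnreal_pow_eq_lintegral (f := f) (μ := μ) (p := 2) two_ne_zero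
  simp only [NNReal.coe_ofNat, ENNReal.coe_ofNat] at h
  exact_mod_cast h

theorem eLpNorm_two_le_of_sq_le {Y G : Type*} [MeasurableSpace Y] [NormedAddCommGroup G]
    {f : X → F} {μ : Measure X} {g : Y → G} {ν : Measure Y} {C : ℝ≥0∞}
    (h : ∫⁻ x, ‖f x‖ₑ ^ 2 ∂μ ≤ C ^ 2 * ∫⁻ y, ‖g y‖ₑ ^ 2 ∂ν) :
    eLpNorm f 2 μ ≤ C * eLpNorm g 2 ν := by
  rw [← eLpNorm_two_sq, ← eLpNorm_two_sq, ← mul_pow] at h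
  exact (ENNReal.pow_le_pow_left_iff two_ne_zero).1 h

theorem exists_le_coe_sq {K : ℝ≥0∞} (hK : K ≠ ⊤) : ∃ C : ℝ≥0, K ≤ (C : ℝ≥0∞) ^ 2 := by
  refine ⟨max 1 K.toNNReal, ?_⟩
  -- a number which is at least one is at most its square
  have h1 : (1 : ℝ≥0∞) ≤ ((max 1 K.toNNReal : ℝ≥0) : ℝ≥0∞) := by exact_mod_cast le_max_left _ _
  calc K = (K.toNNReal : ℝ≥0∞) := (ENNReal.coe_toNNReal hK).symm
    _ ≤ ((max 1 K.toNNReal : ℝ≥0) : ℝ≥0∞) := by exact_mod_cast le_max_right _ _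
    _ ≤ _ := by rw [sq]; exact le_mul_of_one_le_left' h1

theorem le_mul_add_of_sq_le {x a b c : ℝ≥0∞} (h : x ^ 2 ≤ c ^ 2 * (a ^ 2 + b ^ 2)) :
    x ≤ c * (a + b) := by
  refine (ENNReal.pow_le_pow_left_iff two_ne_zero).1 (h.trans ?_)
  rw [mul_pow, add_sq]
  gcongr
  exact le_self_add

/-- Cauchy-Schwarz against a weight. -/
theorem sq_lintegral_mul_le {μ : Measure X} {w f : X → ℝ≥0∞} (hw : AEMeasurable w μ)
    (hf : AEMeasurable f μ) :
    (∫⁻ x, w x * f x ∂μ) ^ 2 ≤ (∫⁻ x, w x ∂μ) * ∫⁻ x, w x * f x ^ 2 ∂μ := by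
  have hpq : (2 : ℝ).HolderConjugate 2 := Real.HolderConjugate.two_two
  have h := ENNReal.lintegral_mul_le_Lp_mul_Lq μ hpq
    (f := fun x => w x ^ (1 / 2 : ℝ)) (g := fun x => w x ^ (1 / 2 : ℝ) * f x)
    (hw.pow_const _) ((hw.pow_const _).mul hf)
  have e0 : ∀ a : ℝ≥0∞, a ^ (1 / 2 : ℝ) * a ^ (1 / 2 : ℝ) = a := fun a => by
    rw [← ENNReal.rpow_add_of_nonneg _ _ (by norm_num) (by norm_num)]; norm_num
  have e1 : ∀ a : ℝ≥0∞, (a ^ (1 / 2 : ℝ)) ^ (2 : ℝ) = a := fun a => by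
    rw [← ENNReal.rpow_mul]; norm_num
  have e2 : ∀ a b : ℝ≥0∞, (a ^ (1 / 2 : ℝ) * b) ^ (2 : ℝ) = a * b ^ 2 := fun a b => by
    rw [ENNReal.mul_rpow_of_nonneg _ _ (by norm_num), e1]; norm_cast
  simp only [Pi.mul_apply, ← mul_assoc, e0, e1, e2] at h
  calc _ ≤ ((∫⁻ x, w x ∂μ) ^ (1 / 2 : ℝ) * (∫⁻ x, w x * f x ^ 2 ∂μ) ^ (1 / 2 : ℝ)) ^ 2 := by
        gcongr
    _ = _ := by
        rw [mul_pow, ← ENNReal.rpow_natCast, ← ENNReal.rpow_natCast]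
        simp only [Nat.cast_ofNat, e1]

/-- Jensen's inequality for the square and a weight of mass at most one. -/
theorem enorm_integral_smul_sq_le [NormedSpace ℝ F] {μ : Measure X} {ρ : X → ℝ} {f : X → F}
    (hρ0 : ∀ x, 0 ≤ ρ x) (hρi : Integrable ρ μ) (hρ : ∫ x, ρ x ∂μ ≤ 1)
    (hf : AEStronglyMeasurable f μ) :
    ‖∫ x, ρ x • f x ∂μ‖ₑ ^ 2 ≤ ∫⁻ x, ENNReal.ofReal (ρ x) * ‖f x‖ₑ ^ 2 ∂μ := by
  have h1 : ∫⁻ x, ENNReal.ofReal (ρ x) ∂μ ≤ 1 := by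
    rw [← ofReal_integral_eq_lintegral_ofReal hρi (Eventually.of_forall hρ0)]
    simpa using hρ
  calc ‖∫ x, ρ x • f x ∂μ‖ₑ ^ 2 ≤ (∫⁻ x, ENNReal.ofReal (ρ x) * ‖f x‖ₑ ∂μ) ^ 2 := by
        gcongr
        refine (enorm_integral_le_lintegral_enorm _).trans_eq ?_
        refine lintegral_congr fun x => ?_
        rw [enorm_smul, Real.enorm_of_nonneg (hρ0 x)]
    _ ≤ (∫⁻ x, ENNReal.ofReal (ρ x) ∂μ) * ∫⁻ x, ENNReal.ofReal (ρ x) * ‖f x‖ₑ ^ 2 ∂μ :=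
        sq_lintegral_mul_le hρi.aestronglyMeasurable.aemeasurable.ennreal_ofReal hf.enorm
    _ ≤ 1 * ∫⁻ x, ENNReal.ofReal (ρ x) * ‖f x‖ₑ ^ 2 ∂μ := by gcongr
    _ = _ := one_mul _

end Jensen

/-! ### Mollification -/

section Mollification

variable {N : ℕ} {F : Type*} [NormedAddCommGroup F]

theorem aestronglyMeasurable_comp_sub {f : Sp N → F} (hf : AEStronglyMeasurable f volume)
    (x : Sp N) : AEStronglyMeasurable (fun t => f (x - t)) volume :=
  hf.comp_quasiMeasurePreserving (quasiMeasurePreserving_sub_left_of_right_invariant volume x)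

/-- Translating by `t` moves the ball of radius `R` into the ball of radius `R + ‖t‖`. -/
theorem setLIntegral_ball_comp_sub_le (g : Sp N → ℝ≥0∞) (R : ℝ) (t : Sp N) :
    ∫⁻ x in Metric.ball 0 R, g (x - t) ≤ ∫⁻ x in Metric.ball 0 (R + ‖t‖), g x := by
  have e := (measurePreserving_sub_right (volume : Measure (Sp N)) t).setLIntegral_comp_emb
    (MeasurableEquiv.subRight t).measurableEmbedding g (Metric.ball 0 R)
  rw [e]
  refine lintegral_mono_set ?_
  rintro _ ⟨x, hx, rfl⟩
  rw [mem_ball_zero_iff] at hx ⊢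
  linarith [norm_sub_le x t]

theorem locallyIntegrable_of_memLp_ball {f : Sp N → F}
    (hf : ∀ R : ℝ, MemLp f 2 (volume.restrict (Metric.ball 0 R))) : LocallyIntegrable f := by
  intro x
  refine ⟨Metric.ball 0 (‖x‖ + 1), Metric.isOpen_ball.mem_nhds (by simp), ?_⟩
  have : IsFiniteMeasure (volume.restrict (Metric.ball (0 : Sp N) (‖x‖ + 1))) :=
    ⟨by simpa using measure_ball_lt_top⟩
  exact (hf _).integrable one_le_two

variable [NormedSpace ℝ F]

/-- A bump function supported in the ball of radius `1 / (n + 1)`. -/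
noncomputable def bump (N n : ℕ) : ContDiffBump (0 : Sp N) where
  rIn := 1 / (n + 1) / 2
  rOut := 1 / (n + 1)
  rIn_pos := by positivity
  rIn_lt_rOut := half_lt_self (by positivity)

/-- The standard mollifier: a normalised smooth bump supported in the ball of radius
`1 / (n + 1)`. -/
noncomputable def eta (N n : ℕ) : Sp N → ℝ := (bump N n).normed volume

theorem eta_nonneg (n : ℕ) (x : Sp N) : 0 ≤ eta N n x := (bump N n).nonneg_normed x

theorem integrable_eta (n : ℕ) : Integrable (eta N n) := (bump N n).integrable_normed

theorem integral_eta (n : ℕ) : ∫ x, eta N n x = 1 := (bump N n).integral_normed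

theorem contDiff_eta (n : ℕ) : ContDiff ℝ ((⊤ : ℕ∞) : WithTop ℕ∞) (eta N n) :=
  (bump N n).contDiff_normed

theorem hasCompactSupport_eta (n : ℕ) : HasCompactSupport (eta N n) :=
  (bump N n).hasCompactSupport_normed

theorem lintegral_eta (n : ℕ) : ∫⁻ x, ENNReal.ofReal (eta N n x) = 1 := by
  rw [← ofReal_integral_eq_lintegral_ofReal (integrable_eta n)
    (Eventually.of_forall (eta_nonneg n)), integral_eta, ENNReal.ofReal_one]

theorem eta_eq_zero {n : ℕ} {x : Sp N} (hx : 1 ≤ ‖x‖) : eta N n x = 0 := by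
  by_contra h
  have h2 : x ∈ Function.support (eta N n) := h
  rw [eta, ContDiffBump.support_normed_eq, mem_ball_zero_iff] at h2
  have : (bump N n).rOut ≤ 1 := by
    change 1 / ((n : ℝ) + 1) ≤ 1
    rw [div_le_one (by positivity)]
    linarith [(Nat.cast_nonneg n : (0 : ℝ) ≤ n)]
  linarith

theorem tendsto_rOut_bump : Tendsto (fun n => (bump N n).rOut) atTop (𝓝 0) :=
  tendsto_one_div_add_atTop_nhds_zero_nat

/-- The mollification `η_n * f`. -/
noncomputable def moll (n : ℕ) (f : Sp N → F) : Sp N → F :=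
  convolution (eta N n) f (ContinuousLinearMap.lsmul ℝ ℝ) volume

theorem moll_apply (n : ℕ) (f : Sp N → F) (x : Sp N) :
    moll n f x = ∫ t, eta N n t • f (x - t) := rfl

theorem moll_apply_swap (n : ℕ) (f : Sp N → F) (x : Sp N) :
    moll n f x = ∫ t, eta N n (x - t) • f t :=
  convolution_lsmul_swap

theorem contDiff_moll (n : ℕ) {f : Sp N → F} (hf : LocallyIntegrable f) :
    ContDiff ℝ ((⊤ : ℕ∞) : WithTop ℕ∞) (moll n f) :=
  (hasCompactSupport_eta n).contDiff_convolution_left _ (contDiff_eta n) hf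

theorem ae_tendsto_moll [CompleteSpace F] {f : Sp N → F} (hf : LocallyIntegrable f) :
    ∀ᵐ x, Tendsto (fun n => moll n f x) atTop (𝓝 (f x)) :=
  ContDiffBump.ae_convolution_tendsto_right_of_locallyIntegrable (K := 2) (μ := volume)
    (φ := fun n => bump N n) tendsto_rOut_bump
    (Eventually.of_forall fun n => by
      change 1 / ((n : ℝ) + 1) ≤ 2 * (1 / (n + 1) / 2)
      linarith) hf

theorem enorm_moll_sq_le (n : ℕ) {f : Sp N → F} (hf : AEStronglyMeasurable f volume) (x : Sp N) :
    ‖moll n f x‖ₑ ^ 2 ≤ ∫⁻ t, ENNReal.ofReal (eta N n t) * ‖f (x - t)‖ₑ ^ 2 := by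
  rw [moll_apply]
  exact enorm_integral_smul_sq_le (eta_nonneg n) (integrable_eta n) (integral_eta n).le
    (aestronglyMeasurable_comp_sub hf x)

/-- Mollification does not increase the `L²` norm, up to enlarging the ball by one. -/
theorem eLpNorm_moll_le (n : ℕ) {f : Sp N → F} (hf : AEStronglyMeasurable f volume) (R : ℝ) :
    eLpNorm (moll n f) 2 (volume.restrict (Metric.ball 0 R)) ≤
      eLpNorm f 2 (volume.restrict (Metric.ball 0 (R + 1))) := by
  rw [← one_mul (eLpNorm f 2 _)]
  refine eLpNorm_two_le_of_sq_le ?_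
  rw [one_pow, one_mul]
  calc ∫⁻ x in Metric.ball 0 R, ‖moll n f x‖ₑ ^ 2
      ≤ ∫⁻ x in Metric.ball 0 R, ∫⁻ t, ENNReal.ofReal (eta N n t) * ‖f (x - t)‖ₑ ^ 2 :=
        lintegral_mono fun x => enorm_moll_sq_le n hf x
    _ = ∫⁻ t, ∫⁻ x in Metric.ball 0 R, ENNReal.ofReal (eta N n t) * ‖f (x - t)‖ₑ ^ 2 := by
        refine lintegral_lintegral_swap ?_
        refine AEMeasurable.mul (f := fun p : Sp N × Sp N => ENNReal.ofReal (eta N n p.2))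
          (g := fun p : Sp N × Sp N => ‖f (p.1 - p.2)‖ₑ ^ 2) ?_ ?_
        · exact ((contDiff_eta n).continuous.measurable.comp measurable_snd).ennreal_ofReal
            |>.aemeasurable
        · have h1 : Measure.QuasiMeasurePreserving (fun p : Sp N × Sp N => p.1 - p.2)
              (volume.prod volume) volume := quasiMeasurePreserving_sub volume volume
          have h2 := (hf.enorm.comp_quasiMeasurePreserving h1).pow_const 2
          refine h2.mono_measure ?_
          exact Measure.prod_mono Measure.restrict_le_self le_rfl
    _ ≤ ∫⁻ t, ENNReal.ofReal (eta N n t) * ∫⁻ x in Metric.ball 0 (R + 1), ‖f x‖ₑ ^ 2 := by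
        refine lintegral_mono fun t => ?_
        dsimp only
        rw [lintegral_const_mul' _ _ ENNReal.ofReal_ne_top]
        rcases le_or_gt 1 ‖t‖ with ht | ht
        · simp [eta_eq_zero ht]
        · refine mul_le_mul_right ?_ _
          refine (setLIntegral_ball_comp_sub_le (fun y => ‖f y‖ₑ ^ 2) R t).trans ?_
          exact lintegral_mono_set (Metric.ball_subset_ball (by linarith))
    _ = _ := by
        rw [lintegral_mul_const'' _
          (integrable_eta n).aestronglyMeasurable.aemeasurable.ennreal_ofReal,
          lintegral_eta, one_mul]

theorem moll_sub (n : ℕ) {f g : Sp N → F} (hf : LocallyIntegrable f) (hg : LocallyIntegrable g) :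
    moll n (f - g) = moll n f - moll n g := by
  have hi : ∀ {h : Sp N → F}, LocallyIntegrable h → ∀ x,
      Integrable fun t => eta N n (x - t) • h t := fun {h} hh x =>
    hh.integrable_smul_left_of_hasCompactSupport
      ((contDiff_eta n).continuous.comp (continuous_const.sub continuous_id))
      ((hasCompactSupport_eta n).comp_homeomorph (Homeomorph.subLeft x))
  ext x
  simp only [moll_apply_swap, Pi.sub_apply, smul_sub]
  rw [integral_sub (hi hf x) (hi hg x)]

/-- Mollifications of a locally square integrable function converge to it in `L²` on balls. -/
theorem tendsto_eLpNorm_moll_sub [CompleteSpace F] {f : Sp N → F}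
    (hf : ∀ R : ℝ, MemLp f 2 (volume.restrict (Metric.ball 0 R))) (R : ℝ) :
    Tendsto (fun n => eLpNorm (moll n f - f) 2 (volume.restrict (Metric.ball 0 R))) atTop
      (𝓝 0) := by
  have hfl := locallyIntegrable_of_memLp_ball hf
  set B : Set (Sp N) := Metric.ball 0 R
  have hB : volume B ≠ ⊤ := measure_ball_lt_top.ne
  rw [ENNReal.tendsto_atTop_zero]
  intro ε hε
  -- the summands bound the `L²` norms of `η_n * (f - g)`, `η_n * g - g` and `g - f` for a
  -- continuous approximation `g` of `f`
  obtain ⟨δ, hδ0, hδ⟩ : ∃ δ : ℝ≥0, 0 < δ ∧ (δ : ℝ≥0∞) + δ * volume B ^ (1 / 2 : ℝ) + δ ≤ ε := by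
    have hc : Tendsto (fun δ : ℝ≥0 => (δ : ℝ≥0∞) + δ * volume B ^ (1 / 2 : ℝ) + δ) (𝓝[>] 0)
        (𝓝 0) := by
      have : Tendsto (fun δ : ℝ≥0 => (δ : ℝ≥0∞)) (𝓝[>] 0) (𝓝 0) :=
        (ENNReal.continuous_coe.tendsto' 0 0 rfl).mono_left nhdsWithin_le_nhds
      have h2 := (this.add (ENNReal.Tendsto.mul_const this
        (b := volume B ^ (1 / 2 : ℝ)) (Or.inr (by finiteness)))).add this
      simpa using h2
    obtain ⟨δ, h1, h2⟩ := ((hc.eventually (ge_mem_nhds hε)).and self_mem_nhdsWithin).exists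
    exact ⟨δ, h2, h1⟩
  have hind : MemLp ((Metric.ball 0 (R + 1)).indicator f) 2 volume :=
    (memLp_indicator_iff_restrict Metric.isOpen_ball.measurableSet).2 (hf (R + 1))
  obtain ⟨g, hgs, hg, hgc, -⟩ :=
    hind.exists_hasCompactSupport_eLpNorm_sub_le ENNReal.ofNat_ne_top
      (ε := δ) (by simpa using hδ0.ne')
  have hgl : LocallyIntegrable g := hgc.locallyIntegrable
  have hfg : eLpNorm (f - g) 2 (volume.restrict (Metric.ball 0 (R + 1))) ≤ δ := by
    refine le_trans ?_ hg
    rw [← eLpNorm_restrict_eq_of_support_subset (s := univ) (by simp), Measure.restrict_univ]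
    refine le_trans (le_of_eq ?_) (eLpNorm_mono_measure _ Measure.restrict_le_self
      (ν := volume.restrict (Metric.ball 0 (R + 1))))
    refine eLpNorm_congr_ae ?_
    filter_upwards [ae_restrict_mem Metric.isOpen_ball.measurableSet] with x hx
    simp [indicator_of_mem hx]
  have huc := hgs.uniformContinuous_of_continuous hgc
  obtain ⟨r, hr, hgr⟩ := Metric.uniformContinuous_iff.1 huc δ hδ0
  obtain ⟨n₀, hn₀⟩ :=
    (tendsto_rOut_bump (N := N).eventually (gt_mem_nhds hr)).exists_forall_of_atTop
  refine ⟨n₀, fun n hn => le_trans ?_ hδ⟩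
  have e : moll n f - f = (moll n (f - g) + (moll n g - g)) + (g - f) := by
    rw [moll_sub n hfl hgl]; abel
  have m1 : AEStronglyMeasurable (moll n (f - g)) (volume.restrict B) :=
    (contDiff_moll n (hfl.sub hgl)).continuous.aestronglyMeasurable
  have m2 : AEStronglyMeasurable (moll n g - g) (volume.restrict B) :=
    ((contDiff_moll n hgl).continuous.sub hgc).aestronglyMeasurable
  have m3 : AEStronglyMeasurable (g - f) (volume.restrict B) :=
    (hgl.sub hfl).aestronglyMeasurable.restrict
  rw [e]
  refine (eLpNorm_add_le (m1.add m2) m3 one_le_two).trans ?_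
  gcongr
  · refine (eLpNorm_add_le m1 m2 one_le_two).trans ?_
    gcongr
    · exact (eLpNorm_moll_le n (hfl.sub hgl).aestronglyMeasurable R).trans hfg
    · refine (eLpNorm_le_of_ae_bound (C := (δ : ℝ)) (Eventually.of_forall fun x => ?_)).trans ?_
      · rw [Pi.sub_apply, ← dist_eq_norm]
        refine ContDiffBump.dist_normed_convolution_le (φ := bump N n)
          hgc.aestronglyMeasurable fun y hy => (hgr ?_).le
        exact lt_trans hy (hn₀ n hn)
      · rw [mul_comm]
        simp [ENNReal.toReal_ofNat]
  · rw [eLpNorm_sub_comm]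
    exact (eLpNorm_mono_measure _ (Measure.restrict_mono
      (Metric.ball_subset_ball (by linarith)) le_rfl)).trans hfg

/-- The gradient of the mollification is the mollification of the weak gradient. -/
theorem hasGradientAt_moll (n : ℕ) {u : Sp N → ℝ} {U : Sp N → Sp N} (h : IsWeakGrad u U)
    (x : Sp N) : HasGradientAt (moll n u) (moll n U x) x := by
  have h1 := (hasCompactSupport_eta n).hasFDerivAt_convolution_left
    (ContinuousLinearMap.lsmul ℝ ℝ) ((contDiff_eta (N := N) n).of_le (by exact_mod_cast le_top))
    h.locInt x
  rw [hasGradientAt_iff_hasFDerivAt]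
  refine h1.congr_fderiv ?_
  ext w
  have hs : HasCompactSupport fun t => eta N n (x - t) :=
    (hasCompactSupport_eta n).comp_homeomorph (Homeomorph.subLeft x)
  have hcd : ContDiff ℝ ((⊤ : ℕ∞) : WithTop ℕ∞) fun t => eta N n (x - t) :=
    (contDiff_eta n).comp (contDiff_const.sub contDiff_id)
  have hp := h.parts (fun t => eta N n (x - t)) hcd hs w
  have hd : ∀ t, fderiv ℝ (fun t => eta N n (x - t)) t w = -fderiv ℝ (eta N n) (x - t) w := by
    intro t
    have h2 : HasFDerivAt (fun t => x - t) (-ContinuousLinearMap.id ℝ (Sp N)) t :=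
      (hasFDerivAt_id t).const_sub x
    have h3 := (((contDiff_eta n).differentiable (by simp)) (x - t)).hasFDerivAt.comp t h2
    rw [show (fun t => eta N n (x - t)) = eta N n ∘ fun t => x - t from rfl, h3.fderiv]
    simp
  have hUi : Integrable fun t => eta N n (x - t) • U t :=
    h.locInt_grad.integrable_smul_left_of_hasCompactSupport hcd.continuous hs
  have hui : Integrable fun t => (ContinuousLinearMap.precompL (Sp N)
      (ContinuousLinearMap.lsmul ℝ ℝ)) (fderiv ℝ (eta N n) (x - t)) (u t) := by
    have hc : Continuous (fderiv ℝ (eta N n)) := (contDiff_eta n).continuous_fderiv (by simp)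
    have := h.locInt.integrable_smul_right_of_hasCompactSupport
      (hc.comp (continuous_const.sub continuous_id : Continuous fun t => x - t))
      (((hasCompactSupport_eta n).fderiv ℝ).comp_homeomorph (Homeomorph.subLeft x))
    refine this.congr (Eventually.of_forall fun t => ?_)
    ext w
    simp [mul_comm]
  rw [convolution_eq_swap, ContinuousLinearMap.integral_apply hui,
    InnerProductSpace.toDual_apply_apply,
    moll_apply_swap, real_inner_comm, ← integral_inner hUi]
  simp only [hd, mul_neg, integral_neg, neg_neg] at hp
  calc _ = ∫ t, u t * fderiv ℝ (eta N n) (x - t) w := by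
        refine integral_congr_ae (Eventually.of_forall fun t => ?_)
        simp [mul_comm]
    _ = _ := hp.symm
    _ = _ := by
        refine integral_congr_ae (Eventually.of_forall fun t => ?_)
        simp [real_inner_smul_right, real_inner_comm, mul_comm]

end Mollification

/-! ### Translation estimates and the Poincaré inequality -/

section Poincare

variable {N : ℕ}

theorem continuous_gradient {φ : Sp N → ℝ} (hφ : ContDiff ℝ 1 φ) : Continuous (gradient φ) :=
  (InnerProductSpace.toDual ℝ (Sp N)).symm.continuous.comp (hφ.continuous_fderiv one_ne_zero)

/-- A pointwise bound for increments: Jensen's inequality along the segment from `x` to `x + h`. -/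
theorem enorm_sub_translate_sq_le {w : Sp N → ℝ} (hw : ContDiff ℝ 1 w) (x h : Sp N) :
    ‖w (x + h) - w x‖ₑ ^ 2 ≤
      ∫⁻ s in Ioc (0 : ℝ) 1, ‖h‖ₑ ^ 2 * ‖gradient w (x + s • h)‖ₑ ^ 2 := by
  have hg : Continuous (gradient w) := continuous_gradient hw
  have hd : ∀ s : ℝ, HasDerivAt (fun s : ℝ => w (x + s • h))
      (inner ℝ (gradient w (x + s • h)) h) s := fun s => by
    have h1 := (hw.differentiable one_ne_zero (x + s • h)).hasGradientAt.hasFDerivAt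
    have h2 : HasDerivAt (fun s : ℝ => x + s • h) h s := by
      simpa using ((hasDerivAt_id s).smul_const h).const_add x
    exact (h1.comp_hasDerivAt s h2).congr_deriv (by simp)
  have hc : Continuous fun s : ℝ => inner ℝ (gradient w (x + s • h)) h := by fun_prop
  have hI := intervalIntegral.integral_eq_sub_of_hasDerivAt (a := 0) (b := 1)
    (fun s _ => hd s) (hc.intervalIntegrable _ _)
  simp only [one_smul, zero_smul, add_zero] at hI
  rw [← hI, intervalIntegral.integral_of_le zero_le_one]
  have hJ := enorm_integral_smul_sq_le (μ := volume.restrict (Ioc (0 : ℝ) 1)) (ρ := fun _ => 1)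
    (f := fun s : ℝ => inner ℝ (gradient w (x + s • h)) h) (fun _ => zero_le_one)
    (by simp) (by simp) hc.aestronglyMeasurable
  simp only [one_smul, ENNReal.ofReal_one, one_mul] at hJ
  refine hJ.trans (lintegral_mono fun s => ?_)
  dsimp only
  rw [← mul_pow]
  gcongr
  rw [mul_comm, ← enorm_norm (gradient w _), ← enorm_norm h, ← enorm_mul]
  exact enorm_le_iff_norm_le.2 (by
    rw [norm_mul, norm_norm, norm_norm]
    exact norm_inner_le_norm _ _)

theorem eLpNorm_sub_translate_le_of_contDiff {w : Sp N → ℝ} (hw : ContDiff ℝ 1 w) (h : Sp N)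
    (R : ℝ) :
    eLpNorm (fun x => w (x + h) - w x) 2 (volume.restrict (Metric.ball 0 R)) ≤
      ‖h‖ₑ * eLpNorm (gradient w) 2 (volume.restrict (Metric.ball 0 (R + ‖h‖))) := by
  have hg : Continuous (gradient w) := continuous_gradient hw
  refine eLpNorm_two_le_of_sq_le ?_
  calc ∫⁻ x in Metric.ball 0 R, ‖w (x + h) - w x‖ₑ ^ 2
      ≤ ∫⁻ x in Metric.ball 0 R, ∫⁻ s in Ioc (0 : ℝ) 1,
          ‖h‖ₑ ^ 2 * ‖gradient w (x + s • h)‖ₑ ^ 2 :=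
        lintegral_mono fun x => enorm_sub_translate_sq_le hw x h
    _ = ∫⁻ s in Ioc (0 : ℝ) 1, ∫⁻ x in Metric.ball 0 R,
          ‖h‖ₑ ^ 2 * ‖gradient w (x + s • h)‖ₑ ^ 2 := by
        refine lintegral_lintegral_swap (Measurable.aemeasurable ?_)
        have : Continuous fun p : Sp N × ℝ => gradient w (p.1 + p.2 • h) := by fun_prop
        exact (this.measurable.enorm.pow_const 2).const_mul _
    _ ≤ ∫⁻ s in Ioc (0 : ℝ) 1, ‖h‖ₑ ^ 2 *
          ∫⁻ x in Metric.ball 0 (R + ‖h‖), ‖gradient w x‖ₑ ^ 2 := by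
        refine setLIntegral_mono (by fun_prop) fun s hs => ?_
        rw [lintegral_const_mul' _ _ (by finiteness)]
        refine mul_le_mul_right ?_ _
        have := setLIntegral_ball_comp_sub_le (fun y => ‖gradient w y‖ₑ ^ 2) R (-(s • h))
        simp only [sub_neg_eq_add] at this
        refine this.trans (lintegral_mono_set (Metric.ball_subset_ball ?_))
        rw [norm_neg, norm_smul, Real.norm_of_nonneg hs.1.le]
        nlinarith [norm_nonneg h, hs.2]
    _ = _ := by simp

/-- The translation estimate for weakly differentiable functions. -/
theorem eLpNorm_sub_translate_le {u : Sp N → ℝ} {U : Sp N → Sp N} (hu : IsWeakGrad u U) (h : Sp N)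
    (R : ℝ) :
    eLpNorm (fun x => u (x + h) - u x) 2 (volume.restrict (Metric.ball 0 R)) ≤
      ‖h‖ₑ * eLpNorm U 2 (volume.restrict (Metric.ball 0 (R + ‖h‖ + 1))) := by
  have hae := ae_tendsto_moll hu.locInt
  have hae' : ∀ᵐ x, Tendsto (fun n => moll n u (x + h)) atTop (𝓝 (u (x + h))) :=
    (measurePreserving_add_right volume h).quasiMeasurePreserving.ae hae
  have hlim : ∀ᵐ x ∂(volume.restrict (Metric.ball 0 R)), Tendsto
      (fun n => moll n u (x + h) - moll n u x) atTop (𝓝 (u (x + h) - u x)) :=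
    ae_restrict_of_ae (by filter_upwards [hae, hae'] with x h1 h2 using h2.sub h1)
  have hsm : ∀ n, ContDiff ℝ 1 (moll n u) := fun n =>
    (contDiff_moll n hu.locInt).of_le (by exact_mod_cast le_top)
  refine (Lp.eLpNorm_lim_le_liminf_eLpNorm (f := fun n x => moll n u (x + h) - moll n u x)
    (fun n => Continuous.aestronglyMeasurable ?_) _ hlim).trans ?_
  · have := (hsm n).continuous
    fun_prop
  · refine liminf_le_of_le (by isBoundedDefault) fun b hb => ?_
    obtain ⟨n, hn⟩ := hb.exists
    refine hn.trans ((eLpNorm_sub_translate_le_of_contDiff (hsm n) h R).trans ?_)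
    refine mul_le_mul_right ?_ _
    have e : gradient (moll n u) = moll n U := funext fun x => (hasGradientAt_moll n hu x).gradient
    rw [e]
    exact eLpNorm_moll_le n hu.locInt_grad.aestronglyMeasurable _

/-- The Poincaré inequality on balls, in double integral form. -/
theorem lintegral_lintegral_sub_sq_le {u : Sp N → ℝ} {U : Sp N → Sp N} (hu : IsWeakGrad u U)
    (R : ℝ) :
    ∫⁻ x in Metric.ball 0 R, ∫⁻ y in Metric.ball 0 R, ‖u y - u x‖ₑ ^ 2 ≤
      volume (Metric.ball (0 : Sp N) (2 * R)) * (ENNReal.ofReal (2 * R) ^ 2 *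
        ∫⁻ x in Metric.ball 0 (3 * R + 1), ‖U x‖ₑ ^ 2) := by
  have hum := hu.locInt.aestronglyMeasurable
  calc ∫⁻ x in Metric.ball 0 R, ∫⁻ y in Metric.ball 0 R, ‖u y - u x‖ₑ ^ 2
      ≤ ∫⁻ x in Metric.ball 0 R, ∫⁻ h in Metric.ball 0 (2 * R), ‖u (x + h) - u x‖ₑ ^ 2 := by
        refine setLIntegral_mono' Metric.isOpen_ball.measurableSet fun x hx => ?_
        -- substitute `y = x + h`
        have e := (measurePreserving_add_left (volume : Measure (Sp N)) (-x)).setLIntegral_comp_emb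
          (MeasurableEquiv.addLeft (-x)).measurableEmbedding
          (fun h => ‖u (x + h) - u x‖ₑ ^ 2) (Metric.ball 0 R)
        simp only [add_neg_cancel_left] at e
        rw [e]
        refine lintegral_mono_set ?_
        rintro _ ⟨y, hy, rfl⟩
        rw [mem_ball_zero_iff] at hx hy ⊢
        have := norm_add_le (-x) y
        rw [norm_neg] at this
        linarith
    _ = ∫⁻ h in Metric.ball 0 (2 * R), ∫⁻ x in Metric.ball 0 R, ‖u (x + h) - u x‖ₑ ^ 2 := by
        refine lintegral_lintegral_swap ?_
        have h1 : Measure.QuasiMeasurePreserving (fun p : Sp N × Sp N => p.1 + p.2)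
            (volume.prod volume) volume := quasiMeasurePreserving_add volume volume
        have h2 := ((hum.comp_quasiMeasurePreserving h1).sub
          (hum.comp_quasiMeasurePreserving Measure.quasiMeasurePreserving_fst)).enorm.pow_const 2
        exact h2.mono_measure (Measure.prod_mono Measure.restrict_le_self Measure.restrict_le_self)
    _ ≤ ∫⁻ h in Metric.ball (0 : Sp N) (2 * R), ENNReal.ofReal (2 * R) ^ 2 *
          ∫⁻ x in Metric.ball 0 (3 * R + 1), ‖U x‖ₑ ^ 2 := by
        refine setLIntegral_mono (by fun_prop) fun h hh => ?_
        rw [mem_ball_zero_iff] at hh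
        rw [← eLpNorm_two_sq, ← eLpNorm_two_sq, ← mul_pow]
        gcongr
        refine (eLpNorm_sub_translate_le hu h R).trans ?_
        refine mul_le_mul' ?_ (eLpNorm_mono_measure _ (Measure.restrict_mono
          (Metric.ball_subset_ball (by linarith)) le_rfl))
        rw [← ofReal_norm]
        exact ENNReal.ofReal_le_ofReal hh.le
    _ = _ := by rw [setLIntegral_const, mul_comm]

theorem enorm_sq_le_two_mul {F : Type*} [NormedAddCommGroup F] (a b : F) :
    ‖a‖ₑ ^ 2 ≤ 2 * ‖b - a‖ₑ ^ 2 + 2 * ‖b‖ₑ ^ 2 := by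
  have h1 : ‖a‖ ^ 2 ≤ 2 * ‖b - a‖ ^ 2 + 2 * ‖b‖ ^ 2 := by
    have := norm_sub_le b (b - a)
    rw [sub_sub_cancel] at this
    nlinarith [sq_nonneg (‖b - a‖ - ‖b‖), norm_nonneg a, norm_nonneg b, norm_nonneg (b - a)]
  simp only [← ofReal_norm, ← ENNReal.ofReal_pow (norm_nonneg _)]
  rw [← ENNReal.ofReal_ofNat 2, ← ENNReal.ofReal_mul zero_le_two,
    ← ENNReal.ofReal_mul zero_le_two, ← ENNReal.ofReal_add (by positivity) (by positivity)]
  exact ENNReal.ofReal_le_ofReal h1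

/-- The `L²` norm on a ball is controlled by the gradient on a larger ball and the `L²` norm on
a fixed bounded set of positive measure. -/
theorem exists_eLpNorm_ball_le {Ω : Set (Sp N)} (hb : Bornology.IsBounded Ω)
    (h0 : volume Ω ≠ 0) (R : ℝ) :
    ∃ (C : ℝ≥0) (R' : ℝ), ∀ (u : Sp N → ℝ) (U : Sp N → Sp N), IsWeakGrad u U →
      eLpNorm u 2 (volume.restrict (Metric.ball 0 R)) ≤
        C * (eLpNorm U 2 (volume.restrict (Metric.ball 0 R')) +
          eLpNorm u 2 (volume.restrict Ω)) := by
  obtain ⟨R₁, hR₁⟩ := hb.subset_ball 0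
  set R₂ := max (max R R₁) 0
  have hΩB : Ω ⊆ Metric.ball 0 R₂ := hR₁.trans (Metric.ball_subset_ball (by simp [R₂]))
  have hRB : Metric.ball (0 : Sp N) R ⊆ Metric.ball 0 R₂ := Metric.ball_subset_ball (by simp [R₂])
  have hBfin : volume (Metric.ball (0 : Sp N) R₂) ≠ ⊤ := measure_ball_lt_top.ne
  have hΩfin : volume Ω ≠ ⊤ := (measure_mono hΩB |>.trans_lt measure_ball_lt_top).ne
  set K : ℝ≥0∞ := (volume Ω)⁻¹ * (2 * (volume (Metric.ball (0 : Sp N) (2 * R₂)) *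
    ENNReal.ofReal (2 * R₂) ^ 2) + 2 * volume (Metric.ball (0 : Sp N) R₂)) with hK
  have hKfin : K ≠ ⊤ := by
    refine ENNReal.mul_ne_top (ENNReal.inv_ne_top.2 h0) ?_
    have : volume (Metric.ball (0 : Sp N) (2 * R₂)) ≠ ⊤ := measure_ball_lt_top.ne
    finiteness
  obtain ⟨C, hC⟩ := exists_le_coe_sq hKfin
  refine ⟨C, 3 * R₂ + 1, fun u U hu => ?_⟩
  have hum := hu.locInt.aestronglyMeasurable
  set B := Metric.ball (0 : Sp N) R₂ with hB
  set A := ∫⁻ x in Metric.ball 0 (3 * R₂ + 1), ‖U x‖ₑ ^ 2 with hA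
  set a := ∫⁻ y in Ω, ‖u y‖ₑ ^ 2 with ha
  -- average `‖u x‖² ≤ 2 ‖u y - u x‖² + 2 ‖u y‖²` over `y ∈ Ω` and integrate over `x ∈ B`
  have key : volume Ω * ∫⁻ x in B, ‖u x‖ₑ ^ 2 ≤
      2 * (volume (Metric.ball (0 : Sp N) (2 * R₂)) * (ENNReal.ofReal (2 * R₂) ^ 2 * A)) +
        2 * volume B * a := by
    calc volume Ω * ∫⁻ x in B, ‖u x‖ₑ ^ 2
        = ∫⁻ x in B, ∫⁻ y in Ω, ‖u x‖ₑ ^ 2 := by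
          simp only [setLIntegral_const]
          rw [lintegral_mul_const' _ _ hΩfin, mul_comm]
      _ ≤ ∫⁻ x in B, ∫⁻ y in Ω, (2 * ‖u y - u x‖ₑ ^ 2 + 2 * ‖u y‖ₑ ^ 2) :=
          lintegral_mono fun x => lintegral_mono fun y => enorm_sq_le_two_mul _ _
      _ = ∫⁻ x in B, ((∫⁻ y in Ω, 2 * ‖u y - u x‖ₑ ^ 2) + 2 * a) := by
          refine lintegral_congr fun x => ?_
          rw [lintegral_add_right' _ ((hum.enorm.pow_const 2).const_mul 2).restrict,
            lintegral_const_mul' 2 (fun y => ‖u y‖ₑ ^ 2) ENNReal.ofNat_ne_top]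
      _ = (∫⁻ x in B, ∫⁻ y in Ω, 2 * ‖u y - u x‖ₑ ^ 2) + 2 * volume B * a := by
          rw [lintegral_add_right _ measurable_const, setLIntegral_const]
          ring
      _ ≤ 2 * (∫⁻ x in B, ∫⁻ y in B, ‖u y - u x‖ₑ ^ 2) + 2 * volume B * a := by
          rw [← lintegral_const_mul' 2 _ ENNReal.ofNat_ne_top]
          gcongr with x
          rw [lintegral_const_mul' 2 _ ENNReal.ofNat_ne_top]
          gcongr
      _ ≤ _ := by
          gcongr
          exact lintegral_lintegral_sub_sq_le hu R₂
  have key2 : ∫⁻ x in B, ‖u x‖ₑ ^ 2 ≤ K * (A + a) := by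
    calc ∫⁻ x in B, ‖u x‖ₑ ^ 2 = (volume Ω)⁻¹ * (volume Ω * ∫⁻ x in B, ‖u x‖ₑ ^ 2) := by
          rw [← mul_assoc, ENNReal.inv_mul_cancel h0 hΩfin, one_mul]
      _ ≤ _ := by
          rw [hK, mul_assoc]
          refine mul_le_mul_right (key.trans ?_) _
          rw [add_mul]
          refine add_le_add ?_ ?_
          · rw [mul_assoc 2, mul_assoc (volume _)]
            gcongr
            exact le_self_add
          · gcongr
            exact le_add_self
  refine le_mul_add_of_sq_le ?_
  rw [eLpNorm_two_sq, eLpNorm_two_sq, eLpNorm_two_sq]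
  exact (lintegral_mono_set hRB).trans (key2.trans (by gcongr))

/-- A function with vanishing weak gradient is constant: by the Poincaré inequality, `u x = u y` for
almost all `x` and `y` in every ball. -/
theorem ae_eq_const_of_isWeakGrad_zero {u : Sp N → ℝ} (hu : IsWeakGrad u 0) :
    ∃ c, u =ᵐ[volume] fun _ => c := by
  have hum := hu.locInt.aestronglyMeasurable
  have h1 : ∀ n : ℕ, ∀ᵐ x ∂(volume.restrict (Metric.ball (0 : Sp N) n)),
      ∀ᵐ y ∂(volume.restrict (Metric.ball (0 : Sp N) n)), u y = u x := by
    intro n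
    have h2 := lintegral_lintegral_sub_sq_le hu n
    have hm : AEMeasurable (fun p : Sp N × Sp N => ‖u p.2 - u p.1‖ₑ ^ 2)
        ((volume.restrict (Metric.ball (0 : Sp N) n)).prod
          (volume.restrict (Metric.ball (0 : Sp N) n))) :=
      ((hum.restrict.comp_quasiMeasurePreserving Measure.quasiMeasurePreserving_snd).sub
        (hum.restrict.comp_quasiMeasurePreserving
          Measure.quasiMeasurePreserving_fst)).enorm.pow_const 2
    simp only [Pi.zero_apply, enorm_zero, ne_eq, OfNat.ofNat_ne_zero, not_false_eq_true,
      zero_pow, lintegral_zero, mul_zero, nonpos_iff_eq_zero] at h2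
    rw [← lintegral_prod _ hm, lintegral_eq_zero_iff' hm] at h2
    filter_upwards [Measure.ae_ae_of_ae_prod h2] with x hx
    filter_upwards [hx] with y hy
    simpa [sub_eq_zero] using hy
  have h2 : ∀ᵐ x ∂(volume : Measure (Sp N)), ∀ n : ℕ, x ∈ Metric.ball (0 : Sp N) n →
      ∀ᵐ y ∂(volume.restrict (Metric.ball (0 : Sp N) n)), u y = u x :=
    ae_all_iff.2 fun n => (ae_restrict_iff' Metric.isOpen_ball.measurableSet).1 (h1 n)
  obtain ⟨x, hx⟩ := h2.exists
  refine ⟨u x, ?_⟩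
  have h3 : ∀ᵐ y ∂(volume : Measure (Sp N)), ∀ n : ℕ, x ∈ Metric.ball (0 : Sp N) n →
      y ∈ Metric.ball (0 : Sp N) n → u y = u x := by
    refine ae_all_iff.2 fun n => ?_
    by_cases hn : x ∈ Metric.ball (0 : Sp N) n
    · filter_upwards [(ae_restrict_iff' Metric.isOpen_ball.measurableSet).1 (hx n hn)] with y hy
        using fun _ => hy
    · exact Eventually.of_forall fun y h => absurd h hn
  filter_upwards [h3] with y hy
  obtain ⟨n, hn⟩ := exists_nat_gt (max ‖x‖ ‖y‖)
  exact hy n (mem_ball_zero_iff.2 (lt_of_le_of_lt (le_max_left _ _) hn))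
    (mem_ball_zero_iff.2 (lt_of_le_of_lt (le_max_right _ _) hn))

end Poincare

/-! ### Weak gradients -/

section WeakGradient

variable {N : ℕ}

theorem isWeakGrad_wgrad {u : Sp N → ℝ} (hu : WeaklyDiff u) : IsWeakGrad u (wgrad u) := by
  rw [wgrad, dif_pos hu]
  exact hu.choose_spec

theorem integrable_mul_of_locallyIntegrable {u φ : Sp N → ℝ} (hu : LocallyIntegrable u)
    (hφ : Continuous φ) (hs : HasCompactSupport φ) : Integrable fun x => u x * φ x := by
  simpa [mul_comm] using hu.integrable_smul_left_of_hasCompactSupport hφ hs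

theorem integrable_mul_fderiv {u φ : Sp N → ℝ} (hu : LocallyIntegrable u)
    (hφ : ContDiff ℝ ((⊤ : ℕ∞) : WithTop ℕ∞) φ) (hs : HasCompactSupport φ) (w : Sp N) :
    Integrable fun x => u x * fderiv ℝ φ x w :=
  integrable_mul_of_locallyIntegrable hu
    ((hφ.continuous_fderiv (by simp)).clm_apply continuous_const) (hs.fderiv_apply ℝ w)

theorem integrable_inner_mul {U : Sp N → Sp N} {φ : Sp N → ℝ} (hU : LocallyIntegrable U)
    (hφ : Continuous φ) (hs : HasCompactSupport φ) (w : Sp N) :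
    Integrable fun x => inner ℝ (U x) w * φ x := by
  have := (hU.integrable_smul_left_of_hasCompactSupport hφ hs).inner_const (𝕜 := ℝ) w
  refine this.congr (Eventually.of_forall fun x => ?_)
  simp [real_inner_smul_left, mul_comm]

theorem IsWeakGrad.congr {u v : Sp N → ℝ} {U V : Sp N → Sp N} (h : IsWeakGrad u U)
    (huv : u =ᵐ[volume] v) (hUV : U =ᵐ[volume] V) : IsWeakGrad v V where
  locInt := h.locInt.congr huv
  locInt_grad := h.locInt_grad.congr hUV
  parts φ hφ hs w := by
    rw [← integral_congr_ae (f := fun x => inner ℝ (U x) w * φ x)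
      (by filter_upwards [hUV] with x hx; rw [hx]), h.parts φ hφ hs w]
    congr 1
    exact integral_congr_ae (by filter_upwards [huv] with x hx; rw [hx])

theorem IsWeakGrad.add {u v : Sp N → ℝ} {U V : Sp N → Sp N} (hu : IsWeakGrad u U)
    (hv : IsWeakGrad v V) : IsWeakGrad (u + v) (U + V) where
  locInt := hu.locInt.add hv.locInt
  locInt_grad := hu.locInt_grad.add hv.locInt_grad
  parts φ hφ hs w := by
    simp only [Pi.add_apply, inner_add_left, add_mul]
    rw [integral_add (integrable_inner_mul hu.locInt_grad hφ.continuous hs w)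
      (integrable_inner_mul hv.locInt_grad hφ.continuous hs w),
      integral_add (integrable_mul_fderiv hu.locInt hφ hs w)
      (integrable_mul_fderiv hv.locInt hφ hs w), hu.parts φ hφ hs w, hv.parts φ hφ hs w]
    ring

theorem IsWeakGrad.smul {u : Sp N → ℝ} {U : Sp N → Sp N} (c : ℝ) (hu : IsWeakGrad u U) :
    IsWeakGrad (c • u) (c • U) where
  locInt := hu.locInt.smul c
  locInt_grad := hu.locInt_grad.smul c
  parts φ hφ hs w := by
    simp only [Pi.smul_apply, real_inner_smul_left, smul_eq_mul, mul_assoc, integral_const_mul,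
      hu.parts φ hφ hs w]
    ring

theorem IsWeakGrad.sub {u v : Sp N → ℝ} {U V : Sp N → Sp N} (hu : IsWeakGrad u U)
    (hv : IsWeakGrad v V) : IsWeakGrad (u - v) (U - V) := by
  simpa [sub_eq_add_neg] using hu.add (hv.smul (-1))

/-- Weak gradients are unique up to null sets, by the fundamental lemma of the calculus of
variations. -/
theorem IsWeakGrad.ae_eq {u : Sp N → ℝ} {U V : Sp N → Sp N} (hU : IsWeakGrad u U)
    (hV : IsWeakGrad u V) : U =ᵐ[volume] V := by
  have hl : LocallyIntegrable (U - V) := hU.locInt_grad.sub hV.locInt_grad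
  have h := ae_eq_zero_of_integral_contDiff_smul_eq_zero hl fun φ hφ hs => by
    refine ext_inner_right ℝ fun w => ?_
    have hi := hl.integrable_smul_left_of_hasCompactSupport hφ.continuous hs
    rw [inner_zero_left, real_inner_comm, ← integral_inner hi]
    have e : ∀ x, inner ℝ w (φ x • (U - V) x) = inner ℝ (U x) w * φ x - inner ℝ (V x) w * φ x := by
      intro x
      rw [real_inner_smul_right, Pi.sub_apply, real_inner_comm, inner_sub_left]
      ring
    simp only [e]
    rw [integral_sub (integrable_inner_mul hU.locInt_grad hφ.continuous hs w)
      (integrable_inner_mul hV.locInt_grad hφ.continuous hs w), hU.parts φ hφ hs w,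
      hV.parts φ hφ hs w, sub_self]
  filter_upwards [h] with x hx
  simpa [sub_eq_zero] using hx

theorem IsWeakGrad.wgrad_ae_eq {u : Sp N → ℝ} {U : Sp N → Sp N} (hU : IsWeakGrad u U) :
    wgrad u =ᵐ[volume] U :=
  (isWeakGrad_wgrad ⟨U, hU⟩).ae_eq hU

theorem isWeakGrad_of_contDiff {φ : Sp N → ℝ} (hφ : ContDiff ℝ 1 φ) :
    IsWeakGrad φ (gradient φ) where
  locInt := hφ.continuous.locallyIntegrable
  locInt_grad := (continuous_gradient hφ).locallyIntegrable
  parts ψ hψ hs w := by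
    have hfc : Continuous fun x => fderiv ℝ φ x w :=
      (hφ.continuous_fderiv one_ne_zero).clm_apply continuous_const
    have e : ∀ x, inner ℝ (gradient φ x) w = fderiv ℝ φ x w := fun x => by simp
    simp only [e]
    rw [integral_mul_fderiv_eq_neg_fderiv_mul_of_integrable, neg_neg]
    · exact integrable_mul_of_locallyIntegrable hfc.locallyIntegrable hψ.continuous hs
    · exact integrable_mul_fderiv hφ.continuous.locallyIntegrable hψ hs w
    · exact integrable_mul_of_locallyIntegrable hφ.continuous.locallyIntegrable hψ.continuous hs
    · exact fun x _ => hφ.differentiable one_ne_zero x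
    · exact fun x _ => hψ.differentiable (by simp) x

/-- The affine function `x ↦ a + (b, x)`. -/
noncomputable def aff (a : ℝ) (b : Sp N) : Sp N → ℝ := fun x => a + inner ℝ b x

theorem aff_mem_P1 (a : ℝ) (b : Sp N) : aff a b ∈ P1 N := ⟨a, b, fun _ => rfl⟩

theorem exists_eq_aff {p : Sp N → ℝ} (hp : p ∈ P1 N) : ∃ a b, p = aff a b := by
  obtain ⟨a, b, h⟩ := hp
  exact ⟨a, b, funext h⟩

theorem contDiff_aff (a : ℝ) (b : Sp N) {n : WithTop ℕ∞} : ContDiff ℝ n (aff a b) :=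
  contDiff_const.add (contDiff_const.inner ℝ contDiff_id)

theorem gradient_aff (a : ℝ) (b : Sp N) : gradient (aff a b) = fun _ => b := by
  funext x
  refine HasGradientAt.gradient ?_
  rw [hasGradientAt_iff_hasFDerivAt]
  exact ((InnerProductSpace.toDual ℝ (Sp N) b).hasFDerivAt (x := x)).const_add a

theorem isWeakGrad_aff (a : ℝ) (b : Sp N) : IsWeakGrad (aff a b) fun _ => b :=
  gradient_aff a b ▸ isWeakGrad_of_contDiff (contDiff_aff a b)

theorem ae_eq_aff_of_wgrad_ae_eq_const {u : Sp N → ℝ} (hu : WeaklyDiff u) {b : Sp N}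
    (h : wgrad u =ᵐ[volume] fun _ => b) : ∃ a, u =ᵐ[volume] aff a b := by
  have h1 := (isWeakGrad_wgrad hu).sub (isWeakGrad_aff 0 b)
  have h2 : IsWeakGrad (u - aff 0 b) 0 := h1.congr EventuallyEq.rfl (by
    filter_upwards [h] with x hx
    simp [hx])
  obtain ⟨c, hc⟩ := ae_eq_const_of_isWeakGrad_zero h2
  refine ⟨c, ?_⟩
  filter_upwards [hc] with x hx
  simp only [Pi.sub_apply, aff, zero_add] at hx ⊢
  linarith

end WeakGradient

/-! ### The energy as a weighted square norm of gradient differences -/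

section Energy

variable {N : ℕ}

/-- The measure `|x - y|^{-(N+2σ)} dx dy` on `Q(Ω)`. -/
noncomputable def kernelMeasure (σ : ℝ) (Ω : Set (Sp N)) : Measure (Sp N × Sp N) :=
  (volume.restrict (Q Ω)).withDensity fun z =>
    ENNReal.ofReal (‖z.1 - z.2‖ ^ ((N : ℝ) + 2 * σ))⁻¹

/-- The gradient difference `(x, y) ↦ ∇u(x) - ∇u(y)`. -/
noncomputable def gradDiff (u : Sp N → ℝ) : Sp N × Sp N → Sp N :=
  fun z => wgrad u z.1 - wgrad u z.2

theorem measurable_kernel (σ : ℝ) :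
    Measurable fun z : Sp N × Sp N => (‖z.1 - z.2‖ ^ ((N : ℝ) + 2 * σ))⁻¹ := by fun_prop

theorem kernelMeasure_absolutelyContinuous (σ : ℝ) (Ω : Set (Sp N)) :
    kernelMeasure σ Ω ≪ volume :=
  (withDensity_absolutelyContinuous _ _).trans Measure.restrict_le_self.absolutelyContinuous

theorem aestronglyMeasurable_sub_prod {U : Sp N → Sp N} (hU : AEStronglyMeasurable U volume) :
    AEStronglyMeasurable (fun z : Sp N × Sp N => U z.1 - U z.2) volume :=
  (hU.comp_quasiMeasurePreserving Measure.quasiMeasurePreserving_fst).sub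
    (hU.comp_quasiMeasurePreserving Measure.quasiMeasurePreserving_snd)

theorem ae_prod_sub_of_ae {U V : Sp N → Sp N} (h : U =ᵐ[volume] V) :
    (fun z : Sp N × Sp N => U z.1 - U z.2) =ᵐ[volume] fun z => V z.1 - V z.2 := by
  have h1 : ∀ᵐ z : Sp N × Sp N, U z.1 = V z.1 :=
    (Measure.quasiMeasurePreserving_fst (μ := (volume : Measure (Sp N)))
      (ν := (volume : Measure (Sp N)))).ae h
  have h2 : ∀ᵐ z : Sp N × Sp N, U z.2 = V z.2 :=
    (Measure.quasiMeasurePreserving_snd (μ := (volume : Measure (Sp N)))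
      (ν := (volume : Measure (Sp N)))).ae h
  filter_upwards [h1, h2] with z a b
  rw [a, b]

theorem aestronglyMeasurable_gradDiff {u : Sp N → ℝ} (hu : WeaklyDiff u) (σ : ℝ) (Ω : Set (Sp N)) :
    AEStronglyMeasurable (gradDiff u) (kernelMeasure σ Ω) :=
  (aestronglyMeasurable_sub_prod (isWeakGrad_wgrad hu).locInt_grad.aestronglyMeasurable).mono_ac
    (kernelMeasure_absolutelyContinuous σ Ω)

theorem IsWeakGrad.gradDiff_ae_eq {u : Sp N → ℝ} {U : Sp N → Sp N} (hU : IsWeakGrad u U) (σ : ℝ)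
    (Ω : Set (Sp N)) : gradDiff u =ᵐ[kernelMeasure σ Ω] fun z => U z.1 - U z.2 :=
  (kernelMeasure_absolutelyContinuous σ Ω).ae_eq (ae_prod_sub_of_ae hU.wgrad_ae_eq)

/-- The energy is the squared `L²` norm of the gradient difference for the kernel measure. -/
theorem energy_eq (σ : ℝ) (Ω : Set (Sp N)) {u : Sp N → ℝ} :
    energy σ Ω u = eLpNorm (gradDiff u) 2 (kernelMeasure σ Ω) ^ 2 := by
  rw [eLpNorm_two_sq, kernelMeasure, lintegral_withDensity_eq_lintegral_mul_non_measurable _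
    (measurable_kernel σ).ennreal_ofReal (Eventually.of_forall fun z => ENNReal.ofReal_lt_top)]
  refine lintegral_congr fun z => ?_
  rw [Pi.mul_apply, ← ofReal_norm, ← ENNReal.ofReal_pow (norm_nonneg _),
    ← ENNReal.ofReal_mul (by positivity), div_eq_inv_mul]
  rfl

/-- The bilinear form is the `L²` inner product of gradient differences for the kernel measure. -/
theorem form_eq (σ : ℝ) (Ω : Set (Sp N)) (u v : Sp N → ℝ) :
    form σ Ω u v = ∫ z, inner ℝ (gradDiff u z) (gradDiff v z) ∂(kernelMeasure σ Ω) := by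
  rw [kernelMeasure, integral_withDensity_eq_integral_toReal_smul
    (measurable_kernel σ).ennreal_ofReal (Eventually.of_forall fun z => ENNReal.ofReal_lt_top)]
  refine integral_congr_ae (Eventually.of_forall fun z => ?_)
  dsimp only
  rw [ENNReal.toReal_ofReal (by positivity), div_eq_inv_mul]
  rfl

theorem memLp_gradDiff {σ : ℝ} {Ω : Set (Sp N)} {u : Sp N → ℝ} (hu : WeaklyDiff u)
    (he : energy σ Ω u < ⊤) : MemLp (gradDiff u) 2 (kernelMeasure σ Ω) := by
  refine ⟨aestronglyMeasurable_gradDiff hu σ Ω, ?_⟩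
  rw [energy_eq] at he
  exact (ENNReal.pow_lt_top_iff.1 he).resolve_right two_ne_zero

theorem gradDiff_aff_ae_eq (σ : ℝ) (Ω : Set (Sp N)) (a : ℝ) (b : Sp N) :
    gradDiff (aff a b) =ᵐ[kernelMeasure σ Ω] 0 := by
  filter_upwards [(isWeakGrad_aff a b).gradDiff_ae_eq σ Ω] with z hz
  simpa using hz

theorem gradDiff_add_ae_eq (σ : ℝ) (Ω : Set (Sp N)) {u v : Sp N → ℝ} (hu : WeaklyDiff u)
    (hv : WeaklyDiff v) :
    gradDiff (u + v) =ᵐ[kernelMeasure σ Ω] gradDiff u + gradDiff v := by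
  filter_upwards [((isWeakGrad_wgrad hu).add (isWeakGrad_wgrad hv)).gradDiff_ae_eq σ Ω] with z hz
  rw [hz]
  simp only [gradDiff, Pi.add_apply]
  abel

theorem gradDiff_sub_ae_eq (σ : ℝ) (Ω : Set (Sp N)) {u v : Sp N → ℝ} (hu : WeaklyDiff u)
    (hv : WeaklyDiff v) :
    gradDiff (u - v) =ᵐ[kernelMeasure σ Ω] gradDiff u - gradDiff v := by
  filter_upwards [((isWeakGrad_wgrad hu).sub (isWeakGrad_wgrad hv)).gradDiff_ae_eq σ Ω] with z hz
  rw [hz]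
  simp only [gradDiff, Pi.sub_apply]
  abel

theorem gradDiff_smul_ae_eq (σ : ℝ) (Ω : Set (Sp N)) (c : ℝ) {u : Sp N → ℝ} (hu : WeaklyDiff u) :
    gradDiff (c • u) =ᵐ[kernelMeasure σ Ω] c • gradDiff u := by
  filter_upwards [((isWeakGrad_wgrad hu).smul c).gradDiff_ae_eq σ Ω] with z hz
  rw [hz]
  simp only [gradDiff, Pi.smul_apply, smul_sub]

/-- The kernel is bounded below by `(2R)^{-(N+2σ)}` on pairs of points of a ball of radius `R`, away
from the diagonal. -/
theorem setLIntegral_prod_le_kernelMeasure {σ : ℝ} (hσ : 0 < σ) {Ω : Set (Sp N)} (hΩ : IsOpen Ω)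
    {F : Sp N × Sp N → ℝ≥0∞} (hF0 : ∀ x, F (x, x) = 0) {R : ℝ} (hR : 0 ≤ R) :
    ∫⁻ z in (Metric.ball 0 R ×ˢ (Ω ∩ Metric.ball 0 R)), F z ≤
      ENNReal.ofReal ((2 * R) ^ ((N : ℝ) + 2 * σ)) * ∫⁻ z, F z ∂(kernelMeasure σ Ω) := by
  have hp : 0 < (N : ℝ) + 2 * σ := by positivity
  rw [kernelMeasure, lintegral_withDensity_eq_lintegral_mul_non_measurable _
    (measurable_kernel σ).ennreal_ofReal (Eventually.of_forall fun z => ENNReal.ofReal_lt_top),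
    ← lintegral_const_mul' _ _ ENNReal.ofReal_ne_top]
  refine le_trans (setLIntegral_mono' (Metric.isOpen_ball.measurableSet.prod
    (hΩ.inter Metric.isOpen_ball).measurableSet) fun z hz => ?_) (lintegral_mono_set ?_)
  · rcases eq_or_ne z.1 z.2 with h | h
    · -- the kernel has the junk value `0` on the diagonal, where `F` vanishes
      obtain ⟨x, y⟩ := z
      obtain rfl : x = y := h
      simp [hF0]
    · rw [Pi.mul_apply, ← mul_assoc, ← ENNReal.ofReal_mul (by positivity)]
      refine le_mul_of_one_le_left' ?_
      rw [← ENNReal.ofReal_one]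
      refine ENNReal.ofReal_le_ofReal ?_
      have h0 : 0 < ‖z.1 - z.2‖ := norm_pos_iff.2 (sub_ne_zero.2 h)
      rw [← div_eq_mul_inv, one_le_div (by positivity)]
      refine Real.rpow_le_rpow h0.le ?_ hp.le
      have h1 := mem_ball_zero_iff.1 hz.1
      have h2 := mem_ball_zero_iff.1 hz.2.2
      linarith [norm_sub_le z.1 z.2]
  · rintro z hz ⟨-, h⟩
    exact h hz.2.1

end Energy

/-! ### Local control by the energy -/

section Control

variable {N : ℕ}

theorem exists_smooth_weight {Ω : Set (Sp N)} (hΩ : IsOpen Ω) (hne : Ω.Nonempty) :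
    ∃ η : Sp N → ℝ, ContDiff ℝ ((⊤ : ℕ∞) : WithTop ℕ∞) η ∧ HasCompactSupport η ∧
      tsupport η ⊆ Ω ∧ (∀ x, 0 ≤ η x) ∧ ∫ x, η x = 1 := by
  obtain ⟨x₀, hx₀⟩ := hne
  obtain ⟨r, hr, hrΩ⟩ := Metric.nhds_basis_closedBall.mem_iff.1 (hΩ.mem_nhds hx₀)
  let b : ContDiffBump x₀ := ⟨r / 2, r, half_pos hr, half_lt_self hr⟩
  refine ⟨b.normed volume, b.contDiff_normed, b.hasCompactSupport_normed, ?_, b.nonneg_normed,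
    b.integral_normed⟩
  rw [b.tsupport_normed_eq]
  exact hrΩ

/-- A weighted mean of the weak gradient is controlled by the function alone. -/
theorem enorm_integral_smul_grad_sq_le {u : Sp N → ℝ} {U : Sp N → Sp N} (hu : IsWeakGrad u U)
    {η : Sp N → ℝ} (hη : ContDiff ℝ ((⊤ : ℕ∞) : WithTop ℕ∞) η) (hs : HasCompactSupport η) :
    ‖∫ x, η x • U x‖ₑ ^ 2 ≤
      (∫⁻ x, ‖fderiv ℝ η x‖ₑ) * ∫⁻ x, ‖fderiv ℝ η x‖ₑ * ‖u x‖ₑ ^ 2 := by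
  set G := ∫ x, η x • U x with hG
  have hi := hu.locInt_grad.integrable_smul_left_of_hasCompactSupport hη.continuous hs
  have hc : Continuous (fderiv ℝ η) := hη.continuous_fderiv (by simp)
  -- test the weak gradient with `η` in the direction `G`
  have e : inner ℝ G G = -∫ x, u x * fderiv ℝ η x G := by
    rw [← hu.parts η hη hs G]
    nth_rewrite 2 [hG]
    rw [← integral_inner hi]
    refine integral_congr_ae (Eventually.of_forall fun x => ?_)
    dsimp only
    rw [real_inner_smul_right, real_inner_comm, mul_comm]
  have h1 : ‖G‖ₑ * ‖G‖ₑ ≤ (∫⁻ x, ‖fderiv ℝ η x‖ₑ * ‖u x‖ₑ) * ‖G‖ₑ := by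
    calc ‖G‖ₑ * ‖G‖ₑ = ‖inner ℝ G G‖ₑ := by
          rw [real_inner_self_eq_norm_mul_norm, enorm_mul, enorm_norm]
      _ ≤ ∫⁻ x, ‖u x * fderiv ℝ η x G‖ₑ := by
          rw [e, enorm_neg]
          exact enorm_integral_le_lintegral_enorm _
      _ ≤ ∫⁻ x, ‖fderiv ℝ η x‖ₑ * ‖u x‖ₑ * ‖G‖ₑ := by
          refine lintegral_mono fun x => ?_
          dsimp only
          rw [enorm_mul, mul_comm ‖fderiv ℝ η x‖ₑ, mul_assoc]
          exact mul_le_mul_right ((fderiv ℝ η x).le_opENorm G) _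
      _ = _ := lintegral_mul_const' _ _ (by finiteness)
  have h2 : ‖G‖ₑ ≤ ∫⁻ x, ‖fderiv ℝ η x‖ₑ * ‖u x‖ₑ := by
    rcases eq_or_ne G 0 with h | h
    · simp [h]
    · exact (ENNReal.mul_le_mul_iff_left (by simpa using h) (by finiteness)).1 h1
  calc ‖G‖ₑ ^ 2 ≤ (∫⁻ x, ‖fderiv ℝ η x‖ₑ * ‖u x‖ₑ) ^ 2 := by gcongr
    _ ≤ _ := sq_lintegral_mul_le hc.measurable.enorm.aemeasurable
        hu.locInt.aestronglyMeasurable.enorm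

/-- On balls, the gradient is controlled by the energy and the `L²(Ω)` norm: it is compared with its
mean `G` for a smooth weight supported in `Ω`. -/
theorem exists_eLpNorm_wgrad_ball_le {σ : ℝ} (hσ : 0 < σ) {Ω : Set (Sp N)} (hΩ : IsOpen Ω)
    (hne : Ω.Nonempty) (hb : Bornology.IsBounded Ω) (R : ℝ) :
    ∃ C : ℝ≥0, ∀ u : Sp N → ℝ, WeaklyDiff u →
      eLpNorm (wgrad u) 2 (volume.restrict (Metric.ball 0 R)) ≤
        C * (eLpNorm (gradDiff u) 2 (kernelMeasure σ Ω) + eLpNorm u 2 (volume.restrict Ω)) := by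
  obtain ⟨η, hη, hs, hsΩ, hη0, hη1⟩ := exists_smooth_weight hΩ hne
  obtain ⟨R₁, hR₁⟩ := hb.subset_ball 0
  set R₂ := max (max R R₁) 0
  have hR₂ : 0 ≤ R₂ := le_max_right _ _
  have hΩB : Ω ⊆ Metric.ball 0 R₂ := hR₁.trans (Metric.ball_subset_ball (by simp [R₂]))
  have hRB : Metric.ball (0 : Sp N) R ⊆ Metric.ball 0 R₂ := Metric.ball_subset_ball (by simp [R₂])
  have hBfin : volume (Metric.ball (0 : Sp N) R₂) ≠ ⊤ := measure_ball_lt_top.ne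
  set B := Metric.ball (0 : Sp N) R₂
  have hηi : Integrable η := hη.continuous.integrable_of_hasCompactSupport hs
  have hc : Continuous (fderiv ℝ η) := hη.continuous_fderiv (by simp)
  have hds : HasCompactSupport (fderiv ℝ η) := hs.fderiv ℝ
  obtain ⟨M, hM⟩ := hη.continuous.bounded_above_of_compact_support hs
  obtain ⟨M', hM'⟩ := hc.bounded_above_of_compact_support hds
  have hDfin : ∫⁻ x, ‖fderiv ℝ η x‖ₑ ≠ ⊤ := (hc.integrable_of_hasCompactSupport hds).2.ne
  set K₁ := ENNReal.ofReal M * ENNReal.ofReal ((2 * R₂) ^ ((N : ℝ) + 2 * σ))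
  set K₂ := (∫⁻ x, ‖fderiv ℝ η x‖ₑ) * ENNReal.ofReal M'
  obtain ⟨C, hC⟩ := exists_le_coe_sq (K := 2 * K₁ + 2 * (K₂ * volume B)) (by finiteness)
  refine ⟨C, fun u hu => le_mul_add_of_sq_le ?_⟩
  have hw := isWeakGrad_wgrad hu
  have hwm := hw.locInt_grad.aestronglyMeasurable
  set G := ∫ x, η x • wgrad u x with hG
  have hGb : ‖G‖ₑ ^ 2 ≤ K₂ * ∫⁻ x in Ω, ‖u x‖ₑ ^ 2 := by
    refine (enorm_integral_smul_grad_sq_le hw hη hs).trans ?_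
    rw [mul_assoc, ← lintegral_const_mul' _ _ ENNReal.ofReal_ne_top,
      ← lintegral_indicator hΩ.measurableSet]
    gcongr with x
    by_cases hx : x ∈ Ω
    · rw [indicator_of_mem hx]
      gcongr
      rw [← ofReal_norm]
      exact ENNReal.ofReal_le_ofReal (hM' x)
    · have h0 : fderiv ℝ η x = 0 := by
        by_contra h
        exact hx (hsΩ (support_fderiv_subset ℝ h))
      rw [← ofReal_norm, h0, norm_zero, ENNReal.ofReal_zero, zero_mul]
      exact zero_le
  have hsub : ∀ x, G - wgrad u x = -∫ y, η y • gradDiff u (x, y) := by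
    intro x
    simp only [gradDiff, smul_sub]
    rw [integral_sub (hηi.smul_const _)
      (hw.locInt_grad.integrable_smul_left_of_hasCompactSupport hη.continuous hs),
      integral_smul_const, hη1, one_smul, neg_sub]
  have hdiff : ∫⁻ x in B, ‖G - wgrad u x‖ₑ ^ 2 ≤
      K₁ * ∫⁻ z, ‖gradDiff u z‖ₑ ^ 2 ∂(kernelMeasure σ Ω) := by
    calc ∫⁻ x in B, ‖G - wgrad u x‖ₑ ^ 2
        ≤ ∫⁻ x in B, ∫⁻ y in Ω, ENNReal.ofReal M * ‖gradDiff u (x, y)‖ₑ ^ 2 := by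
          refine lintegral_mono fun x => ?_
          dsimp only
          rw [hsub, enorm_neg]
          refine (enorm_integral_smul_sq_le hη0 hηi hη1.le
            ((aestronglyMeasurable_const (b := wgrad u x)).sub hwm)).trans ?_
          rw [← lintegral_indicator hΩ.measurableSet]
          refine lintegral_mono fun y => ?_
          by_cases hy : y ∈ Ω
          · rw [indicator_of_mem hy]
            gcongr
            · exact (le_abs_self _).trans (hM y)
            · rfl
          · have h0 : η y = 0 := by
              by_contra h
              exact hy (hsΩ (subset_tsupport η h))
            simp [h0]
      _ = ∫⁻ z in B ×ˢ (Ω ∩ B), ENNReal.ofReal M * ‖gradDiff u z‖ₑ ^ 2 := by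
          rw [inter_eq_self_of_subset_left hΩB, Measure.volume_eq_prod, ← Measure.prod_restrict,
            lintegral_prod]
          rw [Measure.prod_restrict]
          exact ((aestronglyMeasurable_sub_prod hwm).enorm.pow_const 2).const_mul _ |>.restrict
      _ ≤ _ := by
          rw [lintegral_const_mul' _ _ ENNReal.ofReal_ne_top]
          simp only [K₁, mul_assoc]
          gcongr
          exact setLIntegral_prod_le_kernelMeasure hσ hΩ (F := fun z => ‖gradDiff u z‖ₑ ^ 2)
            (fun x => by simp [gradDiff]) hR₂
  rw [eLpNorm_two_sq, eLpNorm_two_sq, eLpNorm_two_sq]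
  set A := ∫⁻ z, ‖gradDiff u z‖ₑ ^ 2 ∂(kernelMeasure σ Ω)
  set a := ∫⁻ x in Ω, ‖u x‖ₑ ^ 2
  calc ∫⁻ x in Metric.ball 0 R, ‖wgrad u x‖ₑ ^ 2
      ≤ ∫⁻ x in B, ‖wgrad u x‖ₑ ^ 2 := lintegral_mono_set hRB
    _ ≤ ∫⁻ x in B, (2 * ‖G - wgrad u x‖ₑ ^ 2 + 2 * ‖G‖ₑ ^ 2) :=
        lintegral_mono fun x => enorm_sq_le_two_mul _ _
    _ = 2 * (∫⁻ x in B, ‖G - wgrad u x‖ₑ ^ 2) + 2 * (‖G‖ₑ ^ 2 * volume B) := by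
        rw [lintegral_add_right _ measurable_const, setLIntegral_const,
          lintegral_const_mul' _ _ ENNReal.ofNat_ne_top, mul_assoc]
    _ ≤ 2 * (K₁ * A) + 2 * (K₂ * a * volume B) := by gcongr
    _ ≤ (2 * K₁ + 2 * (K₂ * volume B)) * (A + a) := by
        rw [add_mul]
        refine add_le_add ?_ ?_
        · rw [← mul_assoc]
          gcongr
          exact le_self_add
        · rw [mul_right_comm, ← mul_assoc]
          gcongr
          exact le_add_self
    _ ≤ _ := by gcongr

/-- On balls, the `H¹` norm is controlled by the energy and the `L²(Ω)` norm. -/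
theorem exists_eLpNorm_H1_ball_le {σ : ℝ} (hσ : 0 < σ) {Ω : Set (Sp N)} (hΩ : IsOpen Ω)
    (hne : Ω.Nonempty) (hb : Bornology.IsBounded Ω) (R : ℝ) :
    ∃ C : ℝ≥0, ∀ u : Sp N → ℝ, WeaklyDiff u →
      eLpNorm u 2 (volume.restrict (Metric.ball 0 R)) +
        eLpNorm (wgrad u) 2 (volume.restrict (Metric.ball 0 R)) ≤
        C * (eLpNorm (gradDiff u) 2 (kernelMeasure σ Ω) + eLpNorm u 2 (volume.restrict Ω)) := by
  obtain ⟨C₁, R', h₁⟩ := exists_eLpNorm_ball_le hb (hΩ.measure_pos volume hne).ne' R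
  obtain ⟨C₂, h₂⟩ := exists_eLpNorm_wgrad_ball_le hσ hΩ hne hb R
  obtain ⟨C₃, h₃⟩ := exists_eLpNorm_wgrad_ball_le hσ hΩ hne hb R'
  refine ⟨C₁ * (C₃ + 1) + C₂, fun u hu => ?_⟩
  push_cast
  rw [add_mul, mul_assoc, add_mul, one_mul]
  refine add_le_add ((h₁ u _ (isWeakGrad_wgrad hu)).trans ?_) (h₂ u hu)
  gcongr
  · exact h₃ u hu
  · exact le_add_self

/-- A weakly differentiable function of zero energy is affine: `∇u(x) = ∇u(y)` for almost all `x` in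
the space and `y ∈ Ω`, so that `∇u` is constant. -/
theorem exists_ae_eq_aff_of_gradDiff_ae_eq_zero {σ : ℝ} {Ω : Set (Sp N)}
    (hΩ : IsOpen Ω) (hne : Ω.Nonempty) {u : Sp N → ℝ} (hu : WeaklyDiff u) (hσ : 0 < σ)
    (h : gradDiff u =ᵐ[kernelMeasure σ Ω] 0) : ∃ a b, u =ᵐ[volume] aff a b := by
  have hwm := (isWeakGrad_wgrad hu).locInt_grad.aestronglyMeasurable
  have h0 : ∫⁻ z, ‖gradDiff u z‖ₑ ^ 2 ∂(kernelMeasure σ Ω) = 0 := by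
    rw [lintegral_eq_zero_iff' ((aestronglyMeasurable_gradDiff hu σ Ω).enorm.pow_const 2)]
    filter_upwards [h] with z hz
    simp [hz]
  have h1 : ∀ n : ℕ, ∀ᵐ y ∂(volume : Measure (Sp N)), y ∈ Ω ∩ Metric.ball 0 n →
      ∀ᵐ x ∂(volume : Measure (Sp N)), x ∈ Metric.ball (0 : Sp N) n → wgrad u x = wgrad u y := by
    intro n
    have h2 := setLIntegral_prod_le_kernelMeasure hσ hΩ (F := fun z => ‖gradDiff u z‖ₑ ^ 2)
      (fun x => by simp [gradDiff]) (R := n) n.cast_nonneg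
    have hm : AEMeasurable (fun z : Sp N × Sp N => ‖gradDiff u z‖ₑ ^ 2) volume :=
      (aestronglyMeasurable_sub_prod hwm).enorm.pow_const 2
    rw [h0, mul_zero, nonpos_iff_eq_zero, lintegral_eq_zero_iff' hm.restrict,
      Measure.volume_eq_prod,
      ← Measure.prod_restrict] at h2
    have h3 := Measure.ae_ae_of_ae_prod
      (Measure.measurePreserving_swap.quasiMeasurePreserving.ae h2)
    rw [← ae_restrict_iff' (hΩ.inter Metric.isOpen_ball).measurableSet]
    filter_upwards [h3] with y hy
    rw [← ae_restrict_iff' Metric.isOpen_ball.measurableSet]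
    filter_upwards [hy] with x hx
    simpa [gradDiff, sub_eq_zero] using hx
  have hpos : ∃ᵐ y ∂(volume : Measure (Sp N)), y ∈ Ω := by
    rw [frequently_ae_mem_iff]
    exact (hΩ.measure_pos volume hne).ne'
  obtain ⟨y, hyΩ, hy⟩ := (hpos.and_eventually (ae_all_iff.2 h1)).exists
  suffices hc : wgrad u =ᵐ[volume] fun _ => wgrad u y by
    obtain ⟨a, ha⟩ := ae_eq_aff_of_wgrad_ae_eq_const hu hc
    exact ⟨a, _, ha⟩
  have h3 : ∀ᵐ x ∂(volume : Measure (Sp N)), ∀ n : ℕ, y ∈ Metric.ball (0 : Sp N) n →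
      x ∈ Metric.ball (0 : Sp N) n → wgrad u x = wgrad u y := by
    refine ae_all_iff.2 fun n => ?_
    by_cases hn : y ∈ Metric.ball (0 : Sp N) n
    · filter_upwards [hy n ⟨hyΩ, hn⟩] with x hx using fun _ => hx
    · exact Eventually.of_forall fun x h => absurd h hn
  filter_upwards [h3] with x hx
  obtain ⟨n, hn⟩ := exists_nat_gt (max ‖x‖ ‖y‖)
  exact hx n (mem_ball_zero_iff.2 (lt_of_le_of_lt (le_max_right _ _) hn))
    (mem_ball_zero_iff.2 (lt_of_le_of_lt (le_max_left _ _) hn))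

end Control

/-! ### Completeness -/

section Completeness

theorem tendsto_integral_smul_of_eLpNorm {X F : Type*} [MeasurableSpace X] [NormedAddCommGroup F]
    [NormedSpace ℝ F] {m : Measure X} {φ : X → ℝ} (hφ : MemLp φ 2 m)
    {f : ℕ → X → F} (hf : ∀ n, MemLp (f n) 2 m) {g : X → F} (hg : MemLp g 2 m)
    (h : Tendsto (fun n => eLpNorm (f n - g) 2 m) atTop (𝓝 0)) :
    Tendsto (fun n => ∫ x, φ x • f n x ∂m) atTop (𝓝 (∫ x, φ x • g x ∂m)) := by
  have hi : ∀ {k : X → F}, MemLp k 2 m → Integrable (fun x => φ x • k x) m := fun {k} hk =>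
    memLp_one_iff_integrable.1 (hk.smul hφ)
  refine tendsto_integral_of_L1' (fun x => φ x • g x) (hi hg).1
    (Eventually.of_forall fun n => hi (hf n)) ?_
  have h0 : Tendsto (fun n => eLpNorm φ 2 m * eLpNorm (f n - g) 2 m) atTop (𝓝 0) := by
    simpa using ENNReal.Tendsto.const_mul h (Or.inr hφ.2.ne)
  refine tendsto_of_tendsto_of_tendsto_of_le_of_le tendsto_const_nhds h0 (fun _ => zero_le)
    fun n => ?_
  have e : ((fun x => φ x • f n x) - fun x => φ x • g x) = φ • (f n - g) := by
    ext x
    simp [smul_sub]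
  dsimp only
  rw [e]
  exact eLpNorm_smul_le_mul_eLpNorm ((hf n).sub hg).1 hφ.1

variable {N : ℕ}

/-- Weak gradients pass to limits in `L²` on balls. -/
theorem isWeakGrad_of_tendsto {u : ℕ → Sp N → ℝ} {U : ℕ → Sp N → Sp N}
    (h : ∀ n, IsWeakGrad (u n) (U n)) {v : Sp N → ℝ} {V : Sp N → Sp N}
    (hum : ∀ n (R : ℝ), MemLp (u n) 2 (volume.restrict (Metric.ball 0 R)))
    (hUm : ∀ n (R : ℝ), MemLp (U n) 2 (volume.restrict (Metric.ball 0 R)))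
    (hvm : ∀ R : ℝ, MemLp v 2 (volume.restrict (Metric.ball 0 R)))
    (hVm : ∀ R : ℝ, MemLp V 2 (volume.restrict (Metric.ball 0 R)))
    (hu : ∀ R : ℝ, Tendsto (fun n => eLpNorm (u n - v) 2 (volume.restrict (Metric.ball 0 R))) atTop
      (𝓝 0))
    (hU : ∀ R : ℝ, Tendsto (fun n => eLpNorm (U n - V) 2 (volume.restrict (Metric.ball 0 R))) atTop
      (𝓝 0)) : IsWeakGrad v V where
  locInt := locallyIntegrable_of_memLp_ball hvm
  locInt_grad := locallyIntegrable_of_memLp_ball hVm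
  parts φ hφ hs w := by
    obtain ⟨R, hR⟩ : ∃ R : ℝ, tsupport φ ⊆ Metric.ball 0 R := hs.isBounded.subset_ball 0
    have key : ∀ {F : Type} [NormedAddCommGroup F] [NormedSpace ℝ F] {ψ : Sp N → ℝ},
        Continuous ψ → HasCompactSupport ψ → tsupport ψ ⊆ Metric.ball 0 R →
        ∀ {f : ℕ → Sp N → F} {g : Sp N → F},
        (∀ n, MemLp (f n) 2 (volume.restrict (Metric.ball 0 R))) →
        MemLp g 2 (volume.restrict (Metric.ball 0 R)) →
        Tendsto (fun n => eLpNorm (f n - g) 2 (volume.restrict (Metric.ball 0 R))) atTop (𝓝 0) →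
        Tendsto (fun n => ∫ x, ψ x • f n x) atTop (𝓝 (∫ x, ψ x • g x)) := by
      intro F _ _ ψ hψ hψs hψR f g hf hg hfg
      have hψ2 : MemLp ψ 2 (volume.restrict (Metric.ball 0 R)) :=
        (hψ.memLp_of_hasCompactSupport hψs).restrict _
      have := tendsto_integral_smul_of_eLpNorm hψ2 hf hg hfg
      have e : ∀ k : Sp N → F, ∫ x in Metric.ball 0 R, ψ x • k x = ∫ x, ψ x • k x := fun k =>
        setIntegral_eq_integral_of_forall_compl_eq_zero fun x hx => by
          have : ψ x = 0 := by
            by_contra h0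
            exact hx (hψR (subset_tsupport ψ h0))
          simp [this]
      simpa only [e] using this
    have h1 := (key hφ.continuous hs hR (fun n => hUm n R) (hVm R) (hU R)).inner (𝕜 := ℝ)
      (tendsto_const_nhds (x := w))
    have hdc : Continuous fun x => fderiv ℝ φ x w :=
      (hφ.continuous_fderiv (by simp)).clm_apply continuous_const
    have h2 := key hdc (hs.fderiv_apply ℝ w)
      ((tsupport_fderiv_apply_subset ℝ w).trans hR) (fun n => hum n R) (hvm R) (hu R)
    have e1 : ∀ {W : Sp N → Sp N}, LocallyIntegrable W →
        inner ℝ (∫ x, φ x • W x) w = ∫ x, inner ℝ (W x) w * φ x := by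
      intro W hW
      have hi := hW.integrable_smul_left_of_hasCompactSupport hφ.continuous hs
      rw [real_inner_comm, ← integral_inner hi]
      refine integral_congr_ae (Eventually.of_forall fun x => ?_)
      dsimp only
      rw [real_inner_smul_right, real_inner_comm, mul_comm]
    have e2 : ∀ n, inner ℝ (∫ x, φ x • U n x) w = -∫ x, fderiv ℝ φ x w • u n x := by
      intro n
      rw [e1 (h n).locInt_grad, (h n).parts φ hφ hs w]
      simp only [smul_eq_mul, mul_comm]
    simp only [e2, e1 (locallyIntegrable_of_memLp_ball hVm)] at h1
    rw [tendsto_nhds_unique h1 h2.neg]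
    simp only [smul_eq_mul, mul_comm]

theorem ae_of_forall_ball {P : Sp N → Prop}
    (h : ∀ R : ℝ, ∀ᵐ x ∂(volume.restrict (Metric.ball (0 : Sp N) R)), P x) : ∀ᵐ x, P x := by
  have h1 : ∀ᵐ x ∂(volume : Measure (Sp N)), ∀ n : ℕ, x ∈ Metric.ball (0 : Sp N) n → P x :=
    ae_all_iff.2 fun n => (ae_restrict_iff' Metric.isOpen_ball.measurableSet).1 (h n)
  filter_upwards [h1] with x hx
  obtain ⟨n, hn⟩ := exists_nat_gt ‖x‖
  exact hx n (mem_ball_zero_iff.2 hn)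

/-- A sequence which is Cauchy at a summable rate in `L²` on every ball has a limit. -/
theorem exists_limit_of_cauchy_ball {F : Type*} [NormedAddCommGroup F] [CompleteSpace F]
    {f : ℕ → Sp N → F} (hf : ∀ n (R : ℝ), MemLp (f n) 2 (volume.restrict (Metric.ball 0 R)))
    (hfm : ∀ n, AEStronglyMeasurable (f n) volume)
    {B : ℕ → ℝ≥0∞} (hB : ∑' i, B i ≠ ⊤) {C : ℝ → ℝ≥0}
    (hc : ∀ (R : ℝ) (K n k : ℕ), K ≤ n → K ≤ k →
      eLpNorm (f n - f k) 2 (volume.restrict (Metric.ball 0 R)) < C R * B K) :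
    ∃ g : Sp N → F, (∀ᵐ x, Tendsto (fun n => f n x) atTop (𝓝 (g x))) ∧
      ∀ R : ℝ, MemLp g 2 (volume.restrict (Metric.ball 0 R)) ∧
        Tendsto (fun n => eLpNorm (f n - g) 2 (volume.restrict (Metric.ball 0 R))) atTop (𝓝 0) := by
  have hB' : ∀ R, ∑' i, (C R * B i : ℝ≥0∞) ≠ ⊤ := fun R => by
    rw [ENNReal.tsum_mul_left]
    exact ENNReal.mul_ne_top ENNReal.coe_ne_top hB
  have h1 : ∀ᵐ x, ∃ l, Tendsto (fun n => f n x) atTop (𝓝 l) :=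
    ae_of_forall_ball fun R => Lp.ae_tendsto_of_cauchy_eLpNorm (fun n => (hf n R).1) one_le_two
      (hB' R) (hc R)
  obtain ⟨g, hgm, hg⟩ := exists_stronglyMeasurable_limit_of_tendsto_ae hfm h1
  have h2 : ∀ R : ℝ,
      Tendsto (fun n => eLpNorm (f n - g) 2 (volume.restrict (Metric.ball 0 R))) atTop (𝓝 0) :=
    fun R => Lp.cauchy_tendsto_of_tendsto (fun n => (hf n R).1) g (hB' R) (hc R)
      (ae_restrict_of_ae hg)
  exact ⟨g, hg, fun R => ⟨Lp.memLp_of_cauchy_tendsto one_le_two (fun n => hf n R) g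
    hgm.aestronglyMeasurable (h2 R), h2 R⟩⟩

/-- Sequences of weakly differentiable functions which are Cauchy at a summable rate for the
energy and in `L²` of a measure above Lebesgue measure on `Ω` have a weakly differentiable limit. -/
theorem exists_weaklyDiff_limit {σ : ℝ} (hσ : 0 < σ) {Ω : Set (Sp N)} (hΩ : IsOpen Ω)
    (hne : Ω.Nonempty) (hb : Bornology.IsBounded Ω) {m : Measure (Sp N)} (hm : m ≪ volume)
    (hΩm : volume.restrict Ω ≤ m) {u : ℕ → Sp N → ℝ} (hu : ∀ n, WeaklyDiff (u n))
    (hu1 : ∀ n, eLpNorm (gradDiff (u n)) 2 (kernelMeasure σ Ω) < ⊤)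
    (hu2 : ∀ n, eLpNorm (u n) 2 m < ⊤) {B : ℕ → ℝ≥0∞} (hB : ∑' i, B i ≠ ⊤)
    (hc : ∀ K n k : ℕ, K ≤ n → K ≤ k →
      eLpNorm (gradDiff (u n) - gradDiff (u k)) 2 (kernelMeasure σ Ω) +
        eLpNorm (u n - u k) 2 m < B K) :
    ∃ v, WeaklyDiff v ∧
      Tendsto (fun n => eLpNorm (gradDiff (u n) - gradDiff v) 2 (kernelMeasure σ Ω)) atTop (𝓝 0) ∧
      Tendsto (fun n => eLpNorm (u n - v) 2 m) atTop (𝓝 0) := by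
  choose C hC using exists_eLpNorm_H1_ball_le (σ := σ) hσ hΩ hne hb
  have hum := fun n => (isWeakGrad_wgrad (hu n)).locInt.aestronglyMeasurable
  have hwm := fun n => (isWeakGrad_wgrad (hu n)).locInt_grad.aestronglyMeasurable
  have hfin : ∀ n R, eLpNorm (u n) 2 (volume.restrict (Metric.ball 0 R)) +
      eLpNorm (wgrad (u n)) 2 (volume.restrict (Metric.ball 0 R)) < ⊤ := fun n R =>
    (hC R (u n) (hu n)).trans_lt (ENNReal.mul_lt_top ENNReal.coe_lt_top
      (ENNReal.add_lt_top.2 ⟨hu1 n, (eLpNorm_mono_measure _ hΩm).trans_lt (hu2 n)⟩))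
  have m1 : ∀ n (R : ℝ), MemLp (u n) 2 (volume.restrict (Metric.ball 0 R)) := fun n R =>
    ⟨(hum n).restrict, (ENNReal.add_lt_top.1 (hfin n R)).1⟩
  have m2 : ∀ n (R : ℝ), MemLp (wgrad (u n)) 2 (volume.restrict (Metric.ball 0 R)) := fun n R =>
    ⟨(hwm n).restrict, (ENNReal.add_lt_top.1 (hfin n R)).2⟩
  have hcau : ∀ (R : ℝ) (K n k : ℕ), K ≤ n → K ≤ k →
      eLpNorm (u n - u k) 2 (volume.restrict (Metric.ball 0 R)) +
        eLpNorm (wgrad (u n) - wgrad (u k)) 2 (volume.restrict (Metric.ball 0 R)) <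
          (C R + 1 : ℝ≥0) * B K := by
    intro R K n k hn hk
    have hg := (isWeakGrad_wgrad (hu n)).sub (isWeakGrad_wgrad (hu k))
    have h1 := hC R (u n - u k) ⟨_, hg⟩
    rw [eLpNorm_congr_ae (ae_restrict_of_ae hg.wgrad_ae_eq),
      eLpNorm_congr_ae (gradDiff_sub_ae_eq σ Ω (hu n) (hu k))] at h1
    refine h1.trans_lt (lt_of_le_of_lt (b := ((C R + 1 : ℝ≥0) : ℝ≥0∞) * (eLpNorm (gradDiff (u n) -
      gradDiff (u k)) 2 (kernelMeasure σ Ω) + eLpNorm (u n - u k) 2 m)) ?_ ?_)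
    · gcongr
      · simp
    · exact (ENNReal.mul_lt_mul_iff_right (by simp) ENNReal.coe_ne_top).2 (hc K n k hn hk)
  obtain ⟨v, hv, hv2⟩ := exists_limit_of_cauchy_ball m1 hum hB (C := fun R => C R + 1)
    fun R K n k hn hk => lt_of_le_of_lt le_self_add (hcau R K n k hn hk)
  obtain ⟨V, hV, hV2⟩ := exists_limit_of_cauchy_ball m2 hwm hB (C := fun R => C R + 1)
    fun R K n k hn hk => lt_of_le_of_lt le_add_self (hcau R K n k hn hk)
  have hvV : IsWeakGrad v V := isWeakGrad_of_tendsto (fun n => isWeakGrad_wgrad (hu n)) m1 m2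
    (fun R => (hv2 R).1) (fun R => (hV2 R).1) (fun R => (hv2 R).2) fun R => (hV2 R).2
  refine ⟨v, ⟨V, hvV⟩, ?_, ?_⟩
  · refine Lp.cauchy_tendsto_of_tendsto (fun n => aestronglyMeasurable_gradDiff (hu n) σ Ω) _ hB
      (fun K n k hn hk => lt_of_le_of_lt le_self_add (hc K n k hn hk)) ?_
    have h1 : ∀ᵐ z : Sp N × Sp N, Tendsto (fun n => wgrad (u n) z.1) atTop (𝓝 (V z.1)) :=
      (Measure.quasiMeasurePreserving_fst (μ := (volume : Measure (Sp N)))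
        (ν := (volume : Measure (Sp N)))).ae hV
    have h2 : ∀ᵐ z : Sp N × Sp N, Tendsto (fun n => wgrad (u n) z.2) atTop (𝓝 (V z.2)) :=
      (Measure.quasiMeasurePreserving_snd (μ := (volume : Measure (Sp N)))
        (ν := (volume : Measure (Sp N)))).ae hV
    filter_upwards [(kernelMeasure_absolutelyContinuous σ Ω).ae_le h1,
      (kernelMeasure_absolutelyContinuous σ Ω).ae_le h2, hvV.gradDiff_ae_eq σ Ω] with z a b c
    rw [c]
    exact a.sub b
  · exact Lp.cauchy_tendsto_of_tendsto (fun n => (hum n).mono_ac hm) _ hB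
      (fun K n k hn hk => lt_of_le_of_lt le_add_self (hc K n k hn hk)) (hm.ae_le hv)

end Completeness

/-! ### The trace inequality -/

section Trace

variable {N : ℕ}

theorem orthogonalProjection_orthogonal_self (ν : Sp N) :
    (Submodule.span ℝ {ν})ᗮ.orthogonalProjectionOnto ν = 0 := by
  rw [Submodule.orthogonalProjectionOnto_eq_zero_iff]
  exact Submodule.le_orthogonal_orthogonal _ (Submodule.mem_span_singleton_self ν)

theorem orthogonalProjection_add_inner_smul {ν : Sp N} (hν : ‖ν‖ = 1) (x : Sp N) :
    ((Submodule.span ℝ {ν})ᗮ.orthogonalProjectionOnto x : Sp N) + inner ℝ ν x • ν = x := by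
  have h := Submodule.starProjection_add_starProjection_orthogonal (K := Submodule.span ℝ {ν}) x
  rw [Submodule.starProjection_unit_singleton ℝ hν x, add_comm] at h
  exact h

/-- Splitting along a unit vector `ν`: integrating over lines parallel to `ν` and then over `ν^⊥`
is integration over `ℝ^N`, up to a constant. -/
theorem exists_lintegral_split (ν : Sp N) (hν : ‖ν‖ = 1)
    (μV : Measure (Submodule.span ℝ {ν})ᗮ) [μV.IsAddHaarMeasure] :
    ∃ c : ℝ≥0, ∀ F : Sp N → ℝ≥0∞, Measurable F →
      ∫⁻ y, (∫⁻ s : ℝ, F (y + s • ν)) ∂μV = c * ∫⁻ x, F x := by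
  let L : ((Submodule.span ℝ {ν})ᗮ × ℝ) ≃ₗ[ℝ] Sp N :=
    { toFun := fun p => p.1 + p.2 • ν
      map_add' := fun p q => by simp only [Prod.fst_add, Prod.snd_add, Submodule.coe_add]; module
      map_smul' := fun c p => by
        simp only [Prod.smul_fst, Prod.smul_snd, Submodule.coe_smul, RingHom.id_apply, smul_eq_mul]
        module
      invFun := fun x => ((Submodule.span ℝ {ν})ᗮ.orthogonalProjectionOnto x, inner ℝ ν x)
      left_inv := fun p => by
        have h1 : inner ℝ ν (p.1 : Sp N) = 0 :=
          Submodule.mem_orthogonal_singleton_iff_inner_right.1 p.1.2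
        have h2 := orthogonalProjection_orthogonal_self ν
        ext1
        · simp [h2]
        · simp [inner_add_right, real_inner_smul_right, h1, hν]
      right_inv := fun x => orthogonalProjection_add_inner_smul hν x }
  let e := L.toContinuousLinearEquiv
  have : (Measure.map e (μV.prod volume)).IsAddHaarMeasure := e.isAddHaarMeasure_map _
  refine ⟨Measure.addHaarScalarFactor (Measure.map e (μV.prod volume)) volume, fun F hF => ?_⟩
  have h1 := congrArg (fun m => ∫⁻ x, F x ∂m) (Measure.isAddLeftInvariant_eq_smul
    (Measure.map e (μV.prod volume)) (volume : Measure (Sp N)))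
  simp only [lintegral_smul_measure] at h1
  refine Eq.trans ?_ h1
  rw [lintegral_map hF e.continuous.measurable, lintegral_prod]
  · rfl
  · exact (hF.comp e.continuous.measurable).aemeasurable

/-- The value at one end of a segment of length `ρ` is controlled by the mean of the function and of
its gradient along the segment. -/
theorem mul_enorm_sq_le_lintegral {φ : Sp N → ℝ} (hφ : ContDiff ℝ 1 φ) {ν : Sp N} (hν : ‖ν‖ = 1)
    (ρ : ℝ) (y : Sp N) :
    ENNReal.ofReal ρ * ‖φ y‖ₑ ^ 2 ≤ ∫⁻ t in Ioc 0 ρ, (2 * ‖φ (y + t • ν)‖ₑ ^ 2 +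
      2 * ENNReal.ofReal ρ ^ 2 * ‖gradient φ (y + t • ν)‖ₑ ^ 2) := by
  have hg : Continuous (gradient φ) := continuous_gradient hφ
  have hφc := hφ.continuous
  have hgm : Measurable fun t : ℝ =>
      2 * ENNReal.ofReal ρ ^ 2 * ‖gradient φ (y + t • ν)‖ₑ ^ 2 := by
    have : Continuous fun t : ℝ => gradient φ (y + t • ν) := by fun_prop
    exact (this.measurable.enorm.pow_const 2).const_mul _
  set A := ∫⁻ s in Ioc 0 ρ, ‖gradient φ (y + s • ν)‖ₑ ^ 2 with hA
  have hd : ∀ s : ℝ, HasDerivAt (fun s : ℝ => φ (y + s • ν))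
      (inner ℝ (gradient φ (y + s • ν)) ν) s := fun s => by
    have h1 := (hφ.differentiable one_ne_zero (y + s • ν)).hasGradientAt.hasFDerivAt
    have h2 : HasDerivAt (fun s : ℝ => y + s • ν) ν s := by
      simpa using ((hasDerivAt_id s).smul_const ν).const_add y
    exact (h1.comp_hasDerivAt s h2).congr_deriv (by simp)
  have hc : Continuous fun s : ℝ => inner ℝ (gradient φ (y + s • ν)) ν := by fun_prop
  have key : ∀ t ∈ Ioc 0 ρ, ‖φ (y + t • ν) - φ y‖ₑ ^ 2 ≤ ENNReal.ofReal ρ * A := by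
    intro t ht
    have hI := intervalIntegral.integral_eq_sub_of_hasDerivAt (a := 0) (b := t)
      (fun s _ => hd s) (hc.intervalIntegrable _ _)
    simp only [zero_smul, add_zero] at hI
    rw [← hI, intervalIntegral.integral_of_le ht.1.le]
    calc _ ≤ (∫⁻ s in Ioc 0 ρ, 1 * ‖gradient φ (y + s • ν)‖ₑ) ^ 2 := by
          gcongr
          refine (enorm_integral_le_lintegral_enorm _).trans ?_
          refine (lintegral_mono_set (Ioc_subset_Ioc_right ht.2)).trans (lintegral_mono fun s => ?_)
          dsimp only
          rw [one_mul, ← enorm_norm (gradient φ _)]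
          refine enorm_le_iff_norm_le.2 ?_
          rw [norm_norm]
          simpa [hν] using norm_inner_le_norm (𝕜 := ℝ) (gradient φ (y + s • ν)) ν
      _ ≤ _ := by
          refine (sq_lintegral_mul_le aemeasurable_const (by fun_prop)).trans_eq ?_
          simp [hA]
  calc ENNReal.ofReal ρ * ‖φ y‖ₑ ^ 2 = ∫⁻ t in Ioc 0 ρ, ‖φ y‖ₑ ^ 2 := by
        simp [mul_comm]
    _ ≤ ∫⁻ t in Ioc 0 ρ, (2 * ‖φ (y + t • ν)‖ₑ ^ 2 + 2 * (ENNReal.ofReal ρ * A)) := by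
        refine setLIntegral_mono' measurableSet_Ioc fun t ht => ?_
        rw [add_comm]
        exact (enorm_sq_le_two_mul (φ y) (φ (y + t • ν))).trans (by gcongr; exact key t ht)
    _ = _ := by
        rw [lintegral_add_right _ measurable_const, lintegral_add_right _ hgm,
          setLIntegral_const, lintegral_const_mul' _ (fun t => ‖gradient φ (y + t • ν)‖ₑ ^ 2)
            (by finiteness), Real.volume_Ioc, sub_zero]
        ring

/-- The hyperplane orthogonal to a unit vector has dimension `N - 1`, so that the measure defining
the surface measure is a Haar measure on it. -/
theorem finrank_orthogonal_span_unit {ν : Sp N} (hν : ‖ν‖ = 1) :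
    Module.finrank ℝ (Submodule.span ℝ {ν})ᗮ = N - 1 := by
  have h1 := Submodule.finrank_add_finrank_orthogonal (Submodule.span ℝ {ν})
  have h2 : ν ≠ 0 := fun h => by simp [h] at hν
  rw [finrank_span_singleton h2, finrank_euclideanSpace_fin] at h1
  omega

/-- The surface measure of a Lipschitz graph is bounded by Lebesgue measure on its base. -/
theorem restrict_le_map_of_lipschitzOn {W : Type*} [MetricSpace W] [MeasurableSpace W]
    [BorelSpace W] (d : ℕ) {γ : W → Sp N} (hγ : Measurable γ) {A : Set (Sp N)}
    {K : ℝ≥0} (hL : LipschitzOnWith K γ (γ ⁻¹' A))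
    (hsurj : A ⊆ range γ) :
    (Measure.euclideanHausdorffMeasure d).restrict A ≤ (K ^ d) •
      Measure.map γ ((Measure.euclideanHausdorffMeasure d : Measure W).restrict (γ ⁻¹' A)) := by
  refine Measure.le_iff.2 fun E hE => ?_
  rw [Measure.restrict_apply hE, Measure.smul_apply, Measure.map_apply hγ hE,
    Measure.restrict_apply (hγ hE), Measure.euclideanHausdorffMeasure_def,
    Measure.euclideanHausdorffMeasure_def, Measure.smul_apply, Measure.smul_apply, smul_comm]
  have h1 : E ∩ A ⊆ γ '' (γ ⁻¹' E ∩ γ ⁻¹' A) := by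
    rintro x ⟨hxE, hxA⟩
    obtain ⟨w, rfl⟩ := hsurj hxA
    exact ⟨w, ⟨hxE, hxA⟩, rfl⟩
  have h2 := (measure_mono (μ := Measure.hausdorffMeasure (d : ℝ)) h1).trans
    ((hL.mono inter_subset_right).hausdorffMeasure_image_le d.cast_nonneg)
  simp only [ENNReal.smul_def, smul_eq_mul]
  gcongr
  rw [ENNReal.coe_pow]
  exact_mod_cast h2

/-- The trace inequality near a boundary point: the boundary is the image of a Lipschitz graph map
`γ`, and from each of its points a segment of length `ρ` in the direction `ν` runs inside `Ω`. -/
theorem exists_local_trace_le {Ω : Set (Sp N)} (hΩ : IsBoundedC11Domain Ω) {x₀ : Sp N}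
    (hx₀ : x₀ ∈ frontier Ω) :
    ∃ r > 0, ∃ C : ℝ≥0, ∀ φ : Sp N → ℝ, ContDiff ℝ 1 φ →
      ∫⁻ x in frontier Ω ∩ Metric.ball x₀ r, ‖φ x‖ₑ ^ 2
        ∂(Measure.euclideanHausdorffMeasure (N - 1)) ≤
        C * ((∫⁻ x in Ω, ‖φ x‖ₑ ^ 2) + ∫⁻ x in Ω, ‖gradient φ x‖ₑ ^ 2) := by
  obtain ⟨r₀, hr₀, ν, hν, h, hh, -, hgr⟩ := hΩ.graph x₀ hx₀
  set P := (Submodule.span ℝ {ν})ᗮ.orthogonalProjectionOnto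
  have hPν : P ν = 0 := orthogonalProjection_orthogonal_self ν
  have hdec : ∀ x : Sp N, (P x : Sp N) + inner ℝ ν x • ν = x :=
    orthogonalProjection_add_inner_smul hν
  obtain ⟨K, t, ht, hKt⟩ := (hh.contDiffAt (x := P x₀)).exists_lipschitzOnWith
  obtain ⟨r₁, hr₁, hPt⟩ := Metric.mem_nhds_iff.1 (P.continuous.continuousAt.preimage_mem_nhds ht)
  set ρ := min (r₀ / 2) r₁
  have hρ : 0 < ρ := lt_min (half_pos hr₀) hr₁
  have hρ₀ : ρ ≤ r₀ / 2 := min_le_left _ _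
  set A := frontier Ω ∩ Metric.ball x₀ ρ
  have hAm : MeasurableSet A :=
    isClosed_frontier.measurableSet.inter Metric.isOpen_ball.measurableSet
  -- on the boundary the defining inequality is an equality
  have hbd : ∀ y ∈ A, h (P y) = inner ℝ ν y := by
    rintro y ⟨hyf, hyb⟩
    have hyb' : y ∈ Metric.ball x₀ r₀ := Metric.ball_subset_ball (by linarith) hyb
    have hyΩ : y ∉ Ω := fun hy => by
      rw [hΩ.isOpen.frontier_eq] at hyf
      exact hyf.2 hy
    refine le_antisymm ?_ (not_lt.1 fun hlt => hyΩ ((hgr y hyb').2 hlt))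
    by_contra! hlt
    have hcont : Continuous fun z => h (P z) - inner ℝ ν z :=
      (hh.continuous.comp P.continuous).sub (continuous_const.inner continuous_id)
    have hev : ∀ᶠ z in 𝓝 y, z ∉ Ω := by
      filter_upwards [hcont.continuousAt.eventually (lt_mem_nhds (sub_pos.2 hlt)),
        Metric.isOpen_ball.mem_nhds hyb'] with z hz hzb hzΩ
      have := (hgr z hzb).1 hzΩ
      linarith
    obtain ⟨z, hz1, hz2⟩ := (mem_closure_iff_frequently.1 hyf.1).and_eventually hev |>.exists
    exact hz2 hz1
  have hup : ∀ y ∈ A, ∀ s ∈ Ioc 0 ρ, y + s • ν ∈ Ω := by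
    intro y hy s hs
    refine (hgr _ ?_).2 ?_
    · have h1 : dist y x₀ < ρ := hy.2
      have h2 : dist (y + s • ν) y = s := by
        rw [dist_eq_norm, add_sub_cancel_left, norm_smul, hν, mul_one, Real.norm_of_nonneg hs.1.le]
      rw [Metric.mem_ball]
      linarith [dist_triangle (y + s • ν) y x₀, hs.2]
    · rw [map_add, map_smul, hPν, smul_zero, add_zero, hbd y hy, inner_add_right,
        real_inner_smul_right, real_inner_self_eq_norm_sq, hν]
      linarith [hs.1]
  set γ : (Submodule.span ℝ {ν})ᗮ → Sp N := fun y => y + h y • ν with hγ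
  have hγc : Continuous γ := continuous_subtype_val.add (hh.continuous.smul continuous_const)
  have hPγ : ∀ y, P (γ y) = y := fun y => by
    simp only [hγ, map_add, map_smul, hPν, smul_zero, add_zero]
    exact Submodule.orthogonalProjectionOnto_mem_subspace_eq_self y
  have hsurj : A ⊆ range γ := fun y hy => ⟨P y, by
    simp only [hγ]
    rw [hbd y hy, hdec]⟩
  have hγt : γ ⁻¹' A ⊆ t := fun y hy => by
    have := hPt (Metric.ball_subset_ball (min_le_right _ _) hy.2 : γ y ∈ Metric.ball x₀ r₁)
    rwa [mem_preimage, hPγ] at this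
  have hL : LipschitzOnWith (1 + K) γ (γ ⁻¹' A) := by
    refine LipschitzOnWith.of_dist_le_mul fun y hy z hz => ?_
    have h1 := hKt.dist_le_mul y (hγt hy) z (hγt hz)
    simp only [hγ]
    calc dist ((y : Sp N) + h y • ν) (z + h z • ν)
        ≤ dist (y : Sp N) z + dist (h y • ν) (h z • ν) := dist_add_add_le _ _ _ _
      _ = dist y z + dist (h y) (h z) := by
          rw [dist_eq_norm (h y • ν), ← sub_smul, norm_smul, hν, mul_one, ← dist_eq_norm]
          rfl
      _ ≤ _ := by
          push_cast
          linarith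
  have hfr := finrank_orthogonal_span_unit hν
  have hHaar : (Measure.euclideanHausdorffMeasure (N - 1) :
      Measure (Submodule.span ℝ {ν})ᗮ).IsAddHaarMeasure := by
    rw [← hfr]
    infer_instance
  set μV : Measure (Submodule.span ℝ {ν})ᗮ := Measure.euclideanHausdorffMeasure (N - 1)
  obtain ⟨c, hc⟩ := exists_lintegral_split ν hν μV
  have hmeas := restrict_le_map_of_lipschitzOn (N - 1) hγc.measurable hL hsurj
  set D : ℝ≥0 := (1 + K) ^ (N - 1) * (c * (Real.toNNReal ρ⁻¹ * (2 + 2 * Real.toNNReal ρ ^ 2)))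
  refine ⟨ρ, hρ, D, fun φ hφ => ?_⟩
  have hg : Continuous (gradient φ) := continuous_gradient hφ
  have hφc := hφ.continuous
  set H : Sp N → ℝ≥0∞ := fun x =>
    2 * ‖φ x‖ₑ ^ 2 + 2 * ENNReal.ofReal ρ ^ 2 * ‖gradient φ x‖ₑ ^ 2 with hH
  have hHm : Measurable H := by fun_prop
  have hcoef : ∀ a : ℝ≥0∞, ENNReal.ofReal ρ⁻¹ * (ENNReal.ofReal ρ * a) = a := fun a => by
    rw [← mul_assoc, ← ENNReal.ofReal_mul (by positivity), inv_mul_cancel₀ hρ.ne',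
      ENNReal.ofReal_one, one_mul]
  have hpt : ∀ y : (Submodule.span ℝ {ν})ᗮ, y ∈ γ ⁻¹' A →
      ‖φ (γ y)‖ₑ ^ 2 ≤ ENNReal.ofReal ρ⁻¹ * ∫⁻ s : ℝ, Ω.indicator H (y + s • ν) := by
    intro y hy
    rw [← hcoef (‖φ (γ y)‖ₑ ^ 2)]
    refine mul_le_mul_right ((mul_enorm_sq_le_lintegral hφ hν ρ (γ y)).trans ?_) _
    rw [← lintegral_add_left_eq_self (μ := (volume : Measure ℝ)) _ (h y),
      ← lintegral_indicator measurableSet_Ioc]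
    refine lintegral_mono fun s => ?_
    by_cases hsI : s ∈ Ioc 0 ρ
    · have e : γ y + s • ν = y + (h y + s) • ν := by simp only [hγ]; module
      rw [indicator_of_mem hsI, ← e, indicator_of_mem (hup _ hy s hsI)]
    · rw [indicator_of_notMem hsI]
      exact zero_le
  calc ∫⁻ x in A, ‖φ x‖ₑ ^ 2 ∂(Measure.euclideanHausdorffMeasure (N - 1))
      ≤ ∫⁻ x, ‖φ x‖ₑ ^ 2 ∂(((1 + K) ^ (N - 1)) • Measure.map γ (μV.restrict (γ ⁻¹' A))) :=
        lintegral_mono' hmeas le_rfl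
    _ = ((1 + K : ℝ≥0) ^ (N - 1) : ℝ≥0) * ∫⁻ y in γ ⁻¹' A, ‖φ (γ y)‖ₑ ^ 2 ∂μV := by
        rw [lintegral_smul_measure, lintegral_map (by fun_prop) hγc.measurable]
        rfl
    _ ≤ ((1 + K : ℝ≥0) ^ (N - 1) : ℝ≥0) * ∫⁻ y in γ ⁻¹' A,
          ENNReal.ofReal ρ⁻¹ * (∫⁻ s : ℝ, Ω.indicator H (y + s • ν)) ∂μV := by
        refine mul_le_mul_right ?_ _
        exact setLIntegral_mono' (hγc.measurable hAm) hpt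
    _ ≤ ((1 + K : ℝ≥0) ^ (N - 1) : ℝ≥0) * ∫⁻ y,
          ENNReal.ofReal ρ⁻¹ * (∫⁻ s : ℝ, Ω.indicator H (y + s • ν)) ∂μV := by
        gcongr
        exact Measure.restrict_le_self
    _ = ((1 + K : ℝ≥0) ^ (N - 1) : ℝ≥0) * (ENNReal.ofReal ρ⁻¹ * (c * ∫⁻ x in Ω, H x)) := by
        rw [lintegral_const_mul' _ _ ENNReal.ofReal_ne_top,
          hc _ (hHm.indicator hΩ.isOpen.measurableSet), lintegral_indicator hΩ.isOpen.measurableSet]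
    _ ≤ ((1 + K : ℝ≥0) ^ (N - 1) : ℝ≥0) * (ENNReal.ofReal ρ⁻¹ * (c *
          ((2 + 2 * ENNReal.ofReal ρ ^ 2) *
            ((∫⁻ x in Ω, ‖φ x‖ₑ ^ 2) + ∫⁻ x in Ω, ‖gradient φ x‖ₑ ^ 2)))) := by
        gcongr
        simp only [hH]
        rw [lintegral_add_left (by fun_prop), lintegral_const_mul' _ _ ENNReal.ofNat_ne_top,
          lintegral_const_mul' _ (fun x => ‖gradient φ x‖ₑ ^ 2) (by finiteness), add_mul, mul_add,
          mul_add]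
        refine add_le_add le_self_add le_add_self
    _ = _ := by
        simp only [D]
        push_cast
        simp only [ENNReal.ofReal]
        ring

/-- The trace inequality: the `L²(∂Ω)` norm of a smooth function is bounded by its `H¹(Ω)` norm. -/
theorem exists_eLpNorm_surf_le {Ω : Set (Sp N)} (hΩ : IsBoundedC11Domain Ω) :
    ∃ C : ℝ≥0, ∀ φ : Sp N → ℝ, ContDiff ℝ 1 φ →
      eLpNorm φ 2 (surf Ω) ≤ C * (eLpNorm φ 2 (volume.restrict Ω) +
        eLpNorm (gradient φ) 2 (volume.restrict Ω)) := by
  have hcpt : IsCompact (frontier Ω) :=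
    Metric.isCompact_of_isClosed_isBounded isClosed_frontier
      (hΩ.isBounded.closure.subset frontier_subset_closure)
  obtain ⟨C, hC⟩ : ∃ C : ℝ≥0, ∀ φ : Sp N → ℝ, ContDiff ℝ 1 φ →
      ∫⁻ x in frontier Ω ∩ frontier Ω, ‖φ x‖ₑ ^ 2 ∂(Measure.euclideanHausdorffMeasure (N - 1)) ≤
        C * ((∫⁻ x in Ω, ‖φ x‖ₑ ^ 2) + ∫⁻ x in Ω, ‖gradient φ x‖ₑ ^ 2) := by
    refine hcpt.induction_on (p := fun s => ∃ C : ℝ≥0, ∀ φ : Sp N → ℝ, ContDiff ℝ 1 φ →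
      ∫⁻ x in frontier Ω ∩ s, ‖φ x‖ₑ ^ 2 ∂(Measure.euclideanHausdorffMeasure (N - 1)) ≤
        C * ((∫⁻ x in Ω, ‖φ x‖ₑ ^ 2) + ∫⁻ x in Ω, ‖gradient φ x‖ₑ ^ 2)) ?_ ?_ ?_ ?_
    · exact ⟨0, by simp⟩
    · rintro s t hst ⟨C, hC⟩
      exact ⟨C, fun φ hφ => (lintegral_mono_set (inter_subset_inter_right _ hst)).trans (hC φ hφ)⟩
    · rintro s t ⟨C, hC⟩ ⟨D, hD⟩
      refine ⟨C + D, fun φ hφ => ?_⟩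
      rw [inter_union_distrib_left, ENNReal.coe_add, add_mul]
      exact (lintegral_union_le _ _ _).trans (add_le_add (hC φ hφ) (hD φ hφ))
    · intro x hx
      obtain ⟨r, hr, C, hC⟩ := exists_local_trace_le hΩ hx
      exact ⟨Metric.ball x r, mem_nhdsWithin_of_mem_nhds (Metric.ball_mem_nhds x hr), C, hC⟩
  obtain ⟨C', hC'⟩ := exists_le_coe_sq (K := (C : ℝ≥0∞)) ENNReal.coe_ne_top
  refine ⟨C', fun φ hφ => le_mul_add_of_sq_le ?_⟩
  rw [eLpNorm_two_sq, eLpNorm_two_sq, eLpNorm_two_sq, surf]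
  have := hC φ hφ
  rw [inter_self] at this
  exact this.trans (by gcongr)

end Trace

/-! ### Existence, uniqueness and linearity of traces -/

section TraceOperator

variable {N : ℕ} {Ω : Set (Sp N)}

theorem gradient_add_of_contDiff {φ ψ : Sp N → ℝ} (hφ : ContDiff ℝ 1 φ) (hψ : ContDiff ℝ 1 ψ) :
    gradient (φ + ψ) = gradient φ + gradient ψ := by
  ext1 x
  rw [Pi.add_apply, gradient, gradient, gradient, fderiv_add (hφ.differentiable one_ne_zero x)
    (hψ.differentiable one_ne_zero x), map_add]

theorem gradient_sub_of_contDiff {φ ψ : Sp N → ℝ} (hφ : ContDiff ℝ 1 φ) (hψ : ContDiff ℝ 1 ψ) :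
    gradient (φ - ψ) = gradient φ - gradient ψ := by
  ext1 x
  rw [Pi.sub_apply, gradient, gradient, gradient, fderiv_sub (hφ.differentiable one_ne_zero x)
    (hψ.differentiable one_ne_zero x), map_sub]

theorem gradient_smul_of_contDiff (c : ℝ) {φ : Sp N → ℝ} (hφ : ContDiff ℝ 1 φ) :
    gradient (c • φ) = c • gradient φ := by
  ext1 x
  rw [Pi.smul_apply, gradient, gradient, fderiv_const_smul (hφ.differentiable one_ne_zero x),
    map_smulₛₗ]
  simp

theorem IsTrace.add {v v' w w' : Sp N → ℝ} (hv : WeaklyDiff v) (hv' : WeaklyDiff v')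
    (h : IsTrace Ω v w) (h' : IsTrace Ω v' w') : IsTrace Ω (v + v') (w + w') := by
  obtain ⟨hw, φ, hφ, a, b, c⟩ := h
  obtain ⟨hw', φ', hφ', a', b', c'⟩ := h'
  have h1 : ∀ n, ContDiff ℝ 1 (φ n) := fun n => (hφ n).of_le (by exact_mod_cast le_top)
  have h1' : ∀ n, ContDiff ℝ 1 (φ' n) := fun n => (hφ' n).of_le (by exact_mod_cast le_top)
  have hvm := isWeakGrad_wgrad hv
  have hvm' := isWeakGrad_wgrad hv'
  refine ⟨hw.add hw', fun n => φ n + φ' n, fun n => (hφ n).add (hφ' n), ?_, ?_, ?_⟩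
  · refine tendsto_of_tendsto_of_tendsto_of_le_of_le tendsto_const_nhds
      (by simpa using a.add a') (fun _ => zero_le) fun n => ?_
    dsimp only
    rw [add_sub_add_comm]
    exact eLpNorm_add_le
      ((h1 n).continuous.aestronglyMeasurable.sub hvm.locInt.aestronglyMeasurable.restrict)
      ((h1' n).continuous.aestronglyMeasurable.sub hvm'.locInt.aestronglyMeasurable.restrict)
      one_le_two
  · refine tendsto_of_tendsto_of_tendsto_of_le_of_le tendsto_const_nhds
      (by simpa using b.add b') (fun _ => zero_le) fun n => ?_
    have e : gradient (φ n + φ' n) - wgrad (v + v') =ᵐ[volume.restrict Ω]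
        (gradient (φ n) - wgrad v) + (gradient (φ' n) - wgrad v') := by
      filter_upwards [ae_restrict_of_ae (hvm.add hvm').wgrad_ae_eq] with x hx
      rw [gradient_add_of_contDiff (h1 n) (h1' n), Pi.sub_apply, hx, ← Pi.sub_apply,
        add_sub_add_comm]
    dsimp only
    rw [eLpNorm_congr_ae e]
    exact eLpNorm_add_le ((continuous_gradient (h1 n)).aestronglyMeasurable.sub
      hvm.locInt_grad.aestronglyMeasurable.restrict)
      ((continuous_gradient (h1' n)).aestronglyMeasurable.sub
      hvm'.locInt_grad.aestronglyMeasurable.restrict) one_le_two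
  · refine tendsto_of_tendsto_of_tendsto_of_le_of_le tendsto_const_nhds
      (by simpa using c.add c') (fun _ => zero_le) fun n => ?_
    dsimp only
    rw [add_sub_add_comm]
    exact eLpNorm_add_le ((h1 n).continuous.aestronglyMeasurable.sub hw.1)
      ((h1' n).continuous.aestronglyMeasurable.sub hw'.1) one_le_two

theorem IsTrace.smul (k : ℝ) {v w : Sp N → ℝ} (hv : WeaklyDiff v) (h : IsTrace Ω v w) :
    IsTrace Ω (k • v) (k • w) := by
  obtain ⟨hw, φ, hφ, a, b, c⟩ := h
  have h1 : ∀ n, ContDiff ℝ 1 (φ n) := fun n => (hφ n).of_le (by exact_mod_cast le_top)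
  have hvm := isWeakGrad_wgrad hv
  have key : ∀ {s : ℕ → ℝ≥0∞}, Tendsto s atTop (𝓝 0) →
      Tendsto (fun n => ‖k‖ₑ * s n) atTop (𝓝 0) := fun {s} hs => by
    simpa using ENNReal.Tendsto.const_mul hs (Or.inr (by simp : ‖k‖ₑ ≠ ⊤))
  refine ⟨hw.const_smul k, fun n => k • φ n, fun n => (hφ n).const_smul k, ?_, ?_, ?_⟩
  · refine (key a).congr fun n => ?_
    rw [← smul_sub, eLpNorm_const_smul]
  · refine (key b).congr fun n => ?_
    rw [← eLpNorm_const_smul]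
    refine eLpNorm_congr_ae ?_
    filter_upwards [ae_restrict_of_ae (hvm.smul k).wgrad_ae_eq] with x hx
    rw [Pi.sub_apply, hx, gradient_smul_of_contDiff k (h1 n), ← Pi.sub_apply, smul_sub]
  · refine (key c).congr fun n => ?_
    rw [← smul_sub, eLpNorm_const_smul]

/-- The trace inequality for weakly differentiable functions. -/
theorem exists_eLpNorm_trace_le (hΩ : IsBoundedC11Domain Ω) :
    ∃ C : ℝ≥0, ∀ v w : Sp N → ℝ, WeaklyDiff v → IsTrace Ω v w →
      eLpNorm w 2 (surf Ω) ≤ C * (eLpNorm v 2 (volume.restrict Ω) +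
        eLpNorm (wgrad v) 2 (volume.restrict Ω)) := by
  obtain ⟨C, hC⟩ := exists_eLpNorm_surf_le hΩ
  refine ⟨C, fun v w hv ⟨hw, φ, hφ, a, b, c⟩ => ?_⟩
  have h1 : ∀ n, ContDiff ℝ 1 (φ n) := fun n => (hφ n).of_le (by exact_mod_cast le_top)
  have hvm := isWeakGrad_wgrad hv
  set x := eLpNorm v 2 (volume.restrict Ω)
  set y := eLpNorm (wgrad v) 2 (volume.restrict Ω)
  have hlim : Tendsto (fun n => eLpNorm (φ n - w) 2 (surf Ω) +
      C * ((eLpNorm (φ n - v) 2 (volume.restrict Ω) + x) +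
        (eLpNorm (gradient (φ n) - wgrad v) 2 (volume.restrict Ω) + y))) atTop
      (𝓝 (0 + C * ((0 + x) + (0 + y)))) :=
    c.add (ENNReal.Tendsto.const_mul ((a.add_const x).add (b.add_const y))
      (Or.inr ENNReal.coe_ne_top))
  rw [zero_add, zero_add, zero_add] at hlim
  refine ge_of_tendsto hlim (Eventually.of_forall fun n => ?_)
  have e1 : eLpNorm w 2 (surf Ω) ≤ eLpNorm (φ n - w) 2 (surf Ω) + eLpNorm (φ n) 2 (surf Ω) := by
    have hm := (h1 n).continuous.aestronglyMeasurable (μ := surf Ω)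
    have := eLpNorm_add_le (hw.1.sub hm) hm one_le_two
    rwa [sub_add_cancel, eLpNorm_sub_comm] at this
  refine e1.trans (add_le_add le_rfl ((hC _ (h1 n)).trans ?_))
  gcongr
  · have := eLpNorm_add_le (μ := volume.restrict Ω) (p := 2)
      ((h1 n).continuous.aestronglyMeasurable.sub
      hvm.locInt.aestronglyMeasurable.restrict) hvm.locInt.aestronglyMeasurable.restrict one_le_two
    rwa [sub_add_cancel] at this
  · have := eLpNorm_add_le (μ := volume.restrict Ω) (p := 2)
      ((continuous_gradient (h1 n)).aestronglyMeasurable.sub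
      hvm.locInt_grad.aestronglyMeasurable.restrict) hvm.locInt_grad.aestronglyMeasurable.restrict
      one_le_two
    rwa [sub_add_cancel] at this

/-- Traces are unique: the difference of two traces of `v` is a trace of `0`. -/
theorem IsTrace.ae_eq (hΩ : IsBoundedC11Domain Ω) {v w w' : Sp N → ℝ} (hv : WeaklyDiff v)
    (h : IsTrace Ω v w) (h' : IsTrace Ω v w') : w =ᵐ[surf Ω] w' := by
  obtain ⟨C, hC⟩ := exists_eLpNorm_trace_le hΩ
  have hd := h.add hv ⟨_, (isWeakGrad_wgrad hv).smul (-1)⟩ (h'.smul (-1) hv)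
  have hw0 := (isWeakGrad_wgrad hv).add ((isWeakGrad_wgrad hv).smul (-1))
  have hb := hC _ _ ⟨_, hw0⟩ hd
  rw [eLpNorm_congr_ae (ae_restrict_of_ae hw0.wgrad_ae_eq)] at hb
  have e : w + (-1 : ℝ) • w' = w - w' := by simp [sub_eq_add_neg]
  have e' : v + (-1 : ℝ) • v = 0 := by simp
  have e'' : wgrad v + (-1 : ℝ) • wgrad v = 0 := by simp
  rw [e, e', e'', eLpNorm_zero, eLpNorm_zero, add_zero, mul_zero, nonpos_iff_eq_zero,
    eLpNorm_eq_zero_iff (h.1.sub h'.1).1 two_ne_zero] at hb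
  filter_upwards [hb] with x hx
  simpa [sub_eq_zero] using hx

theorem memLp_surf_of_contDiff (hΩ : IsBoundedC11Domain Ω) {φ : Sp N → ℝ} (hφ : ContDiff ℝ 1 φ)
    (h1 : eLpNorm φ 2 (volume.restrict Ω) < ⊤)
    (h2 : eLpNorm (gradient φ) 2 (volume.restrict Ω) < ⊤) : MemLp φ 2 (surf Ω) := by
  obtain ⟨C, hC⟩ := exists_eLpNorm_surf_le hΩ
  exact ⟨hφ.continuous.aestronglyMeasurable, (hC φ hφ).trans_lt
    (ENNReal.mul_lt_top ENNReal.coe_lt_top (ENNReal.add_lt_top.2 ⟨h1, h2⟩))⟩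

theorem eLpNorm_lt_top_of_continuous {F : Type*} [NormedAddCommGroup F]
    (hb : Bornology.IsBounded Ω) {f : Sp N → F} (hf : Continuous f) :
    eLpNorm f 2 (volume.restrict Ω) < ⊤ := by
  obtain ⟨M, hM⟩ := hb.isCompact_closure.exists_bound_of_continuousOn hf.continuousOn
  have hfin : IsFiniteMeasure (volume.restrict (closure Ω)) :=
    ⟨by simpa using hb.isCompact_closure.measure_lt_top⟩
  refine (eLpNorm_mono_measure f (Measure.restrict_mono subset_closure le_rfl)).trans_lt ?_
  exact (MemLp.of_bound hf.aestronglyMeasurable M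
    ((ae_restrict_iff' isClosed_closure.measurableSet).2 (Eventually.of_forall hM))).2

theorem isTrace_aff (hΩ : IsBoundedC11Domain Ω) (a : ℝ) (b : Sp N) :
    IsTrace Ω (aff a b) (aff a b) := by
  refine ⟨memLp_surf_of_contDiff hΩ (contDiff_aff a b)
    (eLpNorm_lt_top_of_continuous hΩ.isBounded (contDiff_aff a b (n := 1)).continuous)
    (eLpNorm_lt_top_of_continuous hΩ.isBounded (continuous_gradient (contDiff_aff a b))),
    fun _ => aff a b, fun _ => contDiff_aff a b, by simp, ?_, by simp⟩
  have e : gradient (aff a b) - wgrad (aff a b) =ᵐ[volume.restrict Ω] 0 := by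
    filter_upwards [ae_restrict_of_ae (isWeakGrad_aff a b).wgrad_ae_eq] with x hx
    simp [hx, gradient_aff]
  simp [eLpNorm_congr_ae e]

/-- A function which is `H¹` on every ball has a trace, namely the limit in `L²(∂Ω)` of its
mollifications, which is a Cauchy sequence by the trace inequality. -/
theorem exists_isTrace (hΩ : IsBoundedC11Domain Ω) {v : Sp N → ℝ} (hv : WeaklyDiff v)
    (h1 : ∀ R : ℝ, MemLp v 2 (volume.restrict (Metric.ball 0 R)))
    (h2 : ∀ R : ℝ, MemLp (wgrad v) 2 (volume.restrict (Metric.ball 0 R))) :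
    ∃ w, IsTrace Ω v w := by
  obtain ⟨C, hC⟩ := exists_eLpNorm_surf_le hΩ
  obtain ⟨R, hR⟩ := hΩ.isBounded.subset_ball 0
  have hw := isWeakGrad_wgrad hv
  have hsm : ∀ n, ContDiff ℝ 1 (moll n v) := fun n =>
    (contDiff_moll n hw.locInt).of_le (by exact_mod_cast le_top)
  have hgr : ∀ n, gradient (moll n v) = moll n (wgrad v) := fun n =>
    funext fun x => (hasGradientAt_moll n hw x).gradient
  have hle : ∀ {F : Type} [NormedAddCommGroup F] (f : Sp N → F),
      eLpNorm f 2 (volume.restrict Ω) ≤ eLpNorm f 2 (volume.restrict (Metric.ball 0 R)) :=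
    fun f => eLpNorm_mono_measure f (Measure.restrict_mono hR le_rfl)
  have a : Tendsto (fun n => eLpNorm (moll n v - v) 2 (volume.restrict Ω)) atTop (𝓝 0) :=
    tendsto_of_tendsto_of_tendsto_of_le_of_le tendsto_const_nhds (tendsto_eLpNorm_moll_sub h1 R)
      (fun _ => zero_le) fun n => hle _
  have b : Tendsto (fun n => eLpNorm (gradient (moll n v) - wgrad v) 2 (volume.restrict Ω)) atTop
      (𝓝 0) := by
    simp only [hgr]
    exact tendsto_of_tendsto_of_tendsto_of_le_of_le tendsto_const_nhds
      (tendsto_eLpNorm_moll_sub h2 R) (fun _ => zero_le) fun n => hle _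
  have hmem : ∀ n, MemLp (moll n v) 2 (surf Ω) := fun n => memLp_surf_of_contDiff hΩ (hsm n)
    (eLpNorm_lt_top_of_continuous hΩ.isBounded (hsm n).continuous)
    (eLpNorm_lt_top_of_continuous hΩ.isBounded (continuous_gradient (hsm n)))
  have hdist : ∀ n k, edist ((hmem n).toLp _) ((hmem k).toLp _) ≤
      C * ((eLpNorm (moll n v - v) 2 (volume.restrict Ω) +
          eLpNorm (gradient (moll n v) - wgrad v) 2 (volume.restrict Ω)) +
        (eLpNorm (moll k v - v) 2 (volume.restrict Ω) +
          eLpNorm (gradient (moll k v) - wgrad v) 2 (volume.restrict Ω))) := by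
    intro n k
    rw [Lp.edist_toLp_toLp]
    refine (hC (moll n v - moll k v) ((hsm n).sub (hsm k))).trans ?_
    rw [gradient_sub_of_contDiff (hsm n) (hsm k), add_add_add_comm]
    refine mul_le_mul_right (add_le_add ?_ ?_) _
    · have hm : ∀ n, AEStronglyMeasurable (moll n v - v) (volume.restrict Ω) := fun n =>
        (hsm n).continuous.aestronglyMeasurable.sub hw.locInt.aestronglyMeasurable.restrict
      have := eLpNorm_sub_le (p := 2) (hm n) (hm k) one_le_two
      rwa [sub_sub_sub_cancel_right] at this
    · have hm : ∀ n, AEStronglyMeasurable (gradient (moll n v) - wgrad v) (volume.restrict Ω) :=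
        fun n => (continuous_gradient (hsm n)).aestronglyMeasurable.sub
          hw.locInt_grad.aestronglyMeasurable.restrict
      have := eLpNorm_sub_le (p := 2) (hm n) (hm k) one_le_two
      rwa [sub_sub_sub_cancel_right] at this
  set s : ℕ → ℝ≥0∞ := fun n => eLpNorm (moll n v - v) 2 (volume.restrict Ω) +
    eLpNorm (gradient (moll n v) - wgrad v) 2 (volume.restrict Ω)
  have hs : Tendsto s atTop (𝓝 0) := by simpa using a.add b
  have hcau : CauchySeq fun n => (hmem n).toLp (moll n v) := by
    rw [EMetric.cauchySeq_iff]
    intro ε hε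
    have h0 : Tendsto (fun p : ℕ × ℕ => (C : ℝ≥0∞) * (s p.1 + s p.2)) (atTop ×ˢ atTop) (𝓝 0) := by
      have := ENNReal.Tendsto.const_mul ((hs.comp tendsto_fst).add (hs.comp tendsto_snd))
        (Or.inr (ENNReal.coe_ne_top (r := C))) (f := atTop ×ˢ atTop)
      simpa using this
    rw [prod_atTop_atTop_eq] at h0
    obtain ⟨⟨N₁, N₂⟩, hN⟩ := (h0.eventually (gt_mem_nhds hε)).exists_forall_of_atTop
    exact ⟨max N₁ N₂, fun m hm n hn => (hdist m n).trans_lt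
      (hN (m, n) ⟨(le_max_left _ _).trans hm, (le_max_right _ _).trans hn⟩)⟩
  obtain ⟨w, hwl⟩ := cauchySeq_tendsto_of_complete hcau
  refine ⟨w, Lp.memLp w, fun n => moll n v, fun n => contDiff_moll n hw.locInt, a, b, ?_⟩
  rw [Lp.tendsto_Lp_iff_tendsto_eLpNorm'] at hwl
  refine hwl.congr fun n => eLpNorm_congr_ae ?_
  filter_upwards [(hmem n).coeFn_toLp] with x hx
  simp [hx]

end TraceOperator

/-! ### The normalisation constant -/

section Constant

/-- The integrand of `c_{N,σ}⁻¹` is dominated by `min (‖ξ‖² / 2, 2) / ‖ξ‖^{N+2σ}`, which is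
integrable near the origin as `σ < 1` and at infinity as `σ > 0`. -/
theorem integrable_cNs_integrand (N : ℕ) [NeZero N] {σ : ℝ} (hσ : σ ∈ Ioo (0 : ℝ) 1) :
    Integrable fun ξ : Sp N => (1 - Real.cos (ξ 0)) / ‖ξ‖ ^ ((N : ℝ) + 2 * σ) := by
  have hp : 0 < (N : ℝ) + 2 * σ := by have := hσ.1; positivity
  -- the radial majorant, from `1 - cos t ≤ min (t² / 2, 2)`
  set f : ℝ → ℝ := fun r => (if r ≤ 1 then r ^ 2 / 2 else 2) / r ^ ((N : ℝ) + 2 * σ) with hf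
  have hpow : ∀ y : ℝ, 0 < y → y ^ (N - 1) = y ^ ((N : ℝ) - 1) := fun y hy => by
    rw [← Real.rpow_natCast, Nat.cast_sub NeZero.one_le, Nat.cast_one]
  have hi : Integrable (fun ξ : Sp N => f ‖ξ‖) := by
    rw [integrable_fun_norm_addHaar, finrank_euclideanSpace_fin, ← Ioc_union_Ioi_eq_Ioi zero_le_one]
    refine IntegrableOn.union ?_ ?_
    · have h1 : IntegrableOn (fun y : ℝ => y ^ (1 - 2 * σ) / 2) (Ioc 0 1) := by
        rw [← intervalIntegrable_iff_integrableOn_Ioc_of_le zero_le_one]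
        exact (intervalIntegral.intervalIntegrable_rpow' (by linarith [hσ.2])).div_const 2
      refine h1.congr_fun (fun y hy => ?_) measurableSet_Ioc
      simp only [hf, smul_eq_mul]
      rw [if_pos hy.2, hpow y hy.1, ← Real.rpow_natCast y 2, div_right_comm,
        ← Real.rpow_sub hy.1, ← mul_div_assoc, ← Real.rpow_add hy.1]
      congr 2
      push_cast
      ring
    · have h1 : IntegrableOn (fun y : ℝ => 2 * y ^ (-1 - 2 * σ)) (Ioi 1) :=
        (integrableOn_Ioi_rpow_of_lt (by linarith [hσ.1]) one_pos).const_mul 2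
      refine h1.congr_fun (fun y hy => ?_) measurableSet_Ioi
      have hy0 : 0 < y := one_pos.trans hy
      simp only [hf, smul_eq_mul]
      rw [if_neg (not_le.2 (mem_Ioi.1 hy)), hpow y hy0, mul_div_assoc', mul_comm _ (2 : ℝ),
        mul_div_assoc, ← Real.rpow_sub hy0]
      congr 2
      ring
  refine hi.mono' ?_ (Eventually.of_forall fun ξ => ?_)
  · refine Measurable.aestronglyMeasurable ?_
    have : Continuous fun ξ : Sp N => 1 - Real.cos (ξ 0) := by fun_prop
    have h2 : Measurable fun ξ : Sp N => ‖ξ‖ ^ ((N : ℝ) + 2 * σ) := by fun_prop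
    exact this.measurable.div h2
  · have h0 : 0 ≤ 1 - Real.cos (ξ 0) := by linarith [Real.cos_le_one (ξ 0)]
    rw [Real.norm_of_nonneg (by positivity)]
    refine div_le_div_of_nonneg_right ?_ (by positivity)
    split_ifs with h
    · have h1 : |ξ 0| ≤ ‖ξ‖ := by simpa using PiLp.norm_apply_le ξ 0
      have h2 := Real.one_sub_sq_div_two_le_cos (x := ξ 0)
      nlinarith [sq_abs (ξ 0), abs_nonneg (ξ 0)]
    · linarith [Real.neg_one_le_cos (ξ 0)]

/-- The integral inverted in `c_{N,σ}` is finite and positive, so that `c_{N,σ}` is not a junk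
value. -/
theorem cNs_pos (N : ℕ) [NeZero N] {σ : ℝ} (hσ : σ ∈ Ioo (0 : ℝ) 1) : 0 < cNs N σ := by
  have h0 : ∀ ξ : Sp N, 0 ≤ 1 - Real.cos (ξ 0) := fun ξ => by linarith [Real.cos_le_one (ξ 0)]
  refine inv_pos.2 ((integral_pos_iff_support_of_nonneg (fun ξ => ?_)
    (integrable_cNs_integrand N hσ)).2 ?_)
  · exact div_nonneg (h0 ξ) (by positivity)
  · have ho : IsOpen {ξ : Sp N | 0 < ξ 0 ∧ ξ 0 < 1} := by
      have hc : Continuous fun ξ : Sp N => ξ 0 := by fun_prop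
      exact (isOpen_lt continuous_const hc).inter (isOpen_lt hc continuous_const)
    have hne : {ξ : Sp N | 0 < ξ 0 ∧ ξ 0 < 1}.Nonempty :=
      ⟨EuclideanSpace.single 0 (1 / 2), by norm_num, by norm_num⟩
    refine (ho.measure_pos volume hne).trans_le (measure_mono fun ξ hξ => ?_)
    have h1 : Real.cos (ξ 0) < Real.cos 0 := Real.cos_lt_cos_of_nonneg_of_le_pi le_rfl
      (by linarith [Real.pi_gt_three, hξ.2]) hξ.1
    rw [Real.cos_zero] at h1
    have h2 : ξ ≠ 0 := fun h => by simp [h] at hξ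
    have h3 : 0 < ‖ξ‖ := norm_pos_iff.2 h2
    have h4 : 0 < 1 - Real.cos (ξ 0) := by linarith
    exact (by positivity : 0 < (1 - Real.cos (ξ 0)) / ‖ξ‖ ^ ((N : ℝ) + 2 * σ)).ne'

end Constant

/-! ### The measure `μ_{g₁}` and the space `H^s_N` -/

section Space

variable {N : ℕ} {Ω : Set (Sp N)} {g₁ : Sp N → ℝ} {σ : ℝ}

theorem mu_eq (hΩ : IsOpen Ω) : mu Ω g₁ = volume.restrict Ω +
    (volume.restrict Ωᶜ).withDensity fun x => ENNReal.ofReal |g₁ x| := by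
  rw [mu, withDensity_add_left (measurable_const.indicator hΩ.measurableSet),
    withDensity_indicator hΩ.measurableSet, withDensity_indicator hΩ.measurableSet.compl]
  congr 1
  exact withDensity_one

theorem mu_absolutelyContinuous : mu Ω g₁ ≪ volume := withDensity_absolutelyContinuous _ _

theorem restrict_le_mu (hΩ : IsOpen Ω) : volume.restrict Ω ≤ mu Ω g₁ := by
  rw [mu_eq hΩ]
  exact Measure.le_add_right le_rfl

theorem lintegral_mu (hΩ : IsOpen Ω) (hg : AEStronglyMeasurable g₁ (volume.restrict Ωᶜ))
    {F : Sp N → ℝ≥0∞} (hF : AEMeasurable F volume) :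
    ∫⁻ x, F x ∂(mu Ω g₁) = (∫⁻ x in Ω, F x) + ∫⁻ x in Ωᶜ, ‖g₁ x‖ₑ * F x := by
  rw [mu_eq hΩ, lintegral_add_measure, lintegral_withDensity_eq_lintegral_mul₀
    hg.aemeasurable.abs.ennreal_ofReal hF.restrict]
  congr 1
  refine lintegral_congr fun x => ?_
  rw [Pi.mul_apply, ← ofReal_norm, Real.norm_eq_abs]

theorem enorm_sq_eq_ofReal_sq (a : ℝ) : ‖a‖ₑ ^ 2 = ENNReal.ofReal (a ^ 2) := by
  rw [← ofReal_norm, ← ENNReal.ofReal_pow (norm_nonneg _), Real.norm_eq_abs, sq_abs]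

theorem eLpNorm_mu_sq (hΩ : IsOpen Ω) (hg : AEStronglyMeasurable g₁ (volume.restrict Ωᶜ))
    {u : Sp N → ℝ} (hu : AEStronglyMeasurable u volume) :
    eLpNorm u 2 (mu Ω g₁) ^ 2 = (∫⁻ x in Ω, ENNReal.ofReal (u x ^ 2)) +
      ∫⁻ x in Ωᶜ, ENNReal.ofReal (|g₁ x| * u x ^ 2) := by
  rw [eLpNorm_two_sq, lintegral_mu hΩ hg (hu.enorm.pow_const 2)]
  congr 1
  · exact lintegral_congr fun x => enorm_sq_eq_ofReal_sq _
  · refine lintegral_congr fun x => ?_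
    rw [enorm_sq_eq_ofReal_sq, ← ofReal_norm, ← ENNReal.ofReal_mul (norm_nonneg _),
      Real.norm_eq_abs]

/-- `H^s_N` consists of the functions of finite energy in `L²(μ_{g₁})`. -/
theorem mem_HN_iff (hΩ : IsOpen Ω) (hg : AEStronglyMeasurable g₁ (volume.restrict Ωᶜ))
    {u : Sp N → ℝ} : u ∈ HN σ Ω g₁ ↔ u ∈ Hdot σ Ω ∧ MemLp u 2 (mu Ω g₁) := by
  constructor
  · rintro ⟨hu, hn⟩
    have hm := (isWeakGrad_wgrad hu).locInt.aestronglyMeasurable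
    rw [normSq, add_right_comm, ← eLpNorm_mu_sq hΩ hg hm, ENNReal.add_lt_top] at hn
    exact ⟨⟨hu, hn.2⟩, hm.mono_ac mu_absolutelyContinuous,
      (ENNReal.pow_lt_top_iff.1 hn.1).resolve_right two_ne_zero⟩
  · rintro ⟨⟨hu, he⟩, h⟩
    have hm := (isWeakGrad_wgrad hu).locInt.aestronglyMeasurable
    refine ⟨hu, ?_⟩
    rw [normSq, add_right_comm, ← eLpNorm_mu_sq hΩ hg hm, ENNReal.add_lt_top]
    exact ⟨ENNReal.pow_lt_top h.2, he⟩

theorem Hdot_congr {u v : Sp N → ℝ} (hu : u ∈ Hdot σ Ω) (h : u =ᵐ[volume] v) : v ∈ Hdot σ Ω := by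
  have hw : IsWeakGrad v (wgrad u) := (isWeakGrad_wgrad hu.1).congr h EventuallyEq.rfl
  refine ⟨⟨_, hw⟩, ?_⟩
  rw [energy_eq, eLpNorm_congr_ae (hw.gradDiff_ae_eq σ Ω)]
  have := hu.2
  rwa [energy_eq] at this

theorem HN_congr {u v : Sp N → ℝ} (hΩ : IsOpen Ω)
    (hg : AEStronglyMeasurable g₁ (volume.restrict Ωᶜ)) (hu : u ∈ HN σ Ω g₁)
    (h : u =ᵐ[volume] v) : v ∈ HN σ Ω g₁ := by
  rw [mem_HN_iff hΩ hg] at hu ⊢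
  exact ⟨Hdot_congr hu.1 h, hu.2.ae_eq (mu_absolutelyContinuous.ae_le h)⟩

theorem add_mem_Hdot {u v : Sp N → ℝ} (hu : u ∈ Hdot σ Ω) (hv : v ∈ Hdot σ Ω) :
    u + v ∈ Hdot σ Ω := by
  refine ⟨⟨_, (isWeakGrad_wgrad hu.1).add (isWeakGrad_wgrad hv.1)⟩, ?_⟩
  rw [energy_eq, eLpNorm_congr_ae (gradDiff_add_ae_eq σ Ω hu.1 hv.1)]
  exact ENNReal.pow_lt_top ((memLp_gradDiff hu.1 hu.2).add (memLp_gradDiff hv.1 hv.2)).2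

theorem smul_mem_Hdot (c : ℝ) {u : Sp N → ℝ} (hu : u ∈ Hdot σ Ω) : c • u ∈ Hdot σ Ω := by
  refine ⟨⟨_, (isWeakGrad_wgrad hu.1).smul c⟩, ?_⟩
  rw [energy_eq, eLpNorm_congr_ae (gradDiff_smul_ae_eq σ Ω c hu.1)]
  exact ENNReal.pow_lt_top ((memLp_gradDiff hu.1 hu.2).const_smul c).2

theorem aff_mem_Hdot (a : ℝ) (b : Sp N) : aff a b ∈ Hdot σ Ω := by
  refine ⟨⟨_, isWeakGrad_aff a b⟩, ?_⟩
  rw [energy_eq, eLpNorm_congr_ae (gradDiff_aff_ae_eq σ Ω a b)]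
  simp

theorem aff_zero : aff (0 : ℝ) (0 : Sp N) = 0 := by
  ext x
  simp [aff]

/-- `Ḣ^s(Ω)` as a linear space. -/
noncomputable def hdotSub (σ : ℝ) (Ω : Set (Sp N)) : Submodule ℝ (Sp N → ℝ) where
  carrier := Hdot σ Ω
  add_mem' := add_mem_Hdot
  zero_mem' := aff_zero (N := N) ▸ aff_mem_Hdot 0 0
  smul_mem' c _ := smul_mem_Hdot c

theorem add_mem_HN (hΩ : IsOpen Ω) (hg : AEStronglyMeasurable g₁ (volume.restrict Ωᶜ))
    {u v : Sp N → ℝ} (hu : u ∈ HN σ Ω g₁) (hv : v ∈ HN σ Ω g₁) : u + v ∈ HN σ Ω g₁ := by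
  rw [mem_HN_iff hΩ hg] at *
  exact ⟨add_mem_Hdot hu.1 hv.1, hu.2.add hv.2⟩

theorem smul_mem_HN (hΩ : IsOpen Ω) (hg : AEStronglyMeasurable g₁ (volume.restrict Ωᶜ))
    (c : ℝ) {u : Sp N → ℝ} (hu : u ∈ HN σ Ω g₁) : c • u ∈ HN σ Ω g₁ := by
  rw [mem_HN_iff hΩ hg] at *
  exact ⟨smul_mem_Hdot c hu.1, hu.2.const_smul c⟩

theorem sub_mem_HN (hΩ : IsOpen Ω) (hg : AEStronglyMeasurable g₁ (volume.restrict Ωᶜ))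
    {u v : Sp N → ℝ} (hu : u ∈ HN σ Ω g₁) (hv : v ∈ HN σ Ω g₁) : u - v ∈ HN σ Ω g₁ := by
  simpa [sub_eq_add_neg] using add_mem_HN hΩ hg hu (smul_mem_HN hΩ hg (-1) hv)

/-- Affine functions are square integrable for `μ_{g₁}`, as `g₁` and `|x|² g₁` are integrable. -/
theorem memLp_aff_mu (hΩ : IsOpen Ω) (hb : Bornology.IsBounded Ω) (hg : IntegrableOn g₁ Ωᶜ)
    (hg' : IntegrableOn (fun x => ‖x‖ ^ 2 * g₁ x) Ωᶜ) (a : ℝ) (b : Sp N) :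
    MemLp (aff a b) 2 (mu Ω g₁) := by
  have hc : Continuous (aff a b) := (contDiff_aff a b (n := 1)).continuous
  refine ⟨hc.aestronglyMeasurable, ?_⟩
  suffices h : eLpNorm (aff a b) 2 (mu Ω g₁) ^ 2 < ⊤ from
    (ENNReal.pow_lt_top_iff.1 h).resolve_right two_ne_zero
  rw [eLpNorm_two_sq, lintegral_mu hΩ hg.1 (by fun_prop), ← eLpNorm_two_sq]
  refine ENNReal.add_lt_top.2 ⟨ENNReal.pow_lt_top (eLpNorm_lt_top_of_continuous hb hc), ?_⟩
  have hi : IntegrableOn (fun x => 2 * a ^ 2 * |g₁ x| + 2 * ‖b‖ ^ 2 * |‖x‖ ^ 2 * g₁ x|) Ωᶜ :=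
    (hg.abs.const_mul _).add (hg'.abs.const_mul _)
  refine lt_of_le_of_lt (lintegral_mono fun x => ?_) hi.2
  rw [← ofReal_norm, enorm_sq_eq_ofReal_sq, ← ENNReal.ofReal_mul (norm_nonneg _),
    Real.enorm_of_nonneg (by positivity)]
  refine ENNReal.ofReal_le_ofReal ?_
  dsimp only
  rw [abs_mul, abs_of_nonneg (sq_nonneg ‖x‖), Real.norm_eq_abs]
  have h1 : aff a b x ^ 2 ≤ 2 * a ^ 2 + 2 * (‖b‖ ^ 2 * ‖x‖ ^ 2) := by
    have h2 := sq_le_sq' (neg_le_of_abs_le (abs_real_inner_le_norm b x))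
      (le_of_abs_le (abs_real_inner_le_norm b x))
    rw [mul_pow] at h2
    simp only [aff]
    nlinarith [sq_nonneg (a - inner ℝ b x)]
  calc |g₁ x| * aff a b x ^ 2 ≤ |g₁ x| * (2 * a ^ 2 + 2 * (‖b‖ ^ 2 * ‖x‖ ^ 2)) := by gcongr
    _ = _ := by ring

/-- The gradient difference as a linear map from `Ḣ^s(Ω)` to an `L²` space; the energy is the
square of the norm of its values. -/
noncomputable def gradMap (σ : ℝ) (Ω : Set (Sp N)) :
    hdotSub σ Ω →ₗ[ℝ] Lp (Sp N) 2 (kernelMeasure σ Ω) where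
  toFun u := (memLp_gradDiff u.2.1 u.2.2).toLp _
  map_add' u v := by
    rw [← MemLp.toLp_add]
    exact (MemLp.toLp_eq_toLp_iff _ _).2 (gradDiff_add_ae_eq σ Ω u.2.1 v.2.1)
  map_smul' c u := by
    rw [RingHom.id_apply, ← MemLp.toLp_const_smul]
    exact (MemLp.toLp_eq_toLp_iff _ _).2 (gradDiff_smul_ae_eq σ Ω c u.2.1)

theorem coeFn_gradMap (u : hdotSub σ Ω) :
    gradMap σ Ω u =ᵐ[kernelMeasure σ Ω] gradDiff (u : Sp N → ℝ) :=
  (memLp_gradDiff u.2.1 u.2.2).coeFn_toLp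

theorem enorm_gradMap (u : hdotSub σ Ω) :
    ‖gradMap σ Ω u‖ₑ = eLpNorm (gradDiff (u : Sp N → ℝ)) 2 (kernelMeasure σ Ω) :=
  Lp.enorm_toLp (memLp_gradDiff u.2.1 u.2.2)

theorem edist_gradMap (u v : hdotSub σ Ω) : edist (gradMap σ Ω u) (gradMap σ Ω v) =
    eLpNorm (gradDiff (u : Sp N → ℝ) - gradDiff (v : Sp N → ℝ)) 2 (kernelMeasure σ Ω) :=
  Lp.edist_toLp_toLp _ _ (memLp_gradDiff u.2.1 u.2.2) (memLp_gradDiff v.2.1 v.2.2)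

theorem form_eq_inner (u v : hdotSub σ Ω) :
    form σ Ω u v = inner ℝ (gradMap σ Ω u) (gradMap σ Ω v) := by
  rw [form_eq, L2.inner_def]
  refine integral_congr_ae ?_
  filter_upwards [coeFn_gradMap u, coeFn_gradMap v] with z hu hv
  rw [hu, hv]

theorem gradMap_aff (a : ℝ) (b : Sp N) : gradMap σ Ω ⟨aff a b, aff_mem_Hdot a b⟩ = 0 := by
  rw [← enorm_eq_zero, enorm_gradMap, eLpNorm_congr_ae (gradDiff_aff_ae_eq σ Ω a b)]
  simp

theorem form_congr_of_ae {u u' v : Sp N → ℝ} (hu : WeaklyDiff u) (h : u =ᵐ[volume] u') :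
    form σ Ω u' v = form σ Ω u v := by
  have hw : IsWeakGrad u' (wgrad u) := (isWeakGrad_wgrad hu).congr h EventuallyEq.rfl
  rw [form_eq, form_eq]
  refine integral_congr_ae ?_
  filter_upwards [hw.gradDiff_ae_eq σ Ω] with z hz
  rw [hz]
  rfl

end Space

/-! ### The spectral condition -/

section Spectral

variable {N : ℕ} {Ω : Set (Sp N)} {g₁ : Sp N → ℝ} {σ : ℝ}

/-- Positivity of `λ₁(g₁)` is a Poincaré inequality for functions orthogonal to the affine ones. -/
theorem exists_eLpNorm_mu_le_of_lambda1_pos (h : 0 < lambda1 σ Ω g₁) :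
    ∃ C : ℝ≥0, ∀ u ∈ Hzero σ Ω g₁,
      eLpNorm u 2 (mu Ω g₁) ≤ C * eLpNorm (gradDiff u) 2 (kernelMeasure σ Ω) := by
  -- `λ₁` may be infinite
  set c := min (lambda1 σ Ω g₁) 1
  have hc0 : c ≠ 0 := (lt_min h one_pos).ne'
  have hc1 : c ≠ ⊤ := ((min_le_right _ _).trans_lt ENNReal.one_lt_top).ne
  obtain ⟨C, hC⟩ := exists_le_coe_sq (K := c⁻¹) (ENNReal.inv_ne_top.2 hc0)
  refine ⟨C, fun u hu => ?_⟩
  by_cases h0 : u =ᵐ[volume] 0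
  · rw [eLpNorm_congr_ae (mu_absolutelyContinuous.ae_le h0)]
    simp
  refine (ENNReal.pow_le_pow_left_iff two_ne_zero).1 ?_
  rw [mul_pow, ← energy_eq, eLpNorm_two_sq]
  have h1 : c ≤ energy σ Ω u / ∫⁻ x, ENNReal.ofReal (u x ^ 2) ∂(mu Ω g₁) :=
    (min_le_left _ _).trans (iInf₂_le u ⟨hu, h0⟩)
  have h2 := ENNReal.mul_le_of_le_div' h1
  simp only [enorm_sq_eq_ofReal_sq]
  set M := ∫⁻ x, ENNReal.ofReal (u x ^ 2) ∂(mu Ω g₁)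
  calc M = c⁻¹ * (M * c) := by
        rw [mul_comm M, ← mul_assoc, ENNReal.inv_mul_cancel hc0 hc1, one_mul]
    _ ≤ _ := by gcongr

theorem memLp_of_mem_Hzero (h : 0 < lambda1 σ Ω g₁) {u : Sp N → ℝ} (hu : u ∈ Hzero σ Ω g₁) :
    MemLp u 2 (mu Ω g₁) := by
  obtain ⟨C, hC⟩ := exists_eLpNorm_mu_le_of_lambda1_pos h
  exact ⟨(isWeakGrad_wgrad hu.1.1).locInt.aestronglyMeasurable.mono_ac mu_absolutelyContinuous,
    (hC u hu).trans_lt (ENNReal.mul_lt_top ENNReal.coe_lt_top (memLp_gradDiff hu.1.1 hu.1.2).2)⟩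

/-- `H^{s,0}_{g₁}(Ω)` as a subspace of `Ḣ^s(Ω)`. -/
noncomputable def hzeroSub (σ : ℝ) (Ω : Set (Sp N)) (g₁ : Sp N → ℝ) :
    Submodule ℝ (hdotSub σ Ω) where
  carrier := {u | (u : Sp N → ℝ) ∈ Hzero σ Ω g₁}
  add_mem' {u v} hu hv := by
    refine ⟨(u + v).2, fun p hp => ?_⟩
    have e : (fun x => ((u + v : hdotSub σ Ω) : Sp N → ℝ) x * p x) =
        fun x => (u : Sp N → ℝ) x * p x + (v : Sp N → ℝ) x * p x := by
      ext x
      simp [add_mul]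
    rw [e]
    exact ⟨(hu.2 p hp).1.add (hv.2 p hp).1, by
      rw [integral_add (hu.2 p hp).1 (hv.2 p hp).1, (hu.2 p hp).2, (hv.2 p hp).2, add_zero]⟩
  zero_mem' := ⟨(0 : hdotSub σ Ω).2, fun p _ => by simp⟩
  smul_mem' c u hu := by
    refine ⟨(c • u).2, fun p hp => ?_⟩
    have e : (fun x => ((c • u : hdotSub σ Ω) : Sp N → ℝ) x * p x) =
        fun x => c * ((u : Sp N → ℝ) x * p x) := by
      ext x
      simp [mul_assoc]
    rw [e]
    exact ⟨(hu.2 p hp).1.const_mul c, by rw [integral_const_mul, (hu.2 p hp).2, mul_zero]⟩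

/-- The image of `H^{s,0}_{g₁}(Ω)` under the gradient map is closed: by the spectral condition,
convergence of the gradient differences entails convergence in `L²(μ_{g₁})`. -/
theorem isClosed_map_hzeroSub (hσ : 0 < σ) (hΩ : IsOpen Ω) (hne : Ω.Nonempty)
    (hb : Bornology.IsBounded Ω) (hg : IntegrableOn g₁ Ωᶜ)
    (hg' : IntegrableOn (fun x => ‖x‖ ^ 2 * g₁ x) Ωᶜ) (h : 0 < lambda1 σ Ω g₁) :
    IsClosed ((hzeroSub σ Ω g₁).map (gradMap σ Ω) : Set (Lp (Sp N) 2 (kernelMeasure σ Ω))) := by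
  obtain ⟨C, hC⟩ := exists_eLpNorm_mu_le_of_lambda1_pos h
  refine isClosed_of_closure_subset fun k hk => ?_
  -- a geometric rate of approximation makes the Cauchy bounds summable
  have hex : ∀ n : ℕ, ∃ u : hdotSub σ Ω, u ∈ hzeroSub σ Ω g₁ ∧
      edist k (gradMap σ Ω u) < (2⁻¹ : ℝ≥0∞) ^ n := by
    intro n
    obtain ⟨_, ⟨u, hu, rfl⟩, hd⟩ := EMetric.mem_closure_iff.1 hk ((2⁻¹ : ℝ≥0∞) ^ n)
      (ENNReal.pow_pos (by simp) n)
    exact ⟨u, hu, hd⟩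
  choose u hu hd using hex
  have hε : ∀ {K n : ℕ}, K ≤ n → edist k (gradMap σ Ω (u n)) < (2⁻¹ : ℝ≥0∞) ^ K := fun {K n} hn =>
    (hd n).trans_le (pow_le_pow_right_of_le_one' (by simp) hn)
  have hcau : ∀ K n m : ℕ, K ≤ n → K ≤ m →
      eLpNorm (gradDiff (u n : Sp N → ℝ) - gradDiff (u m : Sp N → ℝ)) 2 (kernelMeasure σ Ω) +
        eLpNorm ((u n : Sp N → ℝ) - (u m : Sp N → ℝ)) 2 (mu Ω g₁) <
        (1 + C) * 2 * (2⁻¹ : ℝ≥0∞) ^ K := by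
    intro K n m hn hm
    have h1 : edist (gradMap σ Ω (u n)) (gradMap σ Ω (u m)) < 2 * (2⁻¹ : ℝ≥0∞) ^ K := by
      rw [two_mul]
      refine (edist_triangle_left _ _ k).trans_lt (ENNReal.add_lt_add (hε hn) (hε hm))
    have h2 := hC _ ((hzeroSub σ Ω g₁).sub_mem (hu n) (hu m))
    rw [← enorm_gradMap, map_sub, ← edist_eq_enorm_sub] at h2
    rw [← edist_gradMap]
    refine lt_of_le_of_lt
      (b := (1 + C : ℝ≥0∞) * edist (gradMap σ Ω (u n)) (gradMap σ Ω (u m))) ?_ ?_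
    · rw [add_mul, one_mul]
      exact add_le_add le_rfl h2
    · rw [mul_assoc]
      exact (ENNReal.mul_lt_mul_iff_right (by simp) (by finiteness)).2 h1
  have hum : ∀ n, MemLp (u n : Sp N → ℝ) 2 (mu Ω g₁) := fun n => memLp_of_mem_Hzero h (hu n)
  have hugm : ∀ n, MemLp (gradDiff (u n : Sp N → ℝ)) 2 (kernelMeasure σ Ω) := fun n =>
    memLp_gradDiff (u n).2.1 (u n).2.2
  obtain ⟨v, hv, hv1, hv2⟩ := exists_weaklyDiff_limit hσ hΩ hne hb (m := mu Ω g₁)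
    mu_absolutelyContinuous (restrict_le_mu hΩ) (u := fun n => (u n : Sp N → ℝ))
    (fun n => (u n).2.1) (fun n => (hugm n).2) (fun n => (hum n).2)
    (B := fun K => (1 + C) * 2 * (2⁻¹ : ℝ≥0∞) ^ K)
    (by
      rw [ENNReal.tsum_mul_left, ENNReal.tsum_geometric, ENNReal.one_sub_inv_two, inv_inv]
      finiteness) hcau
  have hvm : MemLp v 2 (mu Ω g₁) := Lp.memLp_of_cauchy_tendsto one_le_two hum v
    ((isWeakGrad_wgrad hv).locInt.aestronglyMeasurable.mono_ac mu_absolutelyContinuous) hv2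
  have hvg : MemLp (gradDiff v) 2 (kernelMeasure σ Ω) := Lp.memLp_of_cauchy_tendsto one_le_two hugm
    _ (aestronglyMeasurable_gradDiff hv σ Ω) hv1
  have hvd : v ∈ Hdot σ Ω := ⟨hv, by rw [energy_eq]; exact ENNReal.pow_lt_top hvg.2⟩
  refine ⟨⟨v, hvd⟩, ⟨hvd, fun p hp => ?_⟩, ?_⟩
  · obtain ⟨a, b, rfl⟩ := exists_eq_aff hp
    have hpm := memLp_aff_mu hΩ hb hg hg' a b
    refine ⟨hvm.integrable_mul hpm, ?_⟩
    have ht := tendsto_integral_smul_of_eLpNorm hpm hum hvm hv2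
    have e : ∀ w : Sp N → ℝ, ∫ x, aff a b x • w x ∂(mu Ω g₁) = ∫ x, w x * aff a b x ∂(mu Ω g₁) :=
      fun w => by simp only [smul_eq_mul, mul_comm]
    have e0 : ∀ n, ∫ x, (u n : Sp N → ℝ) x * aff a b x ∂(mu Ω g₁) = 0 := fun n =>
      ((hu n).2 _ (aff_mem_P1 a b)).2
    simp only [e, e0] at ht
    exact tendsto_nhds_unique ht tendsto_const_nhds
  · have h1 : Tendsto (fun n => gradMap σ Ω (u n)) atTop (𝓝 k) := by
      rw [tendsto_iff_edist_tendsto_0]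
      refine tendsto_of_tendsto_of_tendsto_of_le_of_le tendsto_const_nhds
        (ENNReal.tendsto_pow_atTop_nhds_zero_of_lt_one (r := 2⁻¹) (by simp)) (fun _ => zero_le)
        fun n => ?_
      dsimp only
      rw [edist_comm]
      exact (hd n).le
    have h2 : Tendsto (fun n => gradMap σ Ω (u n)) atTop (𝓝 (gradMap σ Ω ⟨v, hvd⟩)) := by
      rw [tendsto_iff_edist_tendsto_0]
      refine hv1.congr fun n => ?_
      rw [edist_gradMap]
    exact tendsto_nhds_unique h2 h1

end Spectral

/-! ### The load functional and the Riesz representation -/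

section Load

/-- The Riesz representation of a functional dominated by `‖G ·‖`, for a linear map `G` whose
image of the subspace `W` is complete. -/
theorem exists_riesz_of_le {E K : Type*} [AddCommGroup E] [Module ℝ E] [NormedAddCommGroup K]
    [InnerProductSpace ℝ K] (G : E →ₗ[ℝ] K) [CompleteSpace (LinearMap.range G)] (ℓ : E →ₗ[ℝ] ℝ)
    (C : ℝ) (hb : ∀ v, |ℓ v| ≤ C * ‖G v‖) : ∃ u, ∀ v, inner ℝ (G u) (G v) = ℓ v := by
  obtain ⟨g, hg⟩ := G.rangeRestrict.exists_rightInverse_of_surjective G.range_rangeRestrict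
  have hg' : ∀ k, G (g k) = k := fun k => congrArg Subtype.val (LinearMap.congr_fun hg k)
  let L : StrongDual ℝ (LinearMap.range G) := (ℓ.comp g).mkContinuous C fun k => by
    rw [LinearMap.comp_apply, Real.norm_eq_abs]
    refine (hb _).trans_eq ?_
    rw [hg']
    rfl
  obtain ⟨u, hu⟩ := ((InnerProductSpace.toDual ℝ (LinearMap.range G)).symm L).2
  refine ⟨u, fun v => ?_⟩
  have h1 : inner ℝ ((InnerProductSpace.toDual ℝ (LinearMap.range G)).symm L) (G.rangeRestrict v) =
      L (G.rangeRestrict v) := InnerProductSpace.toDual_symm_apply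
  rw [Submodule.coe_inner, ← hu] at h1
  refine Eq.trans h1 ?_
  -- `G` need not be injective, but `ℓ` vanishes on its kernel
  have h2 : |ℓ (g (G.rangeRestrict v) - v)| ≤ 0 := by
    refine (hb _).trans_eq ?_
    rw [map_sub, hg']
    simp
  rw [map_sub, abs_nonpos_iff, sub_eq_zero] at h2
  exact h2

variable {N : ℕ} {Ω : Set (Sp N)} {f g₁ g₂ : Sp N → ℝ} {σ : ℝ}

open Classical in
/-- A trace of `v` on `∂Ω`, and `0` if there is none. -/
noncomputable def tr (Ω : Set (Sp N)) (v : Sp N → ℝ) : Sp N → ℝ :=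
  if h : ∃ w, IsTrace Ω v w then h.choose else 0

/-- The load `∫_Ω f v + ∫_{ℝ^N ∖ Ω} g₁ v + ∫_{∂Ω} g₂ v`. -/
noncomputable def load (Ω : Set (Sp N)) (f g₁ g₂ v : Sp N → ℝ) : ℝ :=
  (∫ x in Ω, f x * v x) + (∫ x in Ωᶜ, g₁ x * v x) + ∫ x, g₂ x * tr Ω v x ∂(surf Ω)

/-- Elements of `H^s_N` are `H¹` on every ball; in particular they have traces. -/
theorem memLp_ball_of_mem_HN (hσ : 0 < σ) (hΩ : IsBoundedC11Domain Ω)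
    (hg : AEStronglyMeasurable g₁ (volume.restrict Ωᶜ)) {v : Sp N → ℝ} (hv : v ∈ HN σ Ω g₁)
    (R : ℝ) : MemLp v 2 (volume.restrict (Metric.ball 0 R)) ∧
      MemLp (wgrad v) 2 (volume.restrict (Metric.ball 0 R)) := by
  rw [mem_HN_iff hΩ.isOpen hg] at hv
  obtain ⟨C, hC⟩ := exists_eLpNorm_H1_ball_le hσ hΩ.isOpen hΩ.isConnected.nonempty hΩ.isBounded R
  have hw := isWeakGrad_wgrad hv.1.1
  have h := (hC v hv.1.1).trans_lt (ENNReal.mul_lt_top ENNReal.coe_lt_top (ENNReal.add_lt_top.2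
    ⟨(memLp_gradDiff hv.1.1 hv.1.2).2, (hv.2.mono_measure (restrict_le_mu hΩ.isOpen)).2⟩))
  rw [ENNReal.add_lt_top] at h
  exact ⟨⟨hw.locInt.aestronglyMeasurable.restrict, h.1⟩,
    ⟨hw.locInt_grad.aestronglyMeasurable.restrict, h.2⟩⟩

theorem isTrace_tr (hσ : 0 < σ) (hΩ : IsBoundedC11Domain Ω)
    (hg : AEStronglyMeasurable g₁ (volume.restrict Ωᶜ)) {v : Sp N → ℝ} (hv : v ∈ HN σ Ω g₁) :
    IsTrace Ω v (tr Ω v) := by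
  have h := exists_isTrace hΩ hv.1 (fun R => (memLp_ball_of_mem_HN hσ hΩ hg hv R).1)
    fun R => (memLp_ball_of_mem_HN hσ hΩ hg hv R).2
  rw [tr, dif_pos h]
  exact h.choose_spec

theorem load_eq_of_isTrace (hσ : 0 < σ) (hΩ : IsBoundedC11Domain Ω)
    (hg : AEStronglyMeasurable g₁ (volume.restrict Ωᶜ)) {v w : Sp N → ℝ} (hv : v ∈ HN σ Ω g₁)
    (h : IsTrace Ω v w) :
    load Ω f g₁ g₂ v =
      (∫ x in Ω, f x * v x) + (∫ x in Ωᶜ, g₁ x * v x) + ∫ x, g₂ x * w x ∂(surf Ω) := by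
  rw [load]
  congr 1
  refine integral_congr_ae ?_
  filter_upwards [(isTrace_tr hσ hΩ hg hv).ae_eq hΩ hv.1 h] with x hx
  rw [hx]

/-- The exterior load is bounded by the `L²(μ_{g₁})` norm, by the Cauchy-Schwarz inequality with
weight `|g₁|`. -/
theorem lintegral_enorm_mul_sq_le (hΩ : IsOpen Ω)
    (hg : AEStronglyMeasurable g₁ (volume.restrict Ωᶜ))
    {v : Sp N → ℝ} (hv : AEStronglyMeasurable v volume) :
    (∫⁻ x in Ωᶜ, ‖g₁ x * v x‖ₑ) ^ 2 ≤
      (∫⁻ x in Ωᶜ, ‖g₁ x‖ₑ) * eLpNorm v 2 (mu Ω g₁) ^ 2 := by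
  simp only [enorm_mul]
  refine (sq_lintegral_mul_le hg.enorm hv.enorm.restrict).trans ?_
  rw [eLpNorm_two_sq, lintegral_mu hΩ hg (hv.enorm.pow_const 2)]
  gcongr
  exact le_add_self

theorem integrableOn_compl_mul (hΩ : IsOpen Ω) (hg : IntegrableOn g₁ Ωᶜ) {v : Sp N → ℝ}
    (hv : AEStronglyMeasurable v volume) (hv2 : MemLp v 2 (mu Ω g₁)) :
    IntegrableOn (fun x => g₁ x * v x) Ωᶜ := by
  refine ⟨hg.1.mul hv.restrict, ?_⟩
  have h := (lintegral_enorm_mul_sq_le hΩ hg.1 hv).trans_lt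
    (ENNReal.mul_lt_top hg.2 (ENNReal.pow_lt_top hv2.2))
  exact (ENNReal.pow_lt_top_iff.1 h).resolve_right two_ne_zero

theorem load_add (hσ : 0 < σ) (hΩ : IsBoundedC11Domain Ω) (hd : Admissible σ Ω f g₁ g₂)
    {u v : Sp N → ℝ} (hu : u ∈ HN σ Ω g₁) (hv : v ∈ HN σ Ω g₁) :
    load Ω f g₁ g₂ (u + v) = load Ω f g₁ g₂ u + load Ω f g₁ g₂ v := by
  have hg := hd.g₁_L1.1
  have tu := isTrace_tr hσ hΩ hg hu
  have tv := isTrace_tr hσ hΩ hg hv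
  rw [load_eq_of_isTrace hσ hΩ hg (add_mem_HN hΩ.isOpen hg hu hv) (tu.add hu.1 hv.1 tv), load, load]
  have hu' := ((mem_HN_iff hΩ.isOpen hg).1 hu).2
  have hv' := ((mem_HN_iff hΩ.isOpen hg).1 hv).2
  have hum := (isWeakGrad_wgrad hu.1).locInt.aestronglyMeasurable
  have hvm := (isWeakGrad_wgrad hv.1).locInt.aestronglyMeasurable
  have hle := restrict_le_mu (g₁ := g₁) hΩ.isOpen
  have i₁ {w : Sp N → ℝ} (hw : MemLp w 2 (mu Ω g₁)) :
      Integrable (fun x => f x * w x) (volume.restrict Ω) :=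
    hd.f_L2.integrable_mul (hw.mono_measure hle)
  have i₂ {w : Sp N → ℝ} (hw : MemLp w 2 (surf Ω)) :
      Integrable (fun x => g₂ x * w x) (surf Ω) := hd.g₂_L2.integrable_mul hw
  simp only [Pi.add_apply, mul_add]
  rw [integral_add (i₁ hu') (i₁ hv'),
    integral_add (integrableOn_compl_mul hΩ.isOpen hd.g₁_L1 hum hu')
      (integrableOn_compl_mul hΩ.isOpen hd.g₁_L1 hvm hv'),
    integral_add (i₂ tu.1) (i₂ tv.1)]
  ring

theorem load_smul (hσ : 0 < σ) (hΩ : IsBoundedC11Domain Ω) (hd : Admissible σ Ω f g₁ g₂) (c : ℝ)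
    {u : Sp N → ℝ} (hu : u ∈ HN σ Ω g₁) :
    load Ω f g₁ g₂ (c • u) = c * load Ω f g₁ g₂ u := by
  have hg := hd.g₁_L1.1
  rw [load_eq_of_isTrace hσ hΩ hg (smul_mem_HN hΩ.isOpen hg c hu)
    ((isTrace_tr hσ hΩ hg hu).smul c hu.1), load]
  simp only [Pi.smul_apply, smul_eq_mul, mul_left_comm _ c, integral_const_mul]
  ring

theorem enorm_integral_mul_le {X : Type*} [MeasurableSpace X] {m : Measure X} {a b : X → ℝ}
    (ha : AEStronglyMeasurable a m) (hb : AEStronglyMeasurable b m) :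
    ‖∫ x, a x * b x ∂m‖ₑ ≤ eLpNorm a 2 m * eLpNorm b 2 m := by
  refine (enorm_integral_le_lintegral_enorm _).trans ?_
  rw [← eLpNorm_one_eq_lintegral_enorm]
  exact eLpNorm_smul_le_mul_eLpNorm (φ := a) hb ha

/-- The load is bounded on `H^{s,0}_{g₁}(Ω)` for the energy. -/
theorem exists_abs_load_le (hσ : 0 < σ) (hΩ : IsBoundedC11Domain Ω)
    (hd : Admissible σ Ω f g₁ g₂) :
    ∃ C : ℝ, ∀ v : hdotSub σ Ω, v ∈ hzeroSub σ Ω g₁ →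
      |load Ω f g₁ g₂ v| ≤ C * ‖gradMap σ Ω v‖ := by
  have hg := hd.g₁_L1.1
  obtain ⟨C₁, h₁⟩ := exists_eLpNorm_mu_le_of_lambda1_pos hd.g₁_spectral
  obtain ⟨R, hR⟩ := hΩ.isBounded.subset_ball 0
  obtain ⟨C₂, h₂⟩ := exists_eLpNorm_H1_ball_le hσ hΩ.isOpen hΩ.isConnected.nonempty hΩ.isBounded R
  obtain ⟨C₃, h₃⟩ := exists_eLpNorm_trace_le hΩ
  obtain ⟨C₄, h₄⟩ := exists_le_coe_sq (K := ∫⁻ x in Ωᶜ, ‖g₁ x‖ₑ) hd.g₁_L1.2.ne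
  set D : ℝ≥0∞ := eLpNorm f 2 (volume.restrict Ω) * C₁ + C₄ * C₁ +
    eLpNorm g₂ 2 (surf Ω) * (C₃ * (C₂ * (1 + C₁))) with hD
  have hDfin : D ≠ ⊤ := by
    have := hd.f_L2.2.ne
    have := hd.g₂_L2.2.ne
    finiteness
  refine ⟨D.toReal, fun v hv => ?_⟩
  have hv' := memLp_of_mem_Hzero hd.g₁_spectral hv
  have hvN : (v : Sp N → ℝ) ∈ HN σ Ω g₁ := (mem_HN_iff hΩ.isOpen hg).2 ⟨v.2, hv'⟩
  have ht := isTrace_tr hσ hΩ hg hvN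
  have hvm := (isWeakGrad_wgrad hvN.1).locInt.aestronglyMeasurable
  set A := ‖gradMap σ Ω v‖ₑ with hA
  have hmu : eLpNorm (v : Sp N → ℝ) 2 (mu Ω g₁) ≤ C₁ * A := by
    rw [hA, enorm_gradMap]
    exact h₁ _ hv
  have hvΩ : eLpNorm (v : Sp N → ℝ) 2 (volume.restrict Ω) ≤ C₁ * A :=
    (eLpNorm_mono_measure _ (restrict_le_mu hΩ.isOpen)).trans hmu
  have b1 : ‖∫ x in Ω, f x * (v : Sp N → ℝ) x‖ₑ ≤
      eLpNorm f 2 (volume.restrict Ω) * (C₁ * A) :=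
    (enorm_integral_mul_le hd.f_L2.1 hvm.restrict).trans (by gcongr)
  have b2 : ‖∫ x in Ωᶜ, g₁ x * (v : Sp N → ℝ) x‖ₑ ≤ C₄ * (C₁ * A) := by
    refine (enorm_integral_le_lintegral_enorm _).trans
      ((ENNReal.pow_le_pow_left_iff two_ne_zero).1 ?_)
    rw [mul_pow]
    exact (lintegral_enorm_mul_sq_le hΩ.isOpen hg hvm).trans (by gcongr)
  have b3 : ‖∫ x, g₂ x * tr Ω v x ∂(surf Ω)‖ₑ ≤
      eLpNorm g₂ 2 (surf Ω) * (C₃ * (C₂ * (A + C₁ * A))) := by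
    refine (enorm_integral_mul_le hd.g₂_L2.1 ht.1.1).trans ?_
    refine mul_le_mul_right ((h₃ _ _ hvN.1 ht).trans (mul_le_mul_right ?_ _)) _
    refine (add_le_add (eLpNorm_mono_measure _ (Measure.restrict_mono hR le_rfl))
      (eLpNorm_mono_measure _ (Measure.restrict_mono hR le_rfl))).trans ((h₂ _ hvN.1).trans ?_)
    rw [← enorm_gradMap]
    gcongr
  have hb : ‖load Ω f g₁ g₂ v‖ₑ ≤ D * A := by
    calc ‖load Ω f g₁ g₂ v‖ₑ ≤ _ :=
          (enorm_add_le _ _).trans (add_le_add ((enorm_add_le _ _).trans (add_le_add b1 b2)) b3)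
      _ = D * A := by
          rw [hD]
          ring
  have h5 := ENNReal.toReal_mono (ENNReal.mul_ne_top hDfin (by simp [hA])) hb
  simpa [hA] using h5

/-- Every element of `H^s_N` is the sum of an affine function and a function orthogonal to the
affine functions in `L²(μ_{g₁})`. -/
theorem exists_sub_aff_mem_Hzero (hΩ : IsOpen Ω) (hb : Bornology.IsBounded Ω)
    (hg : IntegrableOn g₁ Ωᶜ) (hg' : IntegrableOn (fun x => ‖x‖ ^ 2 * g₁ x) Ωᶜ)
    {v : Sp N → ℝ} (hv : v ∈ HN σ Ω g₁) : ∃ a b, v - aff a b ∈ Hzero σ Ω g₁ := by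
  rw [mem_HN_iff hΩ hg.1] at hv
  have hm : ∀ p : ℝ × Sp N, MemLp (aff p.1 p.2) 2 (mu Ω g₁) := fun p =>
    memLp_aff_mu hΩ hb hg hg' p.1 p.2
  let T : (ℝ × Sp N) →ₗ[ℝ] Lp ℝ 2 (mu Ω g₁) :=
    { toFun := fun p => (hm p).toLp _
      map_add' := fun p q => by
        rw [← MemLp.toLp_add]
        congr 1
        ext x
        simp only [aff, Prod.fst_add, Prod.snd_add, inner_add_left, Pi.add_apply]
        ring
      map_smul' := fun c p => by
        rw [RingHom.id_apply, ← MemLp.toLp_const_smul]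
        congr 1
        ext x
        simp only [aff, Prod.smul_fst, Prod.smul_snd, real_inner_smul_left, Pi.smul_apply,
          smul_eq_mul]
        ring }
  obtain ⟨_, ⟨p, rfl⟩, z, hz, hvz⟩ :=
    (LinearMap.range T).exists_add_mem_mem_orthogonal (hv.2.toLp v)
  have hsub := add_mem_Hdot hv.1 (smul_mem_Hdot (-1) (aff_mem_Hdot (σ := σ) (Ω := Ω) p.1 p.2))
  rw [neg_one_smul, ← sub_eq_add_neg] at hsub
  refine ⟨p.1, p.2, hsub, fun q hq => ?_⟩
  obtain ⟨a, b, rfl⟩ := exists_eq_aff hq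
  refine ⟨(hv.2.sub (hm p)).integrable_mul (hm (a, b)), ?_⟩
  have h0 := hz (T (a, b)) ⟨_, rfl⟩
  have hz' : z = hv.2.toLp v - T p := by
    rw [hvz]
    abel
  rw [hz', L2.inner_def] at h0
  rw [← h0]
  refine integral_congr_ae ?_
  filter_upwards [(hm (a, b)).coeFn_toLp, (hm p).coeFn_toLp, hv.2.coeFn_toLp,
    Lp.coeFn_sub (hv.2.toLp v) (T p)] with x h1 h2 h3 h4
  rw [h4]
  change _ = inner ℝ (((hm (a, b)).toLp _ : Sp N → ℝ) x)
    ((hv.2.toLp v : Sp N → ℝ) x - ((hm p).toLp _ : Sp N → ℝ) x)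
  rw [h1, h2, h3]
  simp

theorem aff_mem_HN (hΩ : IsBoundedC11Domain Ω) (hd : Admissible σ Ω f g₁ g₂) (a : ℝ) (b : Sp N) :
    aff a b ∈ HN σ Ω g₁ :=
  (mem_HN_iff hΩ.isOpen hd.g₁_L1.1).2 ⟨aff_mem_Hdot a b,
    memLp_aff_mu hΩ.isOpen hΩ.isBounded hd.g₁_L1 hd.g₁_L1_weight a b⟩

theorem load_aff (hσ : 0 < σ) (hΩ : IsBoundedC11Domain Ω) (hd : Admissible σ Ω f g₁ g₂) (a : ℝ)
    (b : Sp N) : load Ω f g₁ g₂ (aff a b) = (∫ x in Ω, f x * aff a b x) +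
      (∫ x in Ωᶜ, g₁ x * aff a b x) + ∫ x, g₂ x * aff a b x ∂(surf Ω) :=
  load_eq_of_isTrace hσ hΩ hd.g₁_L1.1 (aff_mem_HN hΩ hd a b) (isTrace_aff hΩ a b)

end Load

/-! ### Weak solutions -/

section Solutions

variable {N : ℕ} [NeZero N] {Ω : Set (Sp N)} {f g₁ g₂ : Sp N → ℝ} {σ : ℝ}

/-- The weak formulation with a fixed choice of traces. -/
theorem isWeakSol_iff (hσ : 0 < σ) (hΩ : IsBoundedC11Domain Ω)
    (hg : AEStronglyMeasurable g₁ (volume.restrict Ωᶜ)) {u : Sp N → ℝ} :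
    IsWeakSol σ Ω f g₁ g₂ u ↔ u ∈ HN σ Ω g₁ ∧ ∀ v ∈ HN σ Ω g₁,
      cNs N σ / 2 * form σ Ω u v = load Ω f g₁ g₂ v := by
  refine and_congr_right fun _ => forall₂_congr fun v hv => ⟨?_, fun h => ?_⟩
  · rintro ⟨w, hw, h⟩
    rw [h, load_eq_of_isTrace hσ hΩ hg hv hw]
  · exact ⟨tr Ω v, isTrace_tr hσ hΩ hg hv, h⟩

/-- A weak solution exists when the load vanishes on affine functions. It is obtained in
`H^{s,0}_{g₁}(Ω)`, and the equation extends to all test functions since affine functions contribute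
nothing to either side. -/
theorem exists_isWeakSol (hσ : σ ∈ Ioo (0 : ℝ) 1) (hΩ : IsBoundedC11Domain Ω)
    (hd : Admissible σ Ω f g₁ g₂) (h : ∀ a b, load Ω f g₁ g₂ (aff a b) = 0) :
    ∃ u, IsWeakSol σ Ω f g₁ g₂ u := by
  have hg := hd.g₁_L1.1
  have hN : ∀ v : hzeroSub σ Ω g₁, ((v : hdotSub σ Ω) : Sp N → ℝ) ∈ HN σ Ω g₁ := fun v =>
    (mem_HN_iff hΩ.isOpen hg).2 ⟨v.1.2, memLp_of_mem_Hzero hd.g₁_spectral v.2⟩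
  let ℓ : hzeroSub σ Ω g₁ →ₗ[ℝ] ℝ :=
    { toFun := fun v => load Ω f g₁ g₂ ((v : hdotSub σ Ω) : Sp N → ℝ)
      map_add' := fun u v => load_add hσ.1 hΩ hd (hN u) (hN v)
      map_smul' := fun c u => load_smul hσ.1 hΩ hd c (hN u) }
  let G := (gradMap σ Ω).comp (hzeroSub σ Ω g₁).subtype
  have hcl := isClosed_map_hzeroSub hσ.1 hΩ.isOpen hΩ.isConnected.nonempty hΩ.isBounded hd.g₁_L1
    hd.g₁_L1_weight hd.g₁_spectral
  have hrange : LinearMap.range G = (hzeroSub σ Ω g₁).map (gradMap σ Ω) := by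
    rw [LinearMap.range_comp, Submodule.range_subtype]
  have hcomp : CompleteSpace (LinearMap.range G) := by
    rw [hrange]
    exact hcl.completeSpace_coe
  obtain ⟨C, hC⟩ := exists_abs_load_le hσ.1 hΩ hd
  have hc := cNs_pos N hσ
  obtain ⟨u, hu⟩ := exists_riesz_of_le (E := hzeroSub σ Ω g₁)
      (K := Lp (Sp N) 2 (kernelMeasure σ Ω)) G ((cNs N σ / 2)⁻¹ • ℓ) ((cNs N σ / 2)⁻¹ * C)
      fun v => by
    rw [LinearMap.smul_apply, smul_eq_mul, abs_mul, abs_of_pos (by positivity), mul_assoc]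
    exact mul_le_mul_of_nonneg_left (hC v v.2) (by positivity)
  refine ⟨_, (isWeakSol_iff hσ.1 hΩ hg).2 ⟨hN u, fun v hv => ?_⟩⟩
  obtain ⟨a, b, hv0⟩ := exists_sub_aff_mem_Hzero hΩ.isOpen hΩ.isBounded hd.g₁_L1 hd.g₁_L1_weight hv
  let v₀ : hzeroSub σ Ω g₁ := ⟨⟨v - aff a b, hv0.1⟩, hv0⟩
  let p : hdotSub σ Ω := ⟨aff a b, aff_mem_Hdot a b⟩
  have hvd := ((mem_HN_iff hΩ.isOpen hg).1 hv).1
  have hdec : (⟨v, hvd⟩ : hdotSub σ Ω) = v₀ + p := Subtype.ext (by simp [v₀, p])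
  have h1 := hu v₀
  rw [LinearMap.smul_apply, smul_eq_mul] at h1
  have h2 : form σ Ω ((u : hdotSub σ Ω) : Sp N → ℝ) v = (cNs N σ / 2)⁻¹ * ℓ v₀ := by
    rw [← h1]
    refine (form_eq_inner (u : hdotSub σ Ω) ⟨v, hvd⟩).trans ?_
    rw [hdec, map_add, gradMap_aff, add_zero]
    rfl
  have h3 : load Ω f g₁ g₂ v = ℓ v₀ := by
    have := load_add hσ.1 hΩ hd (hN v₀) (aff_mem_HN hΩ hd a b)
    rw [h, add_zero] at this
    rw [← show _ = ℓ v₀ from this]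
    simp [v₀]
  rw [h2, h3, ← mul_assoc, mul_inv_cancel₀ (by positivity), one_mul]

end Solutions

end FracNeumann

theorem theorem1p1 (N : ℕ) [NeZero N] (σ : ℝ) (hσ : σ ∈ Set.Ioo (0 : ℝ) 1)
    (Ω : Set (FracNeumann.Sp N)) (hΩ : FracNeumann.IsBoundedC11Domain Ω)
    (f g₁ g₂ : FracNeumann.Sp N → ℝ) (hdata : FracNeumann.Admissible σ Ω f g₁ g₂) :
    ((∃ u, FracNeumann.IsWeakSol σ Ω f g₁ g₂ u) ↔
      ∀ p ∈ FracNeumann.P1 N,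
        (∫ x in Ω, f x * p x) + (∫ x in Ωᶜ, g₁ x * p x) +
          ∫ x, g₂ x * p x ∂(FracNeumann.surf Ω) = 0) ∧
    (∀ u, FracNeumann.IsWeakSol σ Ω f g₁ g₂ u →
      ∀ v, FracNeumann.IsWeakSol σ Ω f g₁ g₂ v ↔
        ∃ p ∈ FracNeumann.P1 N, v =ᵐ[volume] fun x => u x + p x) := by
  open FracNeumann in
  have hg := hdata.g₁_L1.1
  have hc := cNs_pos N hσ
  refine ⟨⟨?_, fun h => ?_⟩, fun u hu v => ⟨fun hv => ?_, ?_⟩⟩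
  · rintro ⟨u, hu⟩ p hp
    obtain ⟨a, b, rfl⟩ := exists_eq_aff hp
    rw [isWeakSol_iff hσ.1 hΩ hg] at hu
    have hud := ((mem_HN_iff hΩ.isOpen hg).1 hu.1).1
    rw [← load_aff hσ.1 hΩ hdata, ← hu.2 _ (aff_mem_HN hΩ hdata a b)]
    have h1 : form σ Ω u (aff a b) = 0 := by
      refine (form_eq_inner (⟨u, hud⟩ : hdotSub σ Ω) ⟨aff a b, aff_mem_Hdot a b⟩).trans ?_
      rw [gradMap_aff, inner_zero_right]
    rw [h1, mul_zero]
  · refine exists_isWeakSol hσ hΩ hdata fun a b => ?_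
    rw [load_aff hσ.1 hΩ hdata]
    exact h _ (aff_mem_P1 a b)
  · rw [isWeakSol_iff hσ.1 hΩ hg] at hu hv
    have hud := ((mem_HN_iff hΩ.isOpen hg).1 hu.1).1
    have hvd := ((mem_HN_iff hΩ.isOpen hg).1 hv.1).1
    have hw := sub_mem_HN hΩ.isOpen hg hv.1 hu.1
    let U : hdotSub σ Ω := ⟨u, hud⟩
    let V : hdotSub σ Ω := ⟨v, hvd⟩
    -- test both equations with the difference
    have h1 := mul_left_cancel₀ (by positivity : cNs N σ / 2 ≠ 0)
      ((hv.2 _ hw).trans (hu.2 _ hw).symm)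
    have h2 : inner ℝ (gradMap σ Ω V) (gradMap σ Ω (V - U)) =
        inner ℝ (gradMap σ Ω U) (gradMap σ Ω (V - U)) :=
      (form_eq_inner V (V - U)).symm.trans (h1.trans (form_eq_inner U (V - U)))
    rw [← sub_eq_zero, ← inner_sub_left, ← map_sub, inner_self_eq_zero] at h2
    have h3 : gradDiff (v - u) =ᵐ[kernelMeasure σ Ω] 0 := by
      have e := coeFn_gradMap (V - U)
      rw [h2] at e
      exact e.symm.trans (Lp.coeFn_zero _ _ _)
    obtain ⟨a, b, hab⟩ := exists_ae_eq_aff_of_gradDiff_ae_eq_zero hΩ.isOpen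
      hΩ.isConnected.nonempty hw.1 hσ.1 h3
    refine ⟨aff a b, aff_mem_P1 a b, ?_⟩
    filter_upwards [hab] with x hx
    rw [← hx, Pi.sub_apply]
    ring
  · rintro ⟨p, hp, hvp⟩
    obtain ⟨a, b, rfl⟩ := exists_eq_aff hp
    rw [isWeakSol_iff hσ.1 hΩ hg] at hu ⊢
    have hup := add_mem_HN hΩ.isOpen hg hu.1 (aff_mem_HN hΩ hdata a b)
    have hvp' : u + aff a b =ᵐ[volume] v := hvp.symm
    refine ⟨HN_congr hΩ.isOpen hg hup hvp', fun w hw => ?_⟩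
    rw [form_congr_of_ae hup.1 hvp', ← hu.2 w hw]
    have hud := ((mem_HN_iff hΩ.isOpen hg).1 hu.1).1
    have hwd := ((mem_HN_iff hΩ.isOpen hg).1 hw).1
    let U : hdotSub σ Ω := ⟨u, hud⟩
    let P : hdotSub σ Ω := ⟨aff a b, aff_mem_Hdot a b⟩
    congr 1
    refine (form_eq_inner (U + P) ⟨w, hwd⟩).trans (Eq.trans ?_ (form_eq_inner U ⟨w, hwd⟩).symm)
    rw [map_add, gradMap_aff, add_zero]
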